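/- **Setting.** Let $M=N=\mathbb Z^d$ with the standard pairing, let $\Delta\subset M_{\mathbb R}$ be a reflexive polytope (a lattice polytope whose dual $\Delta^*=\{x\in N_{\mathbb R}:\langle y,x\rangle\ge -1\ \forall y\in\Delta\}$ is a lattice polytope), and let $\{\Delta_1,\dots,\Delta_r\}$ be a nef partition of $\Delta$: the vertex set of $\Delta^*$ is a disjoint union $E_1\cup\dots\cup E_r$, there are convex functions $\varphi_i:N_{\mathbb R}\to\mathbb R$, given by an element of $M$ on each cone over a proper face of $\Delta^*$, with $\varphi_i=1$ on $E_i$ and $\varphi_i=0$ on the other vertices, and $\Delta_i=\{y\in M_{\mathbb R}:\langle y,z\rangle\ge-\varphi_i(z)\ \forall z\in N_{\mathbb R}\}$. Put $\bar M=\mathbb Z^r\oplus M$, $\bar N=\mathbb Z^r\oplus N$ (with the sum of the standard pairings), $\bar d=d+r$, and let $$C=C_\Delta=\{(\lambda_1,\dots,\lambda_r,\textstyle\sum_i\lambda_iz_i):\lambda_i\ge0,\ z_i\in\Delta_i\}\subset\bar M_{\mathbb R},$$ with dual cone $C^*\subset\bar N_{\mathbb R}$. In $\bar M$ and in $\bar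 N$ the degree $\deg$ of a lattice point is the sum of its first $r$ coordinates. Let $P$ be the poset of faces $C_x$ of $C$, with rank $\rho(x)=\dim C_x$, and let $C_x^*=\{n\in C^*:\langle m,n\rangle=0\ \forall m\in C_x\}$ be the face of $C^*$ corresponding to $x$. For a face $F$ of $C$ or of $C^*$ let $S(F,t)=(1-t)^{\dim F}\sum_m t^{\deg m}$, the sum over the lattice points $m$ of $F$. For an Eulerian poset $Q=[\hat 0,\hat 1]$ of rank $k$ with rank function $\rho$, the polynomials $B(Q;u,v)\in\mathbb Z[u,v]$ are determined recursively by: $B(Q;u,v)=1$ if $k=0$; the $v$-degree of $B(Q;u,v)$ is less than $k/2$ if $k>0$; and $$\sum_{x\in Q}B([\hat 0,x];u^{-1},v^{-1})(uv)^{\rho(x)}(v-u)^{k-\rho(x)}=\sum_{x\in Q}B([x,\hat 1];u,v)(uv-1)^{\rho(x)}.$$ For an interval $I$ of $P$, $I^*$ is the interval with reversed order. The string-theoretic $E$-polynomial $E_{st}(V;u,v)$ of the Calabi–Yau complete intersection $V$ defined by the nef partition is given by the Batyrev–Borisov formula $$E_{st}(V;u,v)=\sum_{I=[x,y]\subseteq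 P}\frac{(-1)^{\rho(y)}}{(uv)^r}(v-u)^{\rho(x)}B(I^*;u,v)(uv-1)^{\bar d-\rho(y)}A_{(x,y)}(u,v),\qquad(1)$$ $$A_{(x,y)}(u,v)=\sum_{m\in\mathrm{Int}(C_x)\cap\bar M,\ n\in\mathrm{Int}(C^*_y)\cap\bar N}\Big(\frac uv\Big)^{\deg m}\Big(\frac1{uv}\Big)^{\deg n},$$ where $\mathrm{Int}$ is the relative interior; that is, $E_{st}(V;u,v)$ is the Laurent polynomial in $\mathbb Z[u^{\pm1},v^{\pm1}]$ which takes the value (1) at all complex $u,v$ with $0<|u|<|v|$ and $|uv|>1$. **Statement.** $P$ is finite, the series $S(C_x,t)$ and $S(C_x^*,t)$ are polynomials, and the polynomials $B$ exist for all intervals of $P$ and of its dual poset $P^*$. The series $A_{(x,y)}(u,v)$, $x\le y$, converge absolutely for $0<|u|<|v|$, $|uv|>1$; there is exactly one Laurent polynomial $E_{st}(V;u,v)$ with values (1) there, and it is $$E_{st}(V;u,v)=\sum_{I=[x,y]\subseteq P}\frac{(-1)^{\rho(x)}u^{\rho(y)}}{(uv)^r}\,S\Big(C_x,\frac vu\Big)\,S\big(C_y^*,uv\big)\,B(I;u^{-1},v).$$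 -/

import Mathlib

namespace StringyE

open scoped Matrix

noncomputable section

/-! ### Laurent polynomials in two variables -/

/-- The ring `ℤ[u, u⁻¹, v, v⁻¹]`. -/
abbrev Laurent : Type := AddMonoidAlgebra ℤ (ℤ × ℤ)

/-- The monomial `u ^ a * v ^ b`. -/
def mon (a b : ℤ) : Laurent := AddMonoidAlgebra.single (a, b) 1

/-- The value of a Laurent polynomial at a pair of (nonzero) complex numbers. -/
def evalAt (u v : ℂ) (E : Laurent) : ℂ := E.coeff.sum fun p a => (a : ℂ) * u ^ p.1 * v ^ p.2

/-! ### B-polynomials of ranked posets -/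

/-- `B x y` is the `B`-polynomial of the interval `[x, y]`, for all intervals of a poset with rank
function `ρ` (the interval `[x, y]` has rank `ρ y - ρ x`). The variable `0` is `u` and the variable
`1` is `v`. -/
structure IsBFamily {P : Type*} [PartialOrder P] (ρ : P → ℕ)
    (B : P → P → MvPolynomial (Fin 2) ℤ) : Prop where
  rank_zero : ∀ x, B x x = 1
  degree_lt : ∀ x y, x < y → 2 * (B x y).degreeOf 1 < ρ y - ρ x
  relation : ∀ x y, x ≤ y →
    ∑ᶠ z ∈ Set.Icc x y,
        MvPolynomial.aeval ![mon (-1) 0, mon 0 (-1)] (B x z) * mon 1 1 ^ (ρ z - ρ x) *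
          (mon 0 1 - mon 1 0) ^ (ρ y - ρ z) =
      ∑ᶠ z ∈ Set.Icc x y,
        MvPolynomial.aeval ![mon 1 0, mon 0 1] (B z y) * (mon 1 1 - 1) ^ (ρ z - ρ x)

open Classical in
/-- The `B`-polynomials of the intervals of a poset with rank function `ρ`: the polynomials `B x y`,
`x ≤ y`, are uniquely determined by `IsBFamily`, and they exist when the poset is Eulerian. -/
def bPoly {P : Type*} [PartialOrder P] (ρ : P → ℕ) : P → P → MvPolynomial (Fin 2) ℤ :=
  if h : ∃ B, IsBFamily ρ B then h.choose else 0

/-! ### Lattice cones in `ℝ^ι`, with the standard pairing and the lattice `ℤ^ι` -/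

section Cones

variable {ι : Type*} [Fintype ι]

/-- An integral vector as a real vector. -/
def toReal (m : ι → ℤ) : ι → ℝ := fun i => (m i : ℝ)

/-- The faces of a cone, ordered by inclusion. -/
abbrev Face (C : PointedCone ℝ (ι → ℝ)) : Type _ :=
  {F : PointedCone ℝ (ι → ℝ) // F.IsFaceOf C}

/-- The dimension of the linear span. -/
def dim (F : Set (ι → ℝ)) : ℕ := Module.finrank ℝ (Submodule.span ℝ F)

/-- The rank function of the face poset. -/
def rank {C : PointedCone ℝ (ι → ℝ)} (x : Face C) : ℕ := dim (x.1 : Set (ι → ℝ))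

/-- The rank function of the dual of the face poset of a full-dimensional cone. -/
def dualRank {C : PointedCone ℝ (ι → ℝ)} (x : (Face C)ᵒᵈ) : ℕ :=
  Fintype.card ι - rank (OrderDual.ofDual x)

/-- The dual cone. -/
def dualCone (C : PointedCone ℝ (ι → ℝ)) : PointedCone ℝ (ι → ℝ) :=
  PointedCone.dual (dotProductBilin ℝ ℝ) (C : Set (ι → ℝ))

/-- The face of the dual cone which corresponds to the face `x`. -/
def dualFace {C : PointedCone ℝ (ι → ℝ)} (x : Face C) : Set (ι → ℝ) :=
  {n | n ∈ dualCone C ∧ ∀ m ∈ x.1, m ⬝ᵥ n = 0}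

/-- `(1 - t) ^ dim F * ∑ t ^ deg m`, the sum over the lattice points `m` of `F`, where
`deg m = ⟨m, w⟩`, as a formal power series. -/
def sSeries (w : ι → ℤ) (F : Set (ι → ℝ)) : PowerSeries ℤ :=
  (1 - PowerSeries.X) ^ dim F *
    PowerSeries.mk fun k => (Nat.card {m : ι → ℤ // toReal m ∈ F ∧ m ⬝ᵥ w = (k : ℤ)} : ℤ)

open Classical in
/-- The polynomial `S(F, t)`: the series `sSeries`, which is a polynomial for the faces of a
Gorenstein cone of degree `w`. -/
def sPoly (w : ι → ℤ) (F : Set (ι → ℝ)) : Polynomial ℤ :=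
  if h : ∃ p : Polynomial ℤ, (p : PowerSeries ℤ) = sSeries w F then h.choose else 0

/-- The lattice points in the relative interior of `F`. -/
abbrev IntPoints (F : Set (ι → ℝ)) : Type _ :=
  {m : ι → ℤ // toReal m ∈ intrinsicInterior ℝ F}

/-- The terms of `A_(x,y)(u, v)`, indexed by the pairs `(m, n)` of a lattice point `m` of `Int(C_x)`
and a lattice point `n` of `Int(C*_y)`. -/
def aTerm (w : ι → ℤ) {C : PointedCone ℝ (ι → ℝ)} (u v : ℂ) (x y : Face C)
    (p : IntPoints (x.1 : Set (ι → ℝ)) × IntPoints (dualFace y)) : ℂ :=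
  (u / v) ^ (p.1.1 ⬝ᵥ w) * (1 / (u * v)) ^ (p.2.1 ⬝ᵥ w)

/-- The Batyrev-Borisov sum over the intervals `I = [x, y]` of the face poset of `C`:
`(-1)^ρ(y) (uv)^(-r) (v-u)^ρ(x) B(I*; u, v) (uv-1)^(dim - ρ(y)) A_(x,y)(u, v)`. -/
def bbSum (w : ι → ℤ) (r : ℕ) (C : PointedCone ℝ (ι → ℝ)) (u v : ℂ) : ℂ :=
  ∑ᶠ I : NonemptyInterval (Face C),
    (-1) ^ rank I.snd / (u * v) ^ r * (v - u) ^ rank I.fst *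
      MvPolynomial.aeval ![u, v]
        (bPoly (P := (Face C)ᵒᵈ) dualRank (OrderDual.toDual I.snd) (OrderDual.toDual I.fst)) *
      (u * v - 1) ^ (Fintype.card ι - rank I.snd) * ∑' p, aTerm w u v I.fst I.snd p

end Cones

/-! ### Reflexive polytopes and nef partitions -/

/-- The convex hull of finitely many lattice points (at least one). -/
def IsLatticePolytope {d : ℕ} (Q : Set (Fin d → ℝ)) : Prop :=
  ∃ s : Finset (Fin d → ℤ), s.Nonempty ∧ Q = convexHull ℝ (toReal '' (s : Set (Fin d → ℤ)))

/-- The dual (polar) set `Δ*`. -/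
def polar {d : ℕ} (Q : Set (Fin d → ℝ)) : Set (Fin d → ℝ) := {x | ∀ y ∈ Q, -1 ≤ y ⬝ᵥ x}

/-- A lattice polytope whose dual is a lattice polytope. -/
def IsReflexive {d : ℕ} (Q : Set (Fin d → ℝ)) : Prop :=
  IsLatticePolytope Q ∧ IsLatticePolytope (polar Q)

/-- The cone `C[F]` over a face `F`. -/
def coneOver {d : ℕ} (F : Set (Fin d → ℝ)) : Set (Fin d → ℝ) :=
  {0} ∪ {z | ∃ c : ℝ, 0 < c ∧ c • z ∈ F}

/-- An integral convex support function for the fan of the cones over the proper faces of `Q`. -/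
def IsSupportFunction {d : ℕ} (Q : Set (Fin d → ℝ)) (φ : (Fin d → ℝ) → ℝ) : Prop :=
  ConvexOn ℝ Set.univ φ ∧
    ∀ F, IsExposed ℝ Q F → F ≠ Q → ∃ m : Fin d → ℤ, ∀ z ∈ coneOver F, φ z = toReal m ⬝ᵥ z

/-- `D 0, …, D (r - 1)` is a nef partition of the reflexive polytope `Δ`. -/
def IsNefPartition {d r : ℕ} (Δ : Set (Fin d → ℝ)) (D : Fin r → Set (Fin d → ℝ)) : Prop :=
  IsReflexive Δ ∧
    ∃ (E : Fin r → Set (Fin d → ℝ)) (φ : Fin r → (Fin d → ℝ) → ℝ),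
      (⋃ i, E i) = (polar Δ).extremePoints ℝ ∧
      Pairwise (fun i j => Disjoint (E i) (E j)) ∧
      (∀ i, IsSupportFunction (polar Δ) (φ i)) ∧
      (∀ i, ∀ e ∈ E i, φ i e = 1) ∧
      (∀ i, ∀ e ∈ (polar Δ).extremePoints ℝ, e ∉ E i → φ i e = 0) ∧
      ∀ i, D i = {y | ∀ z, -φ i z ≤ y ⬝ᵥ z}

/-! ### The Gorenstein cone of a nef partition -/

/-- The points `(a_1, …, a_r, a_1 z_1 + … + a_r z_r)` with `a_i ≥ 0` and `z_i ∈ D i`. -/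
def gorensteinSet {d r : ℕ} (D : Fin r → Set (Fin d → ℝ)) : Set (Fin r ⊕ Fin d → ℝ) :=
  {p | ∃ (a : Fin r → ℝ) (z : Fin r → Fin d → ℝ), (∀ i, 0 ≤ a i) ∧ (∀ i, z i ∈ D i) ∧
    p = Sum.elim a (∑ i, a i • z i)}

/-- The Gorenstein cone of `D`. For convex nonempty `D i`, it is the set `gorensteinSet D` itself,
see `coe_gorensteinCone`. -/
def gorensteinCone {d r : ℕ} (D : Fin r → Set (Fin d → ℝ)) :
    PointedCone ℝ (Fin r ⊕ Fin d → ℝ) :=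
  PointedCone.hull ℝ (gorensteinSet D)

theorem coe_gorensteinCone {d r : ℕ} (D : Fin r → Set (Fin d → ℝ))
    (hc : ∀ i, Convex ℝ (D i)) (hn : ∀ i, (D i).Nonempty) :
    (gorensteinCone D : Set (Fin r ⊕ Fin d → ℝ)) = gorensteinSet D := by
  refine Set.Subset.antisymm (fun p hp => ?_) PointedCone.subset_hull
  refine Submodule.span_induction (p := fun p _ => p ∈ gorensteinSet D) (fun _ h => h) ?_ ?_ ?_ hp
  · choose z hz using hn
    refine ⟨0, z, fun _ => le_rfl, hz, ?_⟩
    ext (i | i) <;> simp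
  · rintro _ _ _ _ ⟨a, z, ha, hz, rfl⟩ ⟨b, y, hb, hy, rfl⟩
    have key : ∀ i, ∃ x ∈ D i, (a i + b i) • x = a i • z i + b i • y i := by
      intro i
      rcases (add_nonneg (ha i) (hb i)).eq_or_lt with h | h
      · have h1 : a i = 0 := by linarith [ha i, hb i]
        have h2 : b i = 0 := by linarith [ha i, hb i]
        exact ⟨z i, hz i, by simp [h1, h2]⟩
      · refine ⟨(a i / (a i + b i)) • z i + (b i / (a i + b i)) • y i,
          hc i (hz i) (hy i) (div_nonneg (ha i) h.le) (div_nonneg (hb i) h.le)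
            (by rw [← add_div, div_self h.ne']), ?_⟩
        rw [smul_add, smul_smul, smul_smul, mul_div_cancel₀ _ h.ne', mul_div_cancel₀ _ h.ne']
    choose x hx hxe using key
    refine ⟨a + b, x, fun i => add_nonneg (ha i) (hb i), hx, ?_⟩
    have : ∑ i, (a + b) i • x i = ∑ i, a i • z i + ∑ i, b i • y i := by
      rw [← Finset.sum_add_distrib]
      exact Finset.sum_congr rfl fun i _ => hxe i
    rw [this]
    ext (i | i) <;> simp
  · rintro c _ _ ⟨a, z, ha, hz, rfl⟩
    refine ⟨fun i => c.1 * a i, z, fun i => mul_nonneg c.2 (ha i), hz, ?_⟩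
    change c.1 • Sum.elim a (∑ i, a i • z i) = _
    ext (i | i)
    · simp
    · simp [Finset.mul_sum, mul_assoc]

/-- The vector `(1, …, 1, 0)`, which defines the degree on the lattices of both the Gorenstein cone
and its dual. -/
def degreeVector (r d : ℕ) : Fin r ⊕ Fin d → ℤ := Sum.elim (fun _ => 1) (fun _ => 0)

/-- The `E`-polynomial: `E` is the Laurent polynomial in `u`, `v` which the Batyrev-Borisov formula
for the nef partition `D` represents, on the domain `0 < |u| < |v|`, `1 < |u v|`, where the series
`A_(x,y)(u, v)` converge. -/
def IsStringyEPolynomial {d r : ℕ} (D : Fin r → Set (Fin d → ℝ)) (E : Laurent) : Prop :=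
  ∀ u v : ℂ, 0 < ‖u‖ → ‖u‖ < ‖v‖ → 1 < ‖u * v‖ →
    (∀ x y : Face (gorensteinCone D), x ≤ y → Summable (aTerm (degreeVector r d) u v x y)) ∧
      evalAt u v E = bbSum (degreeVector r d) r (gorensteinCone D) u v

/-- The sum over the intervals `I = [x, y]` of the face poset of the Gorenstein cone `C`:
`(-1)^ρ(x) u^ρ(y) (uv)^(-r) S(C_x, v/u) S(C*_y, uv) B(I; u⁻¹, v)`. -/
def endFormula {d r : ℕ} (D : Fin r → Set (Fin d → ℝ)) : Laurent :=
  ∑ᶠ I : NonemptyInterval (Face (gorensteinCone D)),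
    (-1) ^ rank I.fst * mon (rank I.snd) 0 * mon (-r) (-r) *
      Polynomial.aeval (mon (-1) 1) (sPoly (degreeVector r d) (I.fst.1 : Set (Fin r ⊕ Fin d → ℝ))) *
      Polynomial.aeval (mon 1 1) (sPoly (degreeVector r d) (dualFace I.snd)) *
      MvPolynomial.aeval ![mon (-1) 0, mon 0 1] (bPoly rank I.fst I.snd)

end

end StringyE

/-! The two sums agree term by term. For I = [x, y] the double series A_(x,y) factors into the
series of Int(C_x) at t = u/v and the series of Int(C*_y) at t = 1/(uv). Ehrhart reciprocity says
that (1 - t)^(dim F) times the series of Int(F) is t^(dim F) S(F, 1/t). Hence the factors (v -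
u)^ρ(x) and (uv - 1)^(dim - ρ(y)) turn the two series into u^ρ(x) S(C_x, v/u) and S(C*_y, uv)
(`IsConePair.summable_and_tsum_aTerm`). Moreover B(I*; u, v) = (-u)^(ρ(y) - ρ(x)) B(I; u⁻¹, v)
(`aeval_bPoly_dual`), and the signs and powers of u combine to (-1)^ρ(x) u^ρ(y)
(`IsConePair.bbSum_eq`).

The duality of B comes from a factorization (`bFormula`): B([x, y]; u, v) is the sum over z of f(x,
z) at uv times (-u)^(ρ(y) - ρ(z)) g(z, y) at v/u, where f and g are the right and left
Kazhdan-Lusztig-Stanley functions of the kernel (t - 1)^k. Reversing the order exchanges f and g,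
and u ↦ u⁻¹ exchanges uv and v/u. The functions f and g exist because the face poset is Eulerian.

Reciprocity and the Eulerian property both rest on `exists_halfOpen_decomposition`: a cone with
generators of degree one and its relative interior are disjoint unions of half-open simplicial cones
on the same bases σ, with complementary sets of open facets. The map m ↦ ∑ σ - m exchanges the
lattice points of the two half-open parallelepipeds. With all weights 1 this is Ehrhart reciprocity.
With weights in the group algebra of the lattice it is reciprocity in all variables; applied to the
partition of a face into the relative interiors of its subfaces, it gives the Euler relation
(`sum_neg_one_pow_faces`).

All this applies to a nef partition because C and C* are both generated by lattice points of degree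
one (`IsNefPartition.exists_isConePair`). Uniqueness holds because a Laurent polynomial is
determined by its values on the domain (`eq_zero_of_evalAt`). -/

namespace StringyE

open scoped Matrix

noncomputable section

set_option linter.unusedSectionVars false

/-! ### Kazhdan-Lusztig-Stanley polynomials of Eulerian posets -/

section KLS

open Polynomial

variable {P : Type*} [PartialOrder P] [Fintype P]

open Classical in
/-- The matrix with entries `a ^ (ρ y - ρ x)` for `x ≤ y`. -/
def powMatrix {S : Type*} [CommRing S] (ρ : P → ℕ) (a : S) (x y : P) : S :=
  if x ≤ y then a ^ (ρ y - ρ x) else 0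

/-- The alternating sum of the ranks over a nontrivial interval is zero. -/
def IsEulerianRank (ρ : P → ℕ) : Prop :=
  ∀ x y, x < y → ∑ᶠ z ∈ Set.Icc x y, (-1 : ℤ) ^ ρ z = 0

/-- Left Kazhdan-Lusztig-Stanley functions for the kernel `(X - 1) ^ (ρ y - ρ x)`. -/
structure IsLeftKLS (ρ : P → ℕ) (g : P → P → ℤ[X]) : Prop where
  diag : ∀ x, g x x = 1
  off : ∀ x y, ¬ x ≤ y → g x y = 0
  deg : ∀ x y, x < y → 2 * (g x y).natDegree < ρ y - ρ x
  rel : ∀ x y, x ≤ y → reflect (ρ y - ρ x) (g x y) = ∑ z, g x z * powMatrix ρ (X - 1) z y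

/-- Right Kazhdan-Lusztig-Stanley functions for the kernel `(X - 1) ^ (ρ y - ρ x)`. -/
structure IsRightKLS (ρ : P → ℕ) (f : P → P → ℤ[X]) : Prop where
  diag : ∀ x, f x x = 1
  off : ∀ x y, ¬ x ≤ y → f x y = 0
  deg : ∀ x y, x < y → 2 * (f x y).natDegree < ρ y - ρ x
  rel : ∀ x y, x ≤ y → reflect (ρ y - ρ x) (f x y) = ∑ z, powMatrix ρ (X - 1) x z * f z y

theorem reflect_sum {R ι : Type*} [Semiring R] (N : ℕ) (s : Finset ι) (f : ι → R[X]) :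
    reflect N (∑ i ∈ s, f i) = ∑ i ∈ s, reflect N (f i) := by
  classical
  induction s using Finset.induction_on with
  | empty => simp
  | insert a s h ih => rw [Finset.sum_insert h, Finset.sum_insert h, reflect_add, ih]

theorem reflect_X_sub_one_pow {R : Type*} [CommRing R] (k : ℕ) :
    reflect k ((X - 1 : R[X]) ^ k) = (1 - X) ^ k := by
  have h1 : (X - 1 : R[X]).natDegree ≤ 1 := by
    rw [← C_1]; exact natDegree_X_sub_C_le _
  induction k with
  | zero => simp
  | succ k ih =>
    have hk : ((X - 1 : R[X]) ^ k).natDegree ≤ k :=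
      natDegree_pow_le.trans (by nlinarith)
    rw [pow_succ, reflect_mul _ _ hk h1, ih, pow_succ]
    congr 1
    rw [sub_eq_add_neg, reflect_add, reflect_neg, reflect_one_X, reflect_one, pow_one,
      ← sub_eq_add_neg]

theorem natDegree_X_sub_one_pow_le {R : Type*} [CommRing R] (k : ℕ) :
    ((X - 1 : R[X]) ^ k).natDegree ≤ k := by
  have h1 : (X - 1 : R[X]).natDegree ≤ 1 := by
    rw [← C_1]; exact natDegree_X_sub_C_le _
  exact natDegree_pow_le.trans (by nlinarith)

/-- The sum is ± a ^ (ρ y - ρ x) times an alternating sum of signs over [x, y], which the Eulerian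
condition kills. So the kernels of a and of -a are inverse matrices; for a = X - 1 the kernel of -a
has the reflected entries. -/
theorem sum_powMatrix_mul {S : Type*} [CommRing S] {ρ : P → ℕ} (hρ : StrictMono ρ)
    (hE : IsEulerianRank ρ) (a : S) {x y : P} (hxy : x < y) :
    ∑ z, powMatrix ρ a x z * powMatrix ρ (-a) z y = 0 := by
  classical
  have h1 : ∀ z, powMatrix ρ a x z * powMatrix ρ (-a) z y =
      (a ^ (ρ y - ρ x) * (-1) ^ ρ y) * (((if z ∈ Set.Icc x y then (-1 : ℤ) ^ ρ z else 0 : ℤ)) : S) := by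
    intro z
    unfold powMatrix
    by_cases hz : x ≤ z <;> by_cases hz' : z ≤ y <;> simp [hz, hz']
    have e1 := hρ.monotone hz
    have e2 := hρ.monotone hz'
    rw [neg_pow a, ← Nat.sub_add_sub_cancel e2 e1, pow_add]
    obtain ⟨k, hk⟩ := Nat.exists_eq_add_of_le e2
    rw [hk, Nat.add_sub_cancel_left, pow_add]
    have : ((-1 : S) ^ ρ z) * (-1) ^ ρ z = 1 := by rw [← mul_pow]; simp
    linear_combination (-a ^ k * a ^ (ρ z - ρ x) * (-1) ^ k) * this
  simp_rw [h1]
  rw [← Finset.mul_sum, ← Int.cast_sum]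
  have := hE x y hxy
  rw [finsum_mem_eq_sum_of_inter_support_eq (t := Finset.univ.filter (· ∈ Set.Icc x y)) _
    (by ext; simp)] at this
  rw [← Finset.sum_filter, this]
  simp

/-- Truncation of a polynomial to the degrees less than `k / 2`. -/
def truncHalf (k : ℕ) (p : ℤ[X]) : ℤ[X] := ∑ i ∈ Finset.range ((k + 1) / 2), monomial i (p.coeff i)

theorem coeff_truncHalf (k : ℕ) (p : ℤ[X]) (i : ℕ) :
    (truncHalf k p).coeff i = if 2 * i < k then p.coeff i else 0 := by
  simp only [truncHalf, finsetSum_coeff, coeff_monomial, Finset.sum_ite_eq', Finset.mem_range]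
  congr 1
  apply propext; omega

theorem natDegree_truncHalf_lt {k : ℕ} (hk : 0 < k) (p : ℤ[X]) :
    2 * (truncHalf k p).natDegree < k := by
  by_cases h : truncHalf k p = 0
  · simpa [h]
  · by_contra h2
    have := leadingCoeff_ne_zero.mpr h
    rw [leadingCoeff, coeff_truncHalf, if_neg h2] at this
    exact this rfl

/-- An antisymmetric Q is its lower half plus the negative of the reflection of that half; the
middle coefficient, if there is one, is its own negative and so vanishes. -/
theorem reflect_neg_truncHalf {k : ℕ} {Q : ℤ[X]} (hQ : reflect k Q = -Q) (hd : Q.natDegree ≤ k) :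
    reflect k (-truncHalf k Q) = Q + -truncHalf k Q := by
  ext i
  rw [coeff_reflect, coeff_add, coeff_neg, coeff_neg, coeff_truncHalf, coeff_truncHalf]
  rcases le_or_gt i k with hi | hi
  · have h := congrArg (fun p => coeff p i) hQ
    simp only [coeff_reflect, coeff_neg] at h
    rw [revAt_le hi] at h ⊢
    rcases lt_trichotomy (2 * i) k with h2 | h2 | h2
    · rw [if_neg (by omega), if_pos h2]; simp
    · have : k - i = i := by omega
      rw [this] at h ⊢
      rw [if_neg (by omega)]; omega
    · rw [if_pos (by omega), if_neg (by omega)]; omega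
  · rw [revAt_eq_self_of_lt hi, coeff_eq_zero_of_natDegree_lt (by omega)]
    simp

/-- Recursion on y: the relation reads reflect g = Q + g, where Q collects the terms z < y. The
relations below y and the Eulerian condition make Q antisymmetric, and then minus the lower half of
Q is a solution of the required degree. -/
theorem exists_isLeftKLS {ρ : P → ℕ} (hρ : StrictMono ρ) (hE : IsEulerianRank ρ) :
    ∃ g, IsLeftKLS ρ g := by
  classical
  have key : ∀ x : P, ∃ g : P → ℤ[X], ∀ y, g y = if x = y then 1 else if x < y then
      -truncHalf (ρ y - ρ x) (∑ z ∈ Finset.univ.filter (· < y), g z * powMatrix ρ (X - 1) z y)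
      else 0 := by
    intro x
    let step : (y : P) → ((z : P) → z < y → ℤ[X]) → ℤ[X] := fun y ih =>
      if x = y then 1 else if x < y then
      -truncHalf (ρ y - ρ x) (∑ z ∈ Finset.univ.filter (· < y),
        (if h : z < y then ih z h else 0) * powMatrix ρ (X - 1) z y) else 0
    refine ⟨WellFoundedLT.fix step, fun y => ?_⟩
    rw [WellFoundedLT.fix_eq]
    simp only [step]
    congr 3
    congr 1
    refine Finset.sum_congr rfl fun z hz => ?_
    rw [dif_pos (by simpa using hz)]
  choose g hg using key
  have diag : ∀ x, g x x = 1 := fun x => by rw [hg]; simp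
  have off : ∀ x y, ¬ x ≤ y → g x y = 0 := fun x y h => by
    rw [hg, if_neg (fun h' => h h'.le), if_neg (fun h' => h h'.le)]
  have deg : ∀ x y, x < y → 2 * (g x y).natDegree < ρ y - ρ x := fun x y h => by
    rw [hg, if_neg h.ne, if_pos h, natDegree_neg]
    exact natDegree_truncHalf_lt (by have := hρ h; omega) _
  have degle : ∀ x y, x ≤ y → (g x y).natDegree ≤ ρ y - ρ x := fun x y h => by
    rcases h.eq_or_lt with rfl | h
    · simp [diag]
    · have := deg x y h; omega
  refine ⟨g, diag, off, deg, fun x y hxy => ?_⟩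
  induction y using WellFoundedLT.induction with
  | ind y ih =>
  rcases hxy.eq_or_lt with rfl | hlt
  · rw [Finset.sum_eq_single x]
    · simp [diag, powMatrix]
    · intro z _ hz
      by_cases h : x ≤ z
      · rw [powMatrix, if_neg (fun h' => hz (le_antisymm h' h)), mul_zero]
      · rw [off x z h, zero_mul]
    · simp
  set Q := ∑ z ∈ Finset.univ.filter (· < y), g x z * powMatrix ρ (X - 1) z y with hQ
  have hsum : ∑ z, g x z * powMatrix ρ (X - 1) z y = Q + g x y := by
    have : ∑ z, g x z * powMatrix ρ (X - 1) z y =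
        ∑ z ∈ insert y (Finset.univ.filter (· < y)), g x z * powMatrix ρ (X - 1) z y := by
      symm
      refine Finset.sum_subset (Finset.subset_univ _) fun z _ hz => ?_
      have : ¬ z ≤ y := fun h => hz (by
        simpa [le_iff_eq_or_lt] using h)
      rw [powMatrix, if_neg this, mul_zero]
    rw [this, Finset.sum_insert (by simp), add_comm]
    simp [powMatrix, hQ]
  have hgy : g x y = -truncHalf (ρ y - ρ x) Q := by
    rw [hg, if_neg hlt.ne, if_pos hlt]
  have hterm : ∀ z, z < y → (g x z * powMatrix ρ (X - 1) z y).natDegree ≤ ρ y - ρ x ∧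
      reflect (ρ y - ρ x) (g x z * powMatrix ρ (X - 1) z y) =
        (∑ z', g x z' * powMatrix ρ (X - 1) z' z) * powMatrix ρ (-(X - 1)) z y := by
    intro z hz
    by_cases h : x ≤ z
    · have e1 := hρ.monotone h
      have e2 := hρ.monotone hz.le
      have e3 : ρ y - ρ x = (ρ z - ρ x) + (ρ y - ρ z) := by omega
      simp only [powMatrix, if_pos hz.le]
      constructor
      · rw [e3]
        exact natDegree_mul_le.trans (add_le_add (degle x z h) (natDegree_X_sub_one_pow_le _))
      · rw [e3, reflect_mul _ _ (degle x z h) (natDegree_X_sub_one_pow_le _),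
          reflect_X_sub_one_pow, ih z hz h, neg_sub]
        rfl
    · rw [off x z h]
      simp only [zero_mul, natDegree_zero, zero_le, reflect_zero, true_and]
      rw [Finset.sum_eq_zero, zero_mul]
      intro z' _
      by_cases h' : x ≤ z'
      · rw [powMatrix, if_neg (fun h'' => h (h'.trans h'')), mul_zero]
      · rw [off x z' h', zero_mul]
  have hQd : Q.natDegree ≤ ρ y - ρ x :=
    natDegree_sum_le_of_forall_le _ _ fun z hz => (hterm z (by simpa using hz)).1
  -- Reflection expands g x z by the induction hypothesis and replaces the kernel by its inverse.
  -- After exchanging the sums, the inner sum over z < y is minus the missing term z = y, by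
  -- `sum_powMatrix_mul`.
  have hQr : reflect (ρ y - ρ x) Q = -Q := by
    rw [hQ, reflect_sum, Finset.sum_congr rfl fun z hz => (hterm z (by simpa using hz)).2]
    simp_rw [Finset.sum_mul]
    rw [Finset.sum_comm, ← Finset.sum_neg_distrib]
    rw [← Finset.sum_subset (Finset.subset_univ (Finset.univ.filter (· < y)))]
    · refine Finset.sum_congr rfl fun z' hz' => ?_
      have hz' : z' < y := by simpa using hz'
      have h0 := sum_powMatrix_mul hρ hE (X - 1 : ℤ[X]) hz'
      rw [← Finset.sum_subset (Finset.subset_univ (insert y (Finset.univ.filter (· < y)))),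
        Finset.sum_insert (by simp)] at h0
      · simp_rw [mul_assoc]
        rw [← Finset.mul_sum, ← mul_neg]
        congr 1
        have h1 : powMatrix ρ (-(X - 1) : ℤ[X]) y y = 1 := by simp [powMatrix]
        rw [h1, mul_one] at h0
        linear_combination h0
      · intro z _ hz
        have : ¬ z ≤ y := fun h => hz (by simpa [le_iff_eq_or_lt] using h)
        rw [powMatrix, powMatrix, if_neg this, mul_zero]
    · intro z' _ hz'
      refine Finset.sum_eq_zero fun z hz => ?_
      rw [powMatrix, if_neg, mul_zero, zero_mul]
      intro h
      exact hz' (by simpa using h.trans_lt (by simpa using hz))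
  rw [hsum, hgy, reflect_neg_truncHalf hQr hQd]

variable {ρ : P → ℕ} {ρ' : Pᵒᵈ → ℕ}

theorem powMatrix_dual {S : Type*} [CommRing S]
    (hρρ' : ∀ x y, x ≤ y → ρ' (OrderDual.toDual x) - ρ' (OrderDual.toDual y) = ρ y - ρ x)
    (a : S) (x y : P) :
    powMatrix ρ' a (OrderDual.toDual y) (OrderDual.toDual x) = powMatrix ρ a x y := by
  by_cases h : x ≤ y
  · rw [powMatrix, powMatrix, if_pos h, if_pos (OrderDual.toDual_le_toDual.mpr h), hρρ' x y h]
  · rw [powMatrix, powMatrix, if_neg h, if_neg (fun h' => h (OrderDual.toDual_le_toDual.mp h'))]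

theorem IsLeftKLS.dual {g : P → P → ℤ[X]} (hg : IsLeftKLS ρ g)
    (hρρ' : ∀ x y, x ≤ y → ρ' (OrderDual.toDual x) - ρ' (OrderDual.toDual y) = ρ y - ρ x) :
    IsRightKLS ρ' fun x y => g (OrderDual.ofDual y) (OrderDual.ofDual x) where
  diag x := hg.diag _
  off x y h := hg.off _ _ h
  deg x y h := by
    have := hg.deg (OrderDual.ofDual y) (OrderDual.ofDual x) h
    rwa [← hρρ' _ _ (le_of_lt (OrderDual.ofDual_lt_ofDual.mpr h))] at this
  rel x y h := by
    have := hg.rel (OrderDual.ofDual y) (OrderDual.ofDual x) h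
    rw [← hρρ' _ _ (OrderDual.ofDual_le_ofDual.mpr h)] at this
    refine this.trans ?_
    rw [← OrderDual.toDual.sum_comp]
    exact Finset.sum_congr rfl fun z _ => by
      rw [← powMatrix_dual hρρ', mul_comm]; rfl

theorem IsRightKLS.dual {f : P → P → ℤ[X]} (hf : IsRightKLS ρ f)
    (hρρ' : ∀ x y, x ≤ y → ρ' (OrderDual.toDual x) - ρ' (OrderDual.toDual y) = ρ y - ρ x) :
    IsLeftKLS ρ' fun x y => f (OrderDual.ofDual y) (OrderDual.ofDual x) where
  diag x := hf.diag _
  off x y h := hf.off _ _ h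
  deg x y h := by
    have := hf.deg (OrderDual.ofDual y) (OrderDual.ofDual x) h
    rwa [← hρρ' _ _ (le_of_lt (OrderDual.ofDual_lt_ofDual.mpr h))] at this
  rel x y h := by
    have := hf.rel (OrderDual.ofDual y) (OrderDual.ofDual x) h
    rw [← hρρ' _ _ (OrderDual.ofDual_le_ofDual.mpr h)] at this
    refine this.trans ?_
    rw [← OrderDual.toDual.sum_comp]
    exact Finset.sum_congr rfl fun z _ => by
      rw [← powMatrix_dual hρρ', mul_comm]; rfl

theorem _root_.StrictMono.dual_sub {ρ : P → ℕ} (hρ : StrictMono ρ) {N : ℕ} (hN : ∀ x, ρ x ≤ N) :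
    StrictMono fun x : Pᵒᵈ => N - ρ (OrderDual.ofDual x) := by
  intro x y h
  have h1 : ρ (OrderDual.ofDual y) < ρ (OrderDual.ofDual x) := hρ h
  have := hN (OrderDual.ofDual x)
  dsimp only
  omega

theorem IsEulerianRank.dual_sub {ρ : P → ℕ} (hE : IsEulerianRank ρ) {N : ℕ} (hN : ∀ x, ρ x ≤ N) :
    IsEulerianRank fun x : Pᵒᵈ => N - ρ (OrderDual.ofDual x) := by
  intro x y h
  have h1 := hE _ _ (OrderDual.ofDual_lt_ofDual.mpr h)
  have h2 : ∀ z : Pᵒᵈ, (-1 : ℤ) ^ (N - ρ (OrderDual.ofDual z)) =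
      (-1) ^ N * (-1) ^ ρ (OrderDual.ofDual z) := by
    intro z
    obtain ⟨k, hk⟩ := Nat.exists_eq_add_of_le (hN (OrderDual.ofDual z))
    simp only [hk, Nat.add_sub_cancel_left, pow_add]
    have : ((-1 : ℤ) ^ ρ (OrderDual.ofDual z)) * (-1) ^ ρ (OrderDual.ofDual z) = 1 := by
      rw [← mul_pow]; simp
    linear_combination (-(-1) ^ k) * this
  simp_rw [h2]
  rw [← mul_finsum_mem]
  have h3 : Set.Icc x y =
      {z | OrderDual.ofDual z ∈ Set.Icc (OrderDual.ofDual y) (OrderDual.ofDual x)} := by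
    ext z; exact and_comm
  rw [h3]
  exact mul_eq_zero_of_right _ h1

/-- Right functions are left functions for the reversed order, ranked by N - ρ with N an upper bound
of ρ. -/
theorem exists_isRightKLS (hρ : StrictMono ρ) (hE : IsEulerianRank ρ) :
    ∃ f, IsRightKLS ρ f := by
  classical
  obtain ⟨N, hN⟩ : ∃ N, ∀ x, ρ x ≤ N := ⟨Finset.univ.sup ρ, fun x => Finset.le_sup (Finset.mem_univ x)⟩
  let ρ' : Pᵒᵈ → ℕ := fun x => N - ρ (OrderDual.ofDual x)
  have hmono : StrictMono ρ' := hρ.dual_sub hN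
  have hE' : IsEulerianRank ρ' := hE.dual_sub hN
  obtain ⟨g, hg⟩ := exists_isLeftKLS hmono hE'
  refine ⟨fun x y => g (OrderDual.toDual y) (OrderDual.toDual x), ?_⟩
  have hd : ∀ x y : P, x ≤ y →
      ρ' (OrderDual.toDual x) - ρ' (OrderDual.toDual y) = ρ y - ρ x := by
    intro x y h
    have := hN x; have := hN y; have := hρ.monotone h
    simp only [ρ', OrderDual.ofDual_toDual]; omega
  refine ⟨fun x => hg.diag _, fun x y h => hg.off _ _ h, fun x y h => ?_, fun x y h => ?_⟩
  · rw [← hd x y h.le]; exact hg.deg _ _ h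
  · rw [← hd x y h]
    refine (hg.rel _ _ (OrderDual.toDual_le_toDual.mpr h)).trans ?_
    rw [← OrderDual.toDual.sum_comp]
    exact Finset.sum_congr rfl fun z _ => by
      rw [powMatrix_dual hd, mul_comm]

theorem IsLeftKLS.natDegree_le {g : P → P → ℤ[X]} (hg : IsLeftKLS ρ g) (x y : P) :
    (g x y).natDegree ≤ ρ y - ρ x := by
  by_cases h : x ≤ y
  · rcases h.eq_or_lt with rfl | h
    · simp [hg.diag]
    · have := hg.deg x y h; omega
  · simp [hg.off x y h]

theorem IsRightKLS.natDegree_le {g : P → P → ℤ[X]} (hg : IsRightKLS ρ g) (x y : P) :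
    (g x y).natDegree ≤ ρ y - ρ x := by
  by_cases h : x ≤ y
  · rcases h.eq_or_lt with rfl | h
    · simp [hg.diag]
    · have := hg.deg x y h; omega
  · simp [hg.off x y h]

end KLS

/-! ### B-polynomials in terms of Kazhdan-Lusztig-Stanley polynomials -/

section BPoly

open Polynomial

variable {P : Type*} [PartialOrder P] [Fintype P] {ρ : P → ℕ}

/-- The homogeneous polynomial `(-u) ^ k * p (v / u)`. -/
def homogenize (k : ℕ) (p : ℤ[X]) : MvPolynomial (Fin 2) ℤ :=
  (-1) ^ k * ∑ j ∈ Finset.range (k + 1),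
    MvPolynomial.C (p.coeff j) * MvPolynomial.X 0 ^ (k - j) * MvPolynomial.X 1 ^ j

/-- The `B`-polynomial in terms of Kazhdan-Lusztig-Stanley polynomials. -/
def bFormula (ρ : P → ℕ) (f g : P → P → ℤ[X]) (x y : P) : MvPolynomial (Fin 2) ℤ :=
  ∑ z, aeval (MvPolynomial.X 0 * MvPolynomial.X 1) (f x z) * homogenize (ρ y - ρ z) (g z y)

theorem aeval_homogenize {S : Type*} [CommRing S] {u u' : S} (v : S) (h : u * u' = 1) {k : ℕ}
    {p : ℤ[X]} (hp : p.natDegree ≤ k) :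
    MvPolynomial.aeval ![u, v] (homogenize k p) = (-u) ^ k * aeval (v * u') p := by
  rw [homogenize, map_mul, map_sum, map_pow, map_neg, map_one, neg_pow u, mul_assoc]
  congr 1
  rw [aeval_eq_sum_range' (Nat.lt_succ_of_le hp), Finset.mul_sum]
  refine Finset.sum_congr rfl fun j hj => ?_
  have hj : j ≤ k := by simpa [Nat.lt_succ_iff] using hj
  simp only [map_mul, map_pow, MvPolynomial.aeval_X, MvPolynomial.aeval_C, Matrix.cons_val_zero,
    Matrix.cons_val_one, zsmul_eq_mul, algebraMap_int_eq, Int.coe_castRingHom]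
  obtain ⟨l, rfl⟩ := Nat.exists_eq_add_of_le hj
  rw [Nat.add_sub_cancel_left, pow_add, mul_pow]
  have : u ^ j * u' ^ j = 1 := by rw [← mul_pow, h, one_pow]
  linear_combination (-(p.coeff j : S) * u ^ l * v ^ j) * this

theorem aeval_bFormula {S : Type*} [CommRing S] {f g : P → P → ℤ[X]} (hg : IsLeftKLS ρ g)
    {u u' : S} (v : S) (h : u * u' = 1) (x y : P) :
    MvPolynomial.aeval ![u, v] (bFormula ρ f g x y) =
      ∑ z, aeval (u * v) (f x z) * ((-u) ^ (ρ y - ρ z) * aeval (v * u') (g z y)) := by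
  rw [bFormula, map_sum]
  refine Finset.sum_congr rfl fun z _ => ?_
  rw [map_mul, aeval_homogenize v h (hg.natDegree_le z y)]
  congr 1
  rw [← Polynomial.aeval_algHom_apply]
  simp

theorem aeval_reflect {S : Type*} [CommRing S] {a b : S} (h : a * b = 1) {k : ℕ} {p : ℤ[X]}
    (hp : p.natDegree ≤ k) : aeval a (reflect k p) = a ^ k * aeval b p := by
  let : Invertible b := ⟨a, h, by rw [mul_comm, h]⟩
  have h1 : (⅟b : S) = a := rfl
  have := eval₂_reflect_mul_pow (algebraMap ℤ S) b k p hp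
  rw [h1] at this
  have h2 : a ^ k * b ^ k = 1 := by rw [← mul_pow, h, one_pow]
  rw [aeval_def, aeval_def, ← this]
  linear_combination (-eval₂ (algebraMap ℤ S) a (reflect k p)) * h2

theorem aeval_powMatrix {S : Type*} [CommRing S] (a : S) (x y : P) :
    aeval a (powMatrix ρ (X - 1 : ℤ[X]) x y) = powMatrix ρ (a - 1) x y := by
  unfold powMatrix
  split_ifs <;> simp

/-- Both sides equal ∑ w, (reflect f)(x, w) at uv times (-u) ^ (ρ y - ρ w) g(w, y) at v/u. On the
right, the factors (uv - 1)^k are absorbed by the relation of f. On the left, (uv)^k reflects f(x,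
w), and since v - u = -v (u/v - 1), the factors (v - u)^k are absorbed by the relation of g at u/v.
-/
theorem bFormula_relation {S : Type*} [CommRing S] (hρ : StrictMono ρ) {f g : P → P → ℤ[X]}
    (hf : IsRightKLS ρ f) (hg : IsLeftKLS ρ g) {u u' v v' : S} (hu : u * u' = 1) (hv : v * v' = 1)
    {x y : P} :
    ∑ᶠ z ∈ Set.Icc x y, MvPolynomial.aeval ![u', v'] (bFormula ρ f g x z) *
        (u * v) ^ (ρ z - ρ x) * (v - u) ^ (ρ y - ρ z) =
      ∑ᶠ z ∈ Set.Icc x y, MvPolynomial.aeval ![u, v] (bFormula ρ f g z y) *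
        (u * v - 1) ^ (ρ z - ρ x) := by
  classical
  have hfin : ∀ F : P → S, ∑ᶠ z ∈ Set.Icc x y, F z = ∑ z, if z ∈ Set.Icc x y then F z else 0 := by
    intro F
    rw [finsum_mem_eq_sum_of_inter_support_eq (t := Finset.univ.filter (· ∈ Set.Icc x y)) _
      (by ext; simp), Finset.sum_filter]
  rw [hfin, hfin]
  have hu' : u' * u = 1 := by rw [mul_comm, hu]
  -- the two sides as products of three matrices
  have huv : (u * v) * (u' * v') = 1 := by linear_combination v * v' * hu + hv
  have hR : ∀ z, (if z ∈ Set.Icc x y then MvPolynomial.aeval ![u, v] (bFormula ρ f g z y) *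
      (u * v - 1) ^ (ρ z - ρ x) else 0) = ∑ w, powMatrix ρ (u * v - 1) x z *
        aeval (u * v) (f z w) * ((-u) ^ (ρ y - ρ w) * aeval (v * u') (g w y)) := by
    intro z
    by_cases hz : x ≤ z
    · by_cases hz' : z ≤ y
      · rw [if_pos ⟨hz, hz'⟩, aeval_bFormula hg v hu, powMatrix, if_pos hz, Finset.sum_mul]
        exact Finset.sum_congr rfl fun w _ => by ring
      · rw [if_neg (fun h => hz' h.2), Finset.sum_eq_zero]
        intro w _
        by_cases h : z ≤ w
        · rw [hg.off w y (fun h' => hz' (h.trans h'))]; simp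
        · rw [hf.off z w h]; simp
    · simp [powMatrix, hz]
  have hL : ∀ z, (if z ∈ Set.Icc x y then MvPolynomial.aeval ![u', v'] (bFormula ρ f g x z) *
      (u * v) ^ (ρ z - ρ x) * (v - u) ^ (ρ y - ρ z) else 0) = ∑ w,
        aeval (u * v) (reflect (ρ w - ρ x) (f x w)) * ((-v) ^ (ρ y - ρ w) *
          (aeval (u * v') (g w z) * powMatrix ρ (u * v' - 1) z y)) := by
    intro z
    by_cases hz : x ≤ z
    · by_cases hz' : z ≤ y
      · rw [if_pos ⟨hz, hz'⟩, aeval_bFormula hg v' hu', powMatrix, if_pos hz', Finset.sum_mul,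
          Finset.sum_mul]
        refine Finset.sum_congr rfl fun w _ => ?_
        by_cases h : x ≤ w
        · by_cases h' : w ≤ z
          · rw [aeval_reflect huv (hf.natDegree_le x w)]
            have e1 := hρ.monotone h
            have e2 := hρ.monotone h'
            have e3 := hρ.monotone hz'
            obtain ⟨a, ha⟩ := Nat.exists_eq_add_of_le e1
            obtain ⟨b, hb⟩ := Nat.exists_eq_add_of_le e2
            obtain ⟨c, hc⟩ := Nat.exists_eq_add_of_le e3
            rw [show ρ z - ρ w = b by omega, show ρ z - ρ x = a + b by omega,
              show ρ y - ρ z = c by omega, show ρ w - ρ x = a by omega,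
              show ρ y - ρ w = b + c by omega]
            have h1 : v - u = (-v) * (u * v' - 1) := by linear_combination u * hv
            have h2 : (-u') ^ b * (u * v) ^ b = (-v) ^ b := by
              rw [← mul_pow]; congr 1; linear_combination -v * hu
            rw [h1, mul_pow (-v), pow_add, pow_add, mul_comm v' u]
            linear_combination (aeval (u' * v') (f x w) * aeval (u * v') (g w z) * (u * v) ^ a *
              (-v) ^ c * (u * v' - 1) ^ c) * h2
          · rw [hg.off w z h']; simp
        · rw [hf.off x w h]; simp
      · rw [if_neg (fun h => hz' h.2), Finset.sum_eq_zero]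
        intro w _
        simp [powMatrix, hz']
    · rw [if_neg (fun h => hz h.1), Finset.sum_eq_zero]
      intro w _
      by_cases h : x ≤ w
      · rw [hg.off w z (fun h' => hz (h.trans h'))]; simp
      · rw [hf.off x w h]; simp
  simp_rw [hL, hR]
  rw [Finset.sum_comm, Finset.sum_comm (f := fun z w => powMatrix ρ (u * v - 1) x z * _ * _)]
  refine Finset.sum_congr rfl fun w _ => ?_
  have hA : ∑ z, aeval (u * v') (g w z) * powMatrix ρ (u * v' - 1) z y =
      aeval (u * v') (∑ z, g w z * powMatrix ρ (X - 1 : ℤ[X]) z y) := by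
    rw [map_sum]
    exact Finset.sum_congr rfl fun z _ => by rw [map_mul, aeval_powMatrix]
  have hB : ∑ z, powMatrix ρ (u * v - 1) x z * aeval (u * v) (f z w) =
      aeval (u * v) (∑ z, powMatrix ρ (X - 1 : ℤ[X]) x z * f z w) := by
    rw [map_sum]
    exact Finset.sum_congr rfl fun z _ => by rw [map_mul, aeval_powMatrix]
  rw [← Finset.mul_sum, ← Finset.mul_sum, ← Finset.sum_mul, hA, hB]
  by_cases h : x ≤ w
  · by_cases h' : w ≤ y
    · rw [hf.rel x w h, ← hg.rel w y h', aeval_reflect (a := u * v') (b := v * u')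
        (by linear_combination v * v' * hu + hv) (hg.natDegree_le w y), ← mul_assoc _ ((u * v') ^ _),
        ← mul_pow]
      congr 4
      linear_combination -u * hv
    · rw [hg.off w y h']
      simp only [map_zero, mul_zero]
      rw [Finset.sum_eq_zero]
      · simp
      · intro z _
        by_cases hz : w ≤ z
        · rw [powMatrix, if_neg (fun hz' => h' (hz.trans hz')), mul_zero]
        · rw [hg.off w z hz, zero_mul]
  · rw [hf.off x w h, reflect_zero, Finset.sum_eq_zero (s := Finset.univ)
      (f := fun i => powMatrix ρ (X - 1 : ℤ[X]) x i * f i w)]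
    · simp
    · intro z _
      by_cases hz : x ≤ z
      · rw [hf.off z w (fun hz' => h (hz.trans hz')), mul_zero]
      · rw [powMatrix, if_neg hz, zero_mul]

theorem degreeOf_homogenize_le (k : ℕ) (p : ℤ[X]) :
    (homogenize k p).degreeOf 1 ≤ p.natDegree := by
  unfold homogenize
  refine (MvPolynomial.degreeOf_mul_le _ _ _).trans ?_
  have h0 : MvPolynomial.degreeOf 1 ((-1 : MvPolynomial (Fin 2) ℤ) ^ k) = 0 := by
    rw [show ((-1 : MvPolynomial (Fin 2) ℤ) ^ k) = MvPolynomial.C ((-1) ^ k) by simp]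
    exact MvPolynomial.degreeOf_C _ _
  rw [h0, zero_add]
  refine (MvPolynomial.degreeOf_sum_le _ _ _).trans (Finset.sup_le fun j _ => ?_)
  by_cases hj : p.coeff j = 0
  · simp [hj]
  · refine (MvPolynomial.degreeOf_mul_le _ _ _).trans ?_
    refine (add_le_add_left (MvPolynomial.degreeOf_C_mul_le _ _ _) _).trans ?_
    have h1 : MvPolynomial.degreeOf 1 ((MvPolynomial.X 0 : MvPolynomial (Fin 2) ℤ) ^ (k - j)) = 0 := by
      have := MvPolynomial.degreeOf_pow_le 1 (MvPolynomial.X 0 : MvPolynomial (Fin 2) ℤ) (k - j)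
      rw [MvPolynomial.degreeOf_X_of_ne (by decide)] at this
      simpa using this
    have h2 := MvPolynomial.degreeOf_pow_le 1 (MvPolynomial.X 1 : MvPolynomial (Fin 2) ℤ) j
    rw [MvPolynomial.degreeOf_X_self, mul_one] at h2
    rw [h1, zero_add]
    exact h2.trans (le_natDegree_of_ne_zero hj)

theorem degreeOf_aeval_mul_le (p : ℤ[X]) :
    (aeval (MvPolynomial.X 0 * MvPolynomial.X 1 : MvPolynomial (Fin 2) ℤ) p).degreeOf 1 ≤
      p.natDegree := by
  rw [aeval_eq_sum_range]
  refine (MvPolynomial.degreeOf_sum_le _ _ _).trans (Finset.sup_le fun j hj => ?_)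
  have hj : j ≤ p.natDegree := by simpa [Nat.lt_succ_iff] using hj
  rw [MvPolynomial.smul_eq_C_mul]
  refine (MvPolynomial.degreeOf_C_mul_le _ _ _).trans ?_
  refine (MvPolynomial.degreeOf_pow_le _ _ _).trans ?_
  have h1 := MvPolynomial.degreeOf_mul_le 1 (MvPolynomial.X 0 : MvPolynomial (Fin 2) ℤ)
    (MvPolynomial.X 1)
  rw [MvPolynomial.degreeOf_X_of_ne (by decide), MvPolynomial.degreeOf_X_self] at h1
  nlinarith

/-- The v-degree of the term at z is at most deg f(x, z) + deg g(z, y). For x < z < y these are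
below half of the two partial ranks; at the endpoints one of the factors is 1. -/
theorem isBFamily_bFormula (hρ : StrictMono ρ) {f g : P → P → ℤ[X]}
    (hf : IsRightKLS ρ f) (hg : IsLeftKLS ρ g) : IsBFamily ρ (bFormula ρ f g) where
  rank_zero x := by
    rw [bFormula, Finset.sum_eq_single x]
    · simp [hf.diag, hg.diag, homogenize]
    · intro z _ hz
      by_cases h : x ≤ z
      · rw [hg.off z x (fun h' => hz (le_antisymm h' h))]
        simp [homogenize]
      · rw [hf.off x z h]; simp
    · simp
  degree_lt x y hxy := by
    have hpos : 0 < ρ y - ρ x := by have := hρ hxy; omega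
    suffices (bFormula ρ f g x y).degreeOf 1 ≤ (ρ y - ρ x - 1) / 2 by omega
    refine (MvPolynomial.degreeOf_sum_le _ _ _).trans (Finset.sup_le fun z _ => ?_)
    by_cases h : x ≤ z
    · by_cases h' : z ≤ y
      · have h1 := MvPolynomial.degreeOf_mul_le 1
          (aeval (MvPolynomial.X 0 * MvPolynomial.X 1 : MvPolynomial (Fin 2) ℤ) (f x z))
          (homogenize (ρ y - ρ z) (g z y))
        have h2 := degreeOf_aeval_mul_le (f x z)
        have h3 := degreeOf_homogenize_le (ρ y - ρ z) (g z y)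
        have e1 := hρ.monotone h
        have e2 := hρ.monotone h'
        rcases h.eq_or_lt with rfl | h4
        · have h5 := hg.deg _ _ hxy
          rw [hf.diag, natDegree_one] at h2
          rw [hf.diag] at h1 ⊢
          omega
        · have h6 := hf.deg _ _ h4
          rcases h'.eq_or_lt with rfl | h5
          · rw [hg.diag, natDegree_one] at h3
            rw [hg.diag] at h1 ⊢
            omega
          · have h7 := hg.deg _ _ h5
            omega
      · rw [hg.off z y h']
        simp [homogenize]
    · rw [hf.off x z h]; simp
  relation x y hxy := by
    have hm : mon 1 1 = mon 1 0 * mon 0 1 := by simp [mon, AddMonoidAlgebra.single_mul_single]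
    rw [hm]
    refine bFormula_relation hρ hf hg ?_ ?_ <;>
      (simp [mon, AddMonoidAlgebra.single_mul_single, AddMonoidAlgebra.one_def]; rfl)

theorem aeval_mon_eq_sum (a b : ℤ) (p : MvPolynomial (Fin 2) ℤ) :
    MvPolynomial.aeval ![mon a 0, mon 0 b] p =
      ∑ m ∈ p.support, AddMonoidAlgebra.single ((m 0 : ℤ) * a, (m 1 : ℤ) * b) (p.coeff m) := by
  conv_lhs => rw [p.as_sum, map_sum]
  refine Finset.sum_congr rfl fun m _ => ?_
  rw [MvPolynomial.aeval_monomial, Finsupp.prod_fintype _ _ (by simp), ← Algebra.smul_def]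
  simp only [Fin.prod_univ_two, Matrix.cons_val_zero, Matrix.cons_val_one, mon,
    AddMonoidAlgebra.single_pow, AddMonoidAlgebra.single_mul_single]
  simp

/-- On the left every exponent of v exceeds k / 2, on the right every one is below k / 2, so no
monomial can occur. -/
theorem eq_zero_of_aeval_mon_eq {k : ℕ} {p : MvPolynomial (Fin 2) ℤ} (hk : 2 * p.degreeOf 1 < k)
    (h : MvPolynomial.aeval ![mon (-1) 0, mon 0 (-1)] p * mon 1 1 ^ k =
      MvPolynomial.aeval ![mon 1 0, mon 0 1] p) : p = 0 := by
  classical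
  by_contra hp
  obtain ⟨m, hm⟩ := MvPolynomial.ne_zero_iff.mp hp
  have hms : m ∈ p.support := MvPolynomial.mem_support_iff.mpr hm
  have h1 := congrArg (fun E : Laurent => E.coeff ((m 0 : ℤ), (m 1 : ℤ))) h
  rw [aeval_mon_eq_sum, aeval_mon_eq_sum] at h1
  simp only [Finset.sum_mul, mon, AddMonoidAlgebra.single_pow,
    AddMonoidAlgebra.single_mul_single, AddMonoidAlgebra.coeff_sum, AddMonoidAlgebra.coeff_single,
    Finsupp.finsetSum_apply, Finsupp.single_apply] at h1
  have h2 : ∑ x ∈ p.support, (if ((x 0 : ℤ) * 1, (x 1 : ℤ) * 1) = ((m 0 : ℤ), (m 1 : ℤ)) then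
      p.coeff x else 0) = p.coeff m := by
    rw [Finset.sum_eq_single m]
    · simp
    · intro b _ hb
      rw [if_neg]
      intro h
      apply hb
      ext i
      simp only [mul_one, Prod.mk.injEq, Nat.cast_inj] at h
      fin_cases i
      · exact h.1
      · exact h.2
    · intro h; exact absurd hms h
  rw [h2] at h1
  rw [← h1] at hm
  obtain ⟨m', hm', hne⟩ := Finset.exists_ne_zero_of_sum_ne_zero hm
  have hcond := (ite_ne_right_iff.mp hne).1
  have e1 := MvPolynomial.monomial_le_degreeOf 1 hms
  have e2 := MvPolynomial.monomial_le_degreeOf 1 hm'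
  have hcond := congrArg Prod.snd hcond
  rw [Prod.snd_add, Prod.smul_snd, nsmul_eq_mul] at hcond
  omega

/-- In the relation for [x, y] the polynomial `B x y` occurs only for z = y on the left and for z =
x on the right; induction on the rank fixes all other terms. The difference of two solutions
therefore satisfies the self-reciprocity of `eq_zero_of_aeval_mon_eq`. -/
theorem IsBFamily.unique (hρ : StrictMono ρ) {B B' : P → P → MvPolynomial (Fin 2) ℤ}
    (hB : IsBFamily ρ B) (hB' : IsBFamily ρ B') {x y : P} (hxy : x ≤ y) : B x y = B' x y := by
  classical
  obtain ⟨n, hn⟩ : ∃ n, ρ y - ρ x = n := ⟨_, rfl⟩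
  induction n using Nat.strong_induction_on generalizing x y with
  | _ n ih =>
  rcases hxy.eq_or_lt with rfl | hlt
  · rw [hB.rank_zero, hB'.rank_zero]
  have hρl := hρ hlt
  have hfin : ∀ F : P → Laurent, ∑ᶠ z ∈ Set.Icc x y, F z =
      ∑ z ∈ Finset.univ.filter (· ∈ Set.Icc x y), F z := by
    intro F
    rw [finsum_mem_eq_sum_of_inter_support_eq (t := Finset.univ.filter (· ∈ Set.Icc x y)) _
      (by ext; simp)]
  have h1 := hB.relation x y hxy
  have h2 := hB'.relation x y hxy
  rw [hfin, hfin] at h1 h2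
  have hx : x ∈ Finset.univ.filter (· ∈ Set.Icc x y) := by simp [hxy]
  have hy : y ∈ Finset.univ.filter (· ∈ Set.Icc x y) := by simp [hxy]
  rw [← Finset.sum_erase_add _ _ hy, ← Finset.sum_erase_add (a := x) _ _ hx] at h1 h2
  have h3 : ∀ z ∈ (Finset.univ.filter (· ∈ Set.Icc x y)).erase y, B x z = B' x z := by
    intro z hz
    simp only [Finset.mem_erase, Finset.mem_filter, Finset.mem_univ, true_and, Set.mem_Icc] at hz
    refine ih _ ?_ hz.2.1 rfl
    have := hρ (lt_of_le_of_ne hz.2.2 hz.1)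
    have := hρ.monotone hz.2.1
    omega
  have h4 : ∀ z ∈ (Finset.univ.filter (· ∈ Set.Icc x y)).erase x, B z y = B' z y := by
    intro z hz
    simp only [Finset.mem_erase, Finset.mem_filter, Finset.mem_univ, true_and, Set.mem_Icc] at hz
    refine ih _ ?_ hz.2.2 rfl
    have := hρ (lt_of_le_of_ne hz.2.1 hz.1.symm)
    have := hρ.monotone hz.2.2
    omega
  rw [Finset.sum_congr rfl fun z hz => by rw [h3 z hz],
    Finset.sum_congr (s₁ := (Finset.univ.filter (· ∈ Set.Icc x y)).erase x) rfl
      fun z hz => by rw [h4 z hz]] at h1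
  rw [Nat.sub_self, Nat.sub_self, pow_zero, pow_zero, mul_one, mul_one] at h1 h2
  rw [← sub_eq_zero]
  refine eq_zero_of_aeval_mon_eq (k := ρ y - ρ x) ?_ ?_
  · have e1 := hB.degree_lt x y hlt
    have e2 := hB'.degree_lt x y hlt
    have e3 := MvPolynomial.degreeOf_sub_le 1 (B x y) (B' x y)
    omega
  · rw [map_sub, map_sub]
    linear_combination h1 - h2

theorem isBFamily_bPoly (hρ : StrictMono ρ) (hE : IsEulerianRank ρ) : IsBFamily ρ (bPoly ρ) := by
  obtain ⟨f, hf⟩ := exists_isRightKLS hρ hE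
  obtain ⟨g, hg⟩ := exists_isLeftKLS hρ hE
  have h : ∃ B, IsBFamily ρ B := ⟨_, isBFamily_bFormula hρ hf hg⟩
  rw [bPoly, dif_pos h]
  exact h.choose_spec

/-- The polynomials `B` of a poset and of the dual poset determine each other. -/
theorem aeval_bPoly_dual {ρ' : Pᵒᵈ → ℕ} (hρ : StrictMono ρ) (hρ' : StrictMono ρ')
    (hE : IsEulerianRank ρ) (hE' : IsEulerianRank ρ')
    (hρρ' : ∀ x y, x ≤ y → ρ' (OrderDual.toDual x) - ρ' (OrderDual.toDual y) = ρ y - ρ x)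
    {S : Type*} [CommRing S] {u u' : S} (v : S) (hu : u * u' = 1) {x y : P} (hxy : x ≤ y) :
    MvPolynomial.aeval ![u, v] (bPoly ρ' (OrderDual.toDual y) (OrderDual.toDual x)) =
      (-u) ^ (ρ y - ρ x) * MvPolynomial.aeval ![u', v] (bPoly ρ x y) := by
  obtain ⟨f, hf⟩ := exists_isRightKLS hρ hE
  obtain ⟨g, hg⟩ := exists_isLeftKLS hρ hE
  have hf' := hf.dual hρρ'
  have hg' := hg.dual hρρ'
  have hu' : u' * u = 1 := by rw [mul_comm, hu]
  -- By uniqueness both sides may be computed from `bFormula`. In the dual poset f and g exchange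
  -- their roles, and replacing u by its inverse exchanges uv and v/u, so the sums agree term by
  -- term up to powers of -u.
  rw [(isBFamily_bPoly hρ hE).unique hρ (isBFamily_bFormula hρ hf hg) hxy,
    (isBFamily_bPoly hρ' hE').unique hρ' (isBFamily_bFormula hρ' hg' hf')
      (OrderDual.toDual_le_toDual.mpr hxy), aeval_bFormula hf' v hu, aeval_bFormula hg v hu',
    Finset.mul_sum, ← OrderDual.toDual.sum_comp]
  refine Finset.sum_congr rfl fun z _ => ?_
  simp only [OrderDual.ofDual_toDual]
  by_cases h : x ≤ z
  · by_cases h' : z ≤ y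
    · rw [hρρ' x z h]
      have e1 := hρ.monotone h
      have e2 := hρ.monotone h'
      obtain ⟨a, ha⟩ := Nat.exists_eq_add_of_le e1
      obtain ⟨b, hb⟩ := Nat.exists_eq_add_of_le e2
      rw [show ρ z - ρ x = a by omega, show ρ y - ρ x = a + b by omega,
        show ρ y - ρ z = b by omega, pow_add, mul_comm v u, mul_comm u' v]
      have h2 : (-u) ^ b * (-u') ^ b = 1 := by
        rw [← mul_pow, neg_mul_neg, hu, one_pow]
      linear_combination (-(-u) ^ a * aeval (v * u') (f x z) * aeval (u * v) (g z y)) * h2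
    · rw [hg.off z y h']; simp
  · rw [hf.off x z h]; simp

end BPoly

/-! ### Half-open decompositions of polyhedral cones into simplicial cones -/

section Triangulation

open Filter Topology

variable {α E : Type*} [AddCommGroup E] [Module ℝ E] {v : α → E}

theorem mem_hull_image_iff {G : Finset α} {p : E} :
    p ∈ PointedCone.hull ℝ (v '' G) ↔
      ∃ x : α → ℝ, (∀ a ∈ G, 0 ≤ x a) ∧ p = ∑ a ∈ G, x a • v a := by
  rw [PointedCone.hull, Submodule.mem_span_image_finset_iff_exists_fun']
  constructor
  · rintro ⟨c, hc⟩
    exact ⟨fun a => (c a : ℝ), fun a _ => (c a).2, hc.symm⟩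
  · rintro ⟨x, hx, rfl⟩
    refine ⟨fun a => ⟨max (x a) 0, le_max_right _ _⟩, Finset.sum_congr rfl fun a ha => ?_⟩
    change (max (x a) 0) • v a = _
    rw [max_eq_left (hx a ha)]

theorem mem_span_image_iff {G : Finset α} {p : E} :
    p ∈ Submodule.span ℝ (v '' G) ↔ ∃ x : α → ℝ, p = ∑ a ∈ G, x a • v a := by
  rw [Submodule.mem_span_image_finset_iff_exists_fun']
  exact ⟨fun ⟨c, hc⟩ => ⟨c, hc.symm⟩, fun ⟨c, hc⟩ => ⟨c, hc.symm⟩⟩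

theorem exists_dual_family {σ : Finset α} (h : LinearIndepOn ℝ v (σ : Set α)) :
    ∃ l : α → E →ₗ[ℝ] ℝ, ∀ s ∈ σ, ∀ x : α → ℝ, l s (∑ t ∈ σ, x t • v t) = x s := by
  classical
  obtain ⟨g, hg⟩ := LinearMap.exists_leftInverse_of_injective
    (Finsupp.linearCombination ℝ (fun s : (σ : Set α) => v s)) (linearIndependent_iff_ker.mp h)
  refine ⟨fun s => if hs : s ∈ σ then (Finsupp.lapply ⟨s, hs⟩).comp g else 0, fun s hs x => ?_⟩
  have h1 : ∑ t ∈ σ, x t • v t = Finsupp.linearCombination ℝ (fun s : (σ : Set α) => v s)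
      (∑ t : (σ : Set α), Finsupp.single t (x t)) := by
    rw [map_sum, ← Finset.sum_coe_sort]
    simp
  rw [h1]
  simp only [dif_pos hs]
  have h2 := LinearMap.congr_fun hg (∑ t : (σ : Set α), Finsupp.single t (x t))
  simp only [LinearMap.coe_comp, Function.comp_apply, LinearMap.id_coe, id_eq] at h2
  rw [LinearMap.comp_apply, h2]
  simp [Finsupp.single_apply]

open Classical in
/-- The coordinates with respect to a linearly independent family. -/
def coordFn (v : α → E) (σ : Finset α) : α → E →ₗ[ℝ] ℝ :=
  if h : LinearIndepOn ℝ v (σ : Set α) then (exists_dual_family h).choose else 0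

theorem coordFn_sum {σ : Finset α} (h : LinearIndepOn ℝ v (σ : Set α)) {s : α} (hs : s ∈ σ)
    (x : α → ℝ) : coordFn v σ s (∑ t ∈ σ, x t • v t) = x s := by
  rw [coordFn, dif_pos h]
  exact (exists_dual_family h).choose_spec s hs x

/-- `σ` is a basis of the span of `G` which consists of elements of `G`. -/
structure IsConeBasis (v : α → E) (G σ : Finset α) : Prop where
  subset : σ ⊆ G
  indep : LinearIndepOn ℝ v (σ : Set α)
  span_eq : Submodule.span ℝ (v '' (σ : Set α)) = Submodule.span ℝ (v '' (G : Set α))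

variable {G σ : Finset α}

theorem IsConeBasis.sum_coordFn (h : IsConeBasis v G σ) {p : E}
    (hp : p ∈ Submodule.span ℝ (v '' (G : Set α))) : ∑ s ∈ σ, coordFn v σ s p • v s = p := by
  rw [← h.span_eq, mem_span_image_iff] at hp
  obtain ⟨x, rfl⟩ := hp
  exact Finset.sum_congr rfl fun s hs => by rw [coordFn_sum h.indep hs]

/-- The cone of the combinations with nonnegative coefficients, positive on `J`. -/
def halfOpenCone (v : α → E) (σ J : Finset α) : Set E :=
  {p | ∃ x : α → ℝ, (∀ s ∈ σ, 0 ≤ x s) ∧ (∀ s ∈ J, 0 < x s) ∧ p = ∑ s ∈ σ, x s • v s}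

theorem IsConeBasis.mem_halfOpenCone_iff (h : IsConeBasis v G σ) {J : Finset α} (hJ : J ⊆ σ)
    {p : E} (hp : p ∈ Submodule.span ℝ (v '' (G : Set α))) : p ∈ halfOpenCone v σ J ↔
      (∀ s ∈ σ, 0 ≤ coordFn v σ s p) ∧ ∀ s ∈ J, 0 < coordFn v σ s p := by
  constructor
  · rintro ⟨x, hx, hx', rfl⟩
    exact ⟨fun s hs => by rw [coordFn_sum h.indep hs]; exact hx s hs,
      fun s hs => by rw [coordFn_sum h.indep (hJ hs)]; exact hx' s hs⟩
  · rintro ⟨h1, h2⟩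
    exact ⟨fun s => coordFn v σ s p, h1, h2, (h.sum_coordFn hp).symm⟩

theorem IsConeBasis.halfOpenCone_subset_hull (h : IsConeBasis v G σ) {J : Finset α} :
    halfOpenCone v σ J ⊆ PointedCone.hull ℝ (v '' (G : Set α)) := by
  rintro p ⟨x, hx, -, rfl⟩
  exact Submodule.span_mono (Set.image_mono (Finset.coe_subset.mpr h.subset))
    (mem_hull_image_iff.mpr ⟨x, hx, rfl⟩)

/-- The ratio test of the simplex algorithm. -/
theorem exists_ratio {σ : Finset α} {x g : α → ℝ} (hx : ∀ s ∈ σ, 0 ≤ x s)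
    (hg : ∃ s ∈ σ, 0 < g s) :
    ∃ e, 0 ≤ e ∧ ∃ s₀ ∈ σ, 0 < g s₀ ∧ x s₀ = e * g s₀ ∧ ∀ s ∈ σ, 0 ≤ x s - e * g s := by
  classical
  obtain ⟨s₀, hs₀, hmin⟩ := Finset.exists_min_image (σ.filter fun s => 0 < g s) (fun s => x s / g s)
    (by obtain ⟨s, hs, h⟩ := hg; exact ⟨s, by simp [hs, h]⟩)
  simp only [Finset.mem_filter, and_imp] at hs₀ hmin
  refine ⟨x s₀ / g s₀, div_nonneg (hx _ hs₀.1) hs₀.2.le, s₀, hs₀.1, hs₀.2, ?_, fun s hs => ?_⟩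
  · field_simp [hs₀.2.ne']
  · rcases le_or_gt (g s) 0 with h | h
    · have : x s₀ / g s₀ * g s ≤ 0 :=
        mul_nonpos_of_nonneg_of_nonpos (div_nonneg (hx _ hs₀.1) hs₀.2.le) h
      linarith [hx s hs]
    · have := hmin s hs h
      rw [le_div_iff₀ h] at this
      linarith

/-- Carathéodory's theorem for cones: in a representation of p with the fewest generators, a linear
dependence could be subtracted until some coefficient vanishes. -/
theorem exists_indep_of_mem_hull {p : E} (hp : p ∈ PointedCone.hull ℝ (v '' (G : Set α))) :
    ∃ σ ⊆ G, LinearIndepOn ℝ v (σ : Set α) ∧ ∃ x : α → ℝ, (∀ s ∈ σ, 0 ≤ x s) ∧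
      p = ∑ s ∈ σ, x s • v s := by
  classical
  have hne : (G.powerset.filter fun σ => ∃ x : α → ℝ, (∀ s ∈ σ, 0 ≤ x s) ∧
      p = ∑ s ∈ σ, x s • v s).Nonempty := ⟨G, by simpa using mem_hull_image_iff.mp hp⟩
  obtain ⟨σ, hσ, hmin⟩ := Finset.exists_min_image _ Finset.card hne
  simp only [Finset.mem_filter, Finset.mem_powerset, and_imp] at hσ hmin
  obtain ⟨hσG, x, hx, hpx⟩ := hσ
  refine ⟨σ, hσG, ?_, x, hx, hpx⟩
  by_contra hdep
  obtain ⟨g, hg0, hg⟩ : ∃ g : α → ℝ, ∑ s ∈ σ, g s • v s = 0 ∧ ∃ s ∈ σ, 0 < g s := by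
    rw [linearIndepOn_finset_iff] at hdep
    push Not at hdep
    obtain ⟨g, hg0, s, hs, hgs⟩ := hdep
    rcases lt_or_gt_of_ne hgs with h | h
    · exact ⟨-g, by simp [hg0], s, hs, by simpa using h⟩
    · exact ⟨g, hg0, s, hs, h⟩
  obtain ⟨e, -, s₀, hs₀, -, hx0, hnn⟩ := exists_ratio hx hg
  have := hmin (σ.erase s₀) ((Finset.erase_subset _ _).trans hσG) ⟨fun s => x s - e * g s,
    fun s hs => hnn s (Finset.mem_of_mem_erase hs), ?_⟩
  · rw [Finset.card_erase_of_mem hs₀] at this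
    have := Finset.card_pos.mpr ⟨s₀, hs₀⟩
    omega
  · rw [Finset.sum_erase]
    · simp only [sub_smul, mul_smul]
      rw [Finset.sum_sub_distrib, ← Finset.smul_sum, hg0, smul_zero, sub_zero, hpx]
    · simp [hx0]

theorem exists_isConeBasis_of_mem_hull {p : E} (hp : p ∈ PointedCone.hull ℝ (v '' (G : Set α))) :
    ∃ σ, IsConeBasis v G σ ∧ ∀ s ∈ σ, 0 ≤ coordFn v σ s p := by
  classical
  obtain ⟨τ, hτG, hτ, x, hx, hpx⟩ := exists_indep_of_mem_hull hp
  obtain ⟨b, hbG, hτb, hspan, hb⟩ := exists_linearIndepOn_extension hτ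
    (Finset.coe_subset.mpr hτG)
  have hfin : b.Finite := G.finite_toSet.subset hbG
  refine ⟨hfin.toFinset, ⟨by simpa using hbG, by simpa using hb, ?_⟩, ?_⟩
  · rw [hfin.coe_toFinset]
    exact le_antisymm (Submodule.span_mono (Set.image_mono hbG)) (Submodule.span_le.mpr hspan)
  · intro s hs
    have h1 : p = ∑ t ∈ hfin.toFinset, (if t ∈ τ then x t else 0) • v t := by
      rw [hpx]
      simp only [ite_smul, zero_smul]
      rw [← Finset.sum_filter]
      refine Finset.sum_congr ?_ fun _ _ => rfl
      ext t
      simp only [Finset.mem_filter, Set.Finite.mem_toFinset]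
      exact ⟨fun h => ⟨hτb h, h⟩, fun h => h.2⟩
    rw [h1, coordFn_sum (by simpa using hb) hs]
    split_ifs with h
    · exact hx s h
    · exact le_rfl

/-- Replacing an element of a basis. -/
theorem IsConeBasis.exchange [DecidableEq α] (h : IsConeBasis v G σ) {a s₀ : α} (ha : a ∈ G) (hs₀ : s₀ ∈ σ)
    (haσ : a ∉ σ) (hne : coordFn v σ s₀ (v a) ≠ 0) : IsConeBasis v G (insert a (σ.erase s₀)) := by
  have haG : v a ∈ Submodule.span ℝ (v '' (G : Set α)) :=
    Submodule.subset_span ⟨a, ha, rfl⟩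
  have hsum := h.sum_coordFn haG
  refine ⟨?_, ?_, ?_⟩
  · intro t ht
    rcases Finset.mem_insert.mp ht with rfl | ht
    · exact ha
    · exact h.subset (Finset.mem_of_mem_erase ht)
  · rw [Finset.coe_insert, linearIndepOn_insert (by simp [haσ])]
    refine ⟨h.indep.mono (by simp), fun hmem => hne ?_⟩
    rw [mem_span_image_iff] at hmem
    obtain ⟨x, hx⟩ := hmem
    have h1 : v a = ∑ t ∈ σ, (if t = s₀ then 0 else x t) • v t := by
      rw [hx, ← Finset.sum_erase (s := σ) (a := s₀) (by simp)]
      refine Finset.sum_congr rfl fun t ht => ?_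
      rw [if_neg (Finset.ne_of_mem_erase ht)]
    rw [h1, coordFn_sum h.indep hs₀, if_pos rfl]
  · rw [← h.span_eq]
    refine le_antisymm (Submodule.span_le.mpr ?_) (Submodule.span_le.mpr ?_)
    · rintro _ ⟨t, ht, rfl⟩
      rcases Finset.mem_insert.mp ht with rfl | ht
      · rw [h.span_eq]; exact haG
      · exact Submodule.subset_span ⟨t, Finset.mem_of_mem_erase ht, rfl⟩
    · have hmem : ∀ t ∈ insert a (σ.erase s₀),
          v t ∈ Submodule.span ℝ (v '' ((insert a (σ.erase s₀) : Finset α) : Set α)) :=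
        fun t ht => Submodule.subset_span ⟨t, ht, rfl⟩
      rintro _ ⟨t, ht, rfl⟩
      by_cases hts : t = s₀
      · subst hts
        rw [← Finset.add_sum_erase _ _ hs₀] at hsum
        have h2 : v t = (coordFn v σ t (v a))⁻¹ •
            (v a - ∑ s ∈ σ.erase t, coordFn v σ s (v a) • v s) := by
          rw [eq_inv_smul_iff₀ hne, eq_sub_iff_add_eq, hsum]
        rw [SetLike.mem_coe, h2]
        refine Submodule.smul_mem _ _ (Submodule.sub_mem _ (hmem a (Finset.mem_insert_self _ _))
          (Submodule.sum_mem _ fun s hs => Submodule.smul_mem _ _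
            (hmem s (Finset.mem_insert_of_mem hs))))
      · exact hmem t (Finset.mem_insert_of_mem (Finset.mem_erase.mpr ⟨hts, ht⟩))

/-- The linear function with the values `c` on a basis. -/
def costFn (v : α → E) (c : α → ℝ) (σ : Finset α) : E →ₗ[ℝ] ℝ := ∑ s ∈ σ, c s • coordFn v σ s

theorem costFn_apply (c : α → ℝ) (σ : Finset α) (p : E) :
    costFn v c σ p = ∑ s ∈ σ, c s * coordFn v σ s p := by
  simp [costFn]

theorem IsConeBasis.costFn_sum (h : IsConeBasis v G σ) (c x : α → ℝ) :
    costFn v c σ (∑ t ∈ σ, x t • v t) = ∑ s ∈ σ, c s * x s := by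
  rw [costFn_apply]
  exact Finset.sum_congr rfl fun s hs => by rw [coordFn_sum h.indep hs]

/-- For fixed σ and a ∉ σ, equality is a linear condition on c in which c a has coefficient -1,
hence a proper hyperplane. Finitely many of them do not cover the space. These c are the heights of
a regular triangulation. -/
theorem exists_generic_heights (v : α → E) (G : Finset α) :
    ∃ c : α → ℝ, ∀ σ, IsConeBasis v G σ → ∀ a ∈ G, a ∉ σ → costFn v c σ (v a) ≠ c a := by
  classical
  let ι := {p : Finset α × α // p.1 ∈ G.powerset ∧ p.2 ∈ G ∧ p.2 ∉ p.1}
  have : Finite ι := by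
    refine Set.Finite.subset (s := (G.powerset ×ˢ G : Finset (Finset α × α)))
      (Finset.finite_toSet _) ?_
    rintro p ⟨h1, h2, h3⟩
    exact Finset.mem_coe.mpr (Finset.mem_product.mpr ⟨h1, h2⟩)
  let f : ι → Module.Dual ℝ (α → ℝ) := fun p =>
    ∑ s ∈ p.1.1, coordFn v p.1.1 s (v p.1.2) • LinearMap.proj s - LinearMap.proj p.1.2
  obtain ⟨c, hc⟩ := Module.Dual.exists_forall_ne_zero_of_forall_exists f (fun p => by
    refine ⟨Pi.single p.1.2 1, ?_⟩
    have : ∑ s ∈ p.1.1, coordFn v p.1.1 s (v p.1.2) * (Pi.single p.1.2 1 : α → ℝ) s = 0 := by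
      refine Finset.sum_eq_zero fun s hs => ?_
      rw [Pi.single_eq_of_ne, mul_zero]
      rintro rfl
      exact p.2.2.2 hs
    simp [f, this])
  refine ⟨c, fun σ hσ a ha haσ h => hc ⟨(σ, a), Finset.mem_powerset.mpr hσ.subset, ha, haσ⟩ ?_⟩
  simp only [f, LinearMap.sub_apply, LinearMap.sum_apply, LinearMap.smul_apply,
    LinearMap.proj_apply, smul_eq_mul, sub_eq_zero]
  rw [← h, costFn_apply]
  exact Finset.sum_congr rfl fun s _ => mul_comm _ _

/-- Simplex algorithm: among the bases with p in their cone, take one of least cost at p. If a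
generator a lay strictly below the cost function of this basis, pivoting a in would change the cost
by e (c a - cost of a) < 0; here e > 0 because no coordinate of p vanishes. -/
theorem exists_optimal_basis (deg : E →ₗ[ℝ] ℝ) (hdeg : ∀ a ∈ G, deg (v a) = 1) (c : α → ℝ) {p : E}
    (hp : p ∈ PointedCone.hull ℝ (v '' (G : Set α)))
    (hgen : ∀ σ, IsConeBasis v G σ → ∀ s ∈ σ, coordFn v σ s p ≠ 0) :
    ∃ σ, IsConeBasis v G σ ∧ (∀ a ∈ G, costFn v c σ (v a) ≤ c a) ∧
      ∀ s ∈ σ, 0 < coordFn v σ s p := by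
  classical
  have hpspan : p ∈ Submodule.span ℝ (v '' (G : Set α)) := PointedCone.hull_le_span ℝ _ hp
  have hne : (G.powerset.filter fun σ => IsConeBasis v G σ ∧
      ∀ s ∈ σ, 0 ≤ coordFn v σ s p).Nonempty := by
    obtain ⟨σ, h, h'⟩ := exists_isConeBasis_of_mem_hull hp
    exact ⟨σ, by simp only [Finset.mem_filter, Finset.mem_powerset]; exact ⟨h.subset, h, h'⟩⟩
  obtain ⟨σ, hσ, hmin⟩ := Finset.exists_min_image _ (fun σ => costFn v c σ p) hne
  simp only [Finset.mem_filter, Finset.mem_powerset, and_imp] at hσ hmin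
  obtain ⟨-, hB, hnn⟩ := hσ
  have hpos : ∀ s ∈ σ, 0 < coordFn v σ s p := fun s hs =>
    lt_of_le_of_ne (hnn s hs) (hgen σ hB s hs).symm
  refine ⟨σ, hB, fun a ha => ?_, hpos⟩
  by_contra! hlt
  have haG : v a ∈ Submodule.span ℝ (v '' (G : Set α)) := Submodule.subset_span ⟨a, ha, rfl⟩
  have haσ : a ∉ σ := by
    intro h
    have : v a = ∑ t ∈ σ, (if t = a then 1 else 0 : ℝ) • v t := by simp [h]
    rw [this, hB.costFn_sum] at hlt
    simp [h] at hlt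
  have hasum := hB.sum_coordFn haG
  have hpsum := hB.sum_coordFn hpspan
  -- The ratio test needs a positive coordinate of v a; one exists because the coordinates add up to
  -- deg (v a) = 1.
  obtain ⟨e, he, s₀, hs₀, hg, hx, hnn'⟩ := exists_ratio (g := fun s => coordFn v σ s (v a)) hnn (by
    by_contra! hcon
    have h1 : deg (v a) = ∑ s ∈ σ, coordFn v σ s (v a) := by
      conv_lhs => rw [← hasum]
      rw [map_sum]
      exact Finset.sum_congr rfl fun s hs => by rw [map_smul, hdeg s (hB.subset hs)]; simp
    have h2 := Finset.sum_nonpos hcon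
    rw [← h1, hdeg a ha] at h2
    linarith)
  have hB' := hB.exchange ha hs₀ haσ hg.ne'
  have he' : 0 < e := by
    refine lt_of_le_of_ne he fun h => ?_
    rw [← h, zero_mul] at hx
    exact (hpos s₀ hs₀).ne' hx
  have ha' : a ∉ σ.erase s₀ := fun h => haσ (Finset.mem_of_mem_erase h)
  let y : α → ℝ := fun t => if t = a then e else coordFn v σ t p - e * coordFn v σ t (v a)
  have hya : y a = e := if_pos rfl
  have hyt : ∀ t ∈ σ, y t = coordFn v σ t p - e * coordFn v σ t (v a) := fun t ht =>
    if_neg (by rintro rfl; exact haσ ht)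
  have hpy : p = ∑ t ∈ insert a (σ.erase s₀), y t • v t := by
    rw [Finset.sum_insert ha', hya, Finset.sum_erase _ (by rw [hyt s₀ hs₀, hx]; simp),
      Finset.sum_congr rfl fun t ht => by rw [hyt t ht]]
    simp only [sub_smul, mul_smul]
    rw [Finset.sum_sub_distrib, ← Finset.smul_sum, hpsum, hasum]
    abel
  have hcost : costFn v c (insert a (σ.erase s₀)) p =
      costFn v c σ p + e * (c a - costFn v c σ (v a)) := by
    conv_lhs => rw [hpy]
    rw [hB'.costFn_sum, Finset.sum_insert ha', hya,
      Finset.sum_erase _ (by rw [hyt s₀ hs₀, hx]; simp), costFn_apply, costFn_apply,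
      Finset.sum_congr rfl fun t ht => by rw [hyt t ht]]
    simp only [mul_sub]
    rw [Finset.sum_sub_distrib, Finset.mul_sum]
    have : ∀ s, c s * (e * coordFn v σ s (v a)) = e * (c s * coordFn v σ s (v a)) := fun s => by ring
    simp_rw [this]
    ring
  have := hmin _ hB'.subset hB' (fun s hs => by
    rw [hpy, coordFn_sum hB'.indep hs]
    rcases Finset.mem_insert.mp hs with rfl | hs
    · rw [hya]; exact he
    · rw [hyt s (Finset.mem_of_mem_erase hs)]; exact hnn' s (Finset.mem_of_mem_erase hs))
  rw [hcost] at this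
  nlinarith

/-- Each cost function bounds the other from below at p, so they agree there. Equality then holds
term by term at the elements of τ, all of which carry positive coefficients, and genericity of c
puts these elements in σ. -/
theorem optimal_basis_subset {c : α → ℝ}
    (hc : ∀ σ, IsConeBasis v G σ → ∀ a ∈ G, a ∉ σ → costFn v c σ (v a) ≠ c a) {σ τ : Finset α}
    (hσ : IsConeBasis v G σ) (hτ : IsConeBasis v G τ) (hσc : ∀ a ∈ G, costFn v c σ (v a) ≤ c a)
    (hτc : ∀ a ∈ G, costFn v c τ (v a) ≤ c a) {p : E}
    (hp : p ∈ Submodule.span ℝ (v '' (G : Set α))) (h1 : ∀ s ∈ σ, 0 < coordFn v σ s p)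
    (h2 : ∀ s ∈ τ, 0 < coordFn v τ s p) : τ ⊆ σ := by
  have key : ∀ σ τ, IsConeBasis v G τ → (∀ a ∈ G, costFn v c σ (v a) ≤ c a) →
      (∀ s ∈ τ, 0 < coordFn v τ s p) → costFn v c σ p ≤ costFn v c τ p := by
    intro σ τ hτ hσc h2
    conv_lhs => rw [← hτ.sum_coordFn hp]
    rw [map_sum, costFn_apply]
    refine Finset.sum_le_sum fun s hs => ?_
    rw [map_smul, smul_eq_mul, mul_comm]
    exact mul_le_mul_of_nonneg_right (hσc s (hτ.subset hs)) (h2 s hs).le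
  have heq := le_antisymm (key σ τ hτ hσc h2) (key τ σ hσ hτc h1)
  conv_lhs at heq => rw [← hτ.sum_coordFn hp]
  rw [map_sum, costFn_apply, Finset.sum_eq_sum_iff_of_le] at heq
  · intro t ht
    by_contra htσ
    have := heq t ht
    rw [map_smul, smul_eq_mul, mul_comm] at this
    exact hc σ hσ t (hτ.subset ht) htσ (mul_right_cancel₀ (h2 t ht).ne' this)
  · intro s hs
    rw [map_smul, smul_eq_mul, mul_comm]
    exact mul_le_mul_of_nonneg_right (hσc s (hτ.subset hs)) (h2 s hs).le

theorem eventually_pos_of_pos {a : ℝ} (b : ℝ) (ha : 0 < a) : ∀ᶠ e in 𝓝[>] (0 : ℝ), 0 < a + e * b := by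
  have : Tendsto (fun e : ℝ => a + e * b) (𝓝[>] 0) (𝓝 (a + 0 * b)) := by
    apply Tendsto.mono_left _ nhdsWithin_le_nhds
    exact (by fun_prop : Continuous fun e : ℝ => a + e * b).tendsto 0
  exact this.eventually (lt_mem_nhds (by simpa))

/-- Lexicographic positivity of (a, b), written as the condition that defines a half-open cone: a ≥
0, and strictly so when b < 0. -/
theorem eventually_pos_iff {a b : ℝ} (hb : b ≠ 0) :
    ∀ᶠ e in 𝓝[>] (0 : ℝ), (0 < a + e * b ↔ 0 ≤ a ∧ (b < 0 → 0 < a)) ∧ a + e * b ≠ 0 := by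
  rcases lt_trichotomy a 0 with h | rfl | h
  · filter_upwards [eventually_pos_of_pos (-b) (neg_pos.mpr h)] with e he
    exact ⟨⟨fun h' => by linarith, fun h' => by linarith [h'.1]⟩, fun h' => by linarith⟩
  · filter_upwards [self_mem_nhdsWithin] with e he
    have he : 0 < e := he
    simp only [zero_add, le_refl, true_and, lt_irrefl, imp_false, not_lt]
    refine ⟨⟨fun h => le_of_lt (pos_of_mul_pos_right h he.le), fun h => ?_⟩, ?_⟩
    · exact mul_pos he (lt_of_le_of_ne h hb.symm)
    · exact mul_ne_zero he.ne' hb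
  · filter_upwards [eventually_pos_of_pos b h] with e he
    exact ⟨⟨fun _ => ⟨h.le, fun _ => h⟩, fun _ => he⟩, he.ne'⟩

/-- Moving p slightly in the direction q makes all coordinates nonzero, and p + e q is interior to
the cone of σ exactly when p lies in the half-open cone selected by q. One e serves all the finitely
many bases. -/
theorem eventually_coordFn (v : α → E) (G : Finset α) (p : E) {q : E}
    (hq : ∀ σ, IsConeBasis v G σ → ∀ s ∈ σ, coordFn v σ s q ≠ 0) :
    ∀ᶠ e in 𝓝[>] (0 : ℝ), ∀ σ, IsConeBasis v G σ → ∀ s ∈ σ,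
      (0 < coordFn v σ s (p + e • q) ↔
        0 ≤ coordFn v σ s p ∧ (coordFn v σ s q < 0 → 0 < coordFn v σ s p)) ∧
      coordFn v σ s (p + e • q) ≠ 0 := by
  have h : ∀ σ ∈ G.powerset, ∀ᶠ e in 𝓝[>] (0 : ℝ), IsConeBasis v G σ → ∀ s ∈ σ,
      (0 < coordFn v σ s (p + e • q) ↔
        0 ≤ coordFn v σ s p ∧ (coordFn v σ s q < 0 → 0 < coordFn v σ s p)) ∧
      coordFn v σ s (p + e • q) ≠ 0 := by
    intro σ _
    by_cases hσ : IsConeBasis v G σ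
    · have := (Filter.eventually_all_finset σ).mpr fun s hs =>
        eventually_pos_iff (a := coordFn v σ s p) (hq σ hσ s hs)
      filter_upwards [this] with e he _ s hs
      rw [map_add, map_smul, smul_eq_mul]
      exact he s hs
    · exact Eventually.of_forall fun e h => absurd h hσ
  filter_upwards [(Filter.eventually_all_finset _).mpr h] with e he σ hσ
  exact he σ (Finset.mem_powerset.mpr hσ.subset) hσ

/-- A generic direction `q` selects a half-open cone for every optimal basis. -/
theorem existsUnique_halfOpenCone (deg : E →ₗ[ℝ] ℝ)
    (hdeg : ∀ a ∈ G, deg (v a) = 1) {c : α → ℝ}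
    (hc : ∀ σ, IsConeBasis v G σ → ∀ a ∈ G, a ∉ σ → costFn v c σ (v a) ≠ c a) {q : E}
    (hqs : q ∈ Submodule.span ℝ (v '' (G : Set α)))
    (hq : ∀ σ, IsConeBasis v G σ → ∀ s ∈ σ, coordFn v σ s q ≠ 0) (T : Finset (Finset α))
    (hT : ∀ σ, σ ∈ T ↔ IsConeBasis v G σ ∧ ∀ a ∈ G, costFn v c σ (v a) ≤ c a)
    (J : Finset α → Finset α) (hJ : ∀ σ s, s ∈ J σ ↔ s ∈ σ ∧ coordFn v σ s q < 0) :
    (∀ p ∈ Submodule.span ℝ (v '' (G : Set α)),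
      (∀ᶠ e in 𝓝[>] (0 : ℝ), p + e • q ∈ PointedCone.hull ℝ (v '' (G : Set α))) ↔
        ∃ σ ∈ T, p ∈ halfOpenCone v σ (J σ)) ∧
    ∀ p, ∀ σ ∈ T, ∀ τ ∈ T, p ∈ halfOpenCone v σ (J σ) → p ∈ halfOpenCone v τ (J τ) → σ = τ := by
  have hspan : ∀ {p : E}, p ∈ PointedCone.hull ℝ (v '' (G : Set α)) →
      p ∈ Submodule.span ℝ (v '' (G : Set α)) := fun h => PointedCone.hull_le_span ℝ _ h
  have hmem : ∀ p ∈ Submodule.span ℝ (v '' (G : Set α)), ∀ σ ∈ T, p ∈ halfOpenCone v σ (J σ) ↔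
      ∀ s ∈ σ, 0 ≤ coordFn v σ s p ∧ (coordFn v σ s q < 0 → 0 < coordFn v σ s p) := by
    intro p hp σ hσ
    rw [((hT σ).mp hσ).1.mem_halfOpenCone_iff (fun s hs => ((hJ σ s).mp hs).1) hp]
    exact ⟨fun h s hs => ⟨h.1 s hs, fun h' => h.2 s ((hJ σ s).mpr ⟨hs, h'⟩)⟩,
      fun h => ⟨fun s hs => (h s hs).1, fun s hs => (h s ((hJ σ s).mp hs).1).2 ((hJ σ s).mp hs).2⟩⟩
  have hev := fun p => eventually_coordFn v G p hq
  refine ⟨fun p hp => ⟨fun h => ?_, ?_⟩, fun p σ hσ τ hτ h1 h2 => ?_⟩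
  · obtain ⟨e, he, he'⟩ := (h.and (hev p)).exists
    obtain ⟨σ, hσ, hσc, hpos⟩ := exists_optimal_basis deg hdeg c he fun σ hσ s hs => (he' σ hσ s hs).2
    refine ⟨σ, (hT σ).mpr ⟨hσ, hσc⟩, (hmem p hp σ ((hT σ).mpr ⟨hσ, hσc⟩)).mpr fun s hs => ?_⟩
    exact (he' σ hσ s hs).1.mp (hpos s hs)
  · rintro ⟨σ, hσ, hpσ⟩
    filter_upwards [hev p] with e he
    have hB := ((hT σ).mp hσ).1
    rw [← hB.sum_coordFn (Submodule.add_mem _ hp (Submodule.smul_mem _ e hqs))]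
    refine hB.halfOpenCone_subset_hull (J := ∅) ⟨_, fun s hs => ?_, by simp, rfl⟩
    exact ((he σ hB s hs).1.mpr ((hmem p hp σ hσ).mp hpσ s hs)).le
  · have hB := (hT σ).mp hσ
    have hB' := (hT τ).mp hτ
    have hp := hspan (hB.1.halfOpenCone_subset_hull h1)
    obtain ⟨e, he⟩ := (hev p).exists
    have hpe := Submodule.add_mem _ hp (Submodule.smul_mem _ e hqs)
    have e1 : ∀ s ∈ σ, 0 < coordFn v σ s (p + e • q) := fun s hs =>
      (he σ hB.1 s hs).1.mpr ((hmem p hp σ hσ).mp h1 s hs)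
    have e2 : ∀ s ∈ τ, 0 < coordFn v τ s (p + e • q) := fun s hs =>
      (he τ hB'.1 s hs).1.mpr ((hmem p hp τ hτ).mp h2 s hs)
    exact (optimal_basis_subset hc hB'.1 hB.1 hB'.2 hB.2 hpe e2 e1).antisymm
      (optimal_basis_subset hc hB.1 hB'.1 hB.2 hB'.2 hpe e1 e2)

/-- The cone `hull G` and its relative interior are disjoint unions of half-open simplicial cones,
with complementary sets of open facets. -/
theorem exists_halfOpen_decomposition {κ : Type*} (deg : E →ₗ[ℝ] ℝ)
    (hdeg : ∀ a ∈ G, deg (v a) = 1) (N : Finset κ) (n : κ → E →ₗ[ℝ] ℝ)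
    (hK : ∀ p ∈ Submodule.span ℝ (v '' (G : Set α)),
      p ∈ PointedCone.hull ℝ (v '' (G : Set α)) ↔ ∀ k ∈ N, 0 ≤ n k p)
    (hint : ∃ q ∈ Submodule.span ℝ (v '' (G : Set α)), ∀ k ∈ N, 0 < n k q) :
    ∃ (T : Finset (Finset α)) (J J' : Finset α → Finset α),
      (∀ σ ∈ T, IsConeBasis v G σ ∧ J σ ⊆ σ ∧ J' σ ⊆ σ ∧ ∀ s ∈ σ, s ∈ J' σ ↔ s ∉ J σ) ∧
      (∀ p, p ∈ PointedCone.hull ℝ (v '' (G : Set α)) ↔ ∃ σ ∈ T, p ∈ halfOpenCone v σ (J σ)) ∧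
      (∀ p, (p ∈ Submodule.span ℝ (v '' (G : Set α)) ∧ ∀ k ∈ N, 0 < n k p) ↔
        ∃ σ ∈ T, p ∈ halfOpenCone v σ (J' σ)) ∧
      (∀ p, ∀ σ ∈ T, ∀ τ ∈ T, p ∈ halfOpenCone v σ (J σ) → p ∈ halfOpenCone v τ (J τ) → σ = τ) ∧
      ∀ p, ∀ σ ∈ T, ∀ τ ∈ T, p ∈ halfOpenCone v σ (J' σ) → p ∈ halfOpenCone v τ (J' τ) →
        σ = τ := by
  classical
  set W := Submodule.span ℝ (v '' (G : Set α)) with hW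
  set K := PointedCone.hull ℝ (v '' (G : Set α)) with hKdef
  have hspan : ∀ {p : E}, p ∈ K → p ∈ W := fun h => PointedCone.hull_le_span ℝ _ h
  obtain ⟨c, hc⟩ := exists_generic_heights v G
  obtain ⟨q₀, hq₀, hq₀n⟩ := hint
  obtain ⟨q₁, hq₁, hq₁c⟩ : ∃ q ∈ W, ∀ σ, IsConeBasis v G σ → ∀ s ∈ σ, coordFn v σ s q ≠ 0 := by
    let ι := {p : Finset α × α // p.1 ∈ G.powerset ∧ p.2 ∈ G ∧ IsConeBasis v G p.1 ∧ p.2 ∈ p.1}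
    have : Finite ι := by
      refine Set.Finite.subset (s := (G.powerset ×ˢ G : Finset (Finset α × α)))
        (Finset.finite_toSet _) ?_
      rintro p ⟨h1, h2, h3⟩
      exact Finset.mem_coe.mpr (Finset.mem_product.mpr ⟨h1, h2⟩)
    obtain ⟨q, hq, hq'⟩ := Module.Dual.exists_forall_mem_ne_zero_of_forall_exists W
      (fun p : ι => coordFn v p.1.1 p.1.2) (fun p => by
        refine ⟨v p.1.2, Submodule.subset_span ⟨_, p.2.2.1, rfl⟩, ?_⟩
        have : v p.1.2 = ∑ t ∈ p.1.1, (if t = p.1.2 then 1 else 0 : ℝ) • v t := by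
          simp [p.2.2.2.2]
        rw [this, coordFn_sum p.2.2.2.1.indep p.2.2.2.2]
        simp)
    exact ⟨q, hq, fun σ hσ s hs => hq' ⟨(σ, s), Finset.mem_powerset.mpr hσ.subset,
      hσ.subset hs, hσ, hs⟩⟩
  -- A small generic perturbation of the interior point q₀ is still interior and has no zero
  -- coordinate in any basis.
  obtain ⟨e, he1, he2⟩ := ((eventually_coordFn v G q₀ hq₁c).and
    ((Filter.eventually_all_finset N).mpr fun k hk =>
      eventually_pos_of_pos (n k q₁) (hq₀n k hk))).exists
  set q := q₀ + e • q₁ with hqdef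
  have hqW : q ∈ W := Submodule.add_mem _ hq₀ (Submodule.smul_mem _ e hq₁)
  have hqn : ∀ k ∈ N, 0 < n k q := fun k hk => by
    rw [hqdef, map_add, map_smul, smul_eq_mul]; exact he2 k hk
  have hqc : ∀ σ, IsConeBasis v G σ → ∀ s ∈ σ, coordFn v σ s q ≠ 0 := fun σ hσ s hs =>
    (he1 σ hσ s hs).2
  let T := G.powerset.filter fun σ => IsConeBasis v G σ ∧ ∀ a ∈ G, costFn v c σ (v a) ≤ c a
  have hT : ∀ σ, σ ∈ T ↔ IsConeBasis v G σ ∧ ∀ a ∈ G, costFn v c σ (v a) ≤ c a := fun σ => by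
    simp only [T, Finset.mem_filter, Finset.mem_powerset]
    exact ⟨fun h => h.2, fun h => ⟨h.1.subset, h⟩⟩
  let J : Finset α → Finset α := fun σ => σ.filter fun s => coordFn v σ s q < 0
  let J' : Finset α → Finset α := fun σ => σ.filter fun s => coordFn v σ s (-q) < 0
  -- A point of the span stays in the cone under a small move by q if it lies in the cone, and under
  -- a small move by -q exactly if it satisfies all inequalities strictly. The directions q and -q
  -- select complementary open facets, as no coordinate of q is zero.
  obtain ⟨hJ1, hJ2⟩ := existsUnique_halfOpenCone deg hdeg hc hqW hqc T hT J (fun σ s => by simp [J])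
  obtain ⟨hJ1', hJ2'⟩ := existsUnique_halfOpenCone deg hdeg hc (Submodule.neg_mem _ hqW)
    (fun σ hσ s hs => by rw [map_neg]; exact neg_ne_zero.mpr (hqc σ hσ s hs)) T hT J'
    (fun σ s => by simp [J'])
  have hTK : ∀ (L : Finset α → Finset α) (p), (∃ σ ∈ T, p ∈ halfOpenCone v σ (L σ)) → p ∈ K := by
    rintro L p ⟨σ, hσ, h⟩
    exact ((hT σ).mp hσ).1.halfOpenCone_subset_hull h
  refine ⟨T, J, J', fun σ hσ => ⟨((hT σ).mp hσ).1, Finset.filter_subset _ _,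
    Finset.filter_subset _ _, fun s hs => ?_⟩, fun p => ⟨fun h => ?_, fun h => hTK J p h⟩,
    fun p => ⟨fun h => ?_, fun h => ?_⟩, hJ2, hJ2'⟩
  · have := hqc σ ((hT σ).mp hσ).1 s hs
    simp only [J, J', Finset.mem_filter, hs, true_and, map_neg, neg_lt_zero, not_lt]
    exact ⟨fun h => h.le, fun h => lt_of_le_of_ne h this.symm⟩
  · refine (hJ1 p (hspan h)).mp ?_
    filter_upwards [self_mem_nhdsWithin] with e he
    have he : 0 < e := he
    refine (hK _ (Submodule.add_mem _ (hspan h) (Submodule.smul_mem _ e hqW))).mpr fun k hk => ?_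
    rw [map_add, map_smul, smul_eq_mul]
    exact add_nonneg ((hK p (hspan h)).mp h k hk) (mul_nonneg he.le (hqn k hk).le)
  · refine (hJ1' p h.1).mp ?_
    filter_upwards [(Filter.eventually_all_finset N).mpr fun k hk =>
      eventually_pos_of_pos (n k (-q)) (h.2 k hk)] with e he
    refine (hK _ (Submodule.add_mem _ h.1 (Submodule.smul_mem _ e
      (Submodule.neg_mem _ hqW)))).mpr fun k hk => ?_
    rw [map_add, map_smul, smul_eq_mul]
    exact (he k hk).le
  · have hp := hspan (hTK J' p h)
    refine ⟨hp, fun k hk => ?_⟩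
    obtain ⟨e, he, he0⟩ := (((hJ1' p hp).mpr h).and self_mem_nhdsWithin).exists
    have he0 : 0 < e := he0
    have := (hK _ (hspan he)).mp he k hk
    rw [map_add, map_smul, smul_eq_mul, map_neg] at this
    have := mul_pos he0 (hqn k hk)
    linarith

end Triangulation

/-! ### Generating functions of lattice points in cones -/

section GeneratingFunctions

variable {ι : Type*} [Fintype ι]

theorem toReal_add (a b : ι → ℤ) : toReal (a + b) = toReal a + toReal b := by
  ext i; simp [toReal]

theorem toReal_sub (a b : ι → ℤ) : toReal (a - b) = toReal a - toReal b := by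
  ext i; simp [toReal]

theorem toReal_zero : toReal (0 : ι → ℤ) = 0 := by
  ext i; simp [toReal]

theorem toReal_sum {α : Type*} (s : Finset α) (f : α → ι → ℤ) :
    toReal (∑ a ∈ s, f a) = ∑ a ∈ s, toReal (f a) := by
  ext i; simp [toReal]

theorem toReal_injective : Function.Injective (toReal : (ι → ℤ) → ι → ℝ) := fun a b h => by
  ext i; simpa [toReal] using congrFun h i

theorem toReal_dotProduct (a b : ι → ℤ) : toReal a ⬝ᵥ toReal b = ((a ⬝ᵥ b : ℤ) : ℝ) := by
  simp [toReal, dotProduct]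

/-- The set `S` of lattice points has nonnegative degrees and finitely many points in each degree. -/
structure IsGraded (w : ι → ℤ) (S : Set (ι → ℤ)) : Prop where
  nonneg : ∀ m ∈ S, 0 ≤ m ⬝ᵥ w
  finite : ∀ k : ℤ, {m ∈ S | m ⬝ᵥ w = k}.Finite

theorem IsGraded.mono {w : ι → ℤ} {S S' : Set (ι → ℤ)} (h : IsGraded w S) (hS : S' ⊆ S) :
    IsGraded w S' :=
  ⟨fun m hm => h.nonneg m (hS hm), fun k => (h.finite k).subset fun _ hm => ⟨hS hm.1, hm.2⟩⟩

theorem dotProduct_sum_smul_eq {w : ι → ℤ} {G : Finset (ι → ℤ)} (hG : ∀ a ∈ G, a ⬝ᵥ w = 1)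
    {m : ι → ℤ} {x : (ι → ℤ) → ℝ} (h : toReal m = ∑ a ∈ G, x a • toReal a) :
    ((m ⬝ᵥ w : ℤ) : ℝ) = ∑ a ∈ G, x a := by
  rw [← toReal_dotProduct, h, sum_dotProduct]
  refine Finset.sum_congr rfl fun a ha => ?_
  rw [smul_dotProduct, toReal_dotProduct, hG a ha]
  simp

/-- The degree of a point is the sum of its coefficients, because all generators have degree one. A
fixed degree therefore bounds the nonnegative coefficients and hence the entries. -/
theorem isGraded_hull {w : ι → ℤ} {G : Finset (ι → ℤ)} (hG : ∀ a ∈ G, a ⬝ᵥ w = 1) :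
    IsGraded w {m | toReal m ∈ PointedCone.hull ℝ (toReal '' (G : Set (ι → ℤ)))} where
  nonneg m hm := by
    obtain ⟨x, hx, h⟩ := mem_hull_image_iff.mp hm
    have := dotProduct_sum_smul_eq hG h
    have h2 := Finset.sum_nonneg hx
    rw [← this] at h2
    exact_mod_cast h2
  finite k := by
    obtain ⟨M, hM⟩ : ∃ M : ℤ, ∀ a ∈ G, ∀ i, |a i| ≤ M := by
      refine ⟨∑ a ∈ G, ∑ i, |a i|, fun a ha i => ?_⟩
      refine (Finset.single_le_sum (f := fun i => |a i|) (fun _ _ => abs_nonneg _)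
        (Finset.mem_univ i)).trans ?_
      exact Finset.single_le_sum (f := fun a : ι → ℤ => ∑ i, |a i|)
        (fun _ _ => Finset.sum_nonneg fun _ _ => abs_nonneg _) ha
    refine (Set.Finite.pi' (t := fun _ : ι => Set.Icc (-(k * M)) (k * M))
      fun _ => Set.finite_Icc _ _).subset ?_
    rintro m ⟨hm, hk⟩ i
    obtain ⟨x, hx, h⟩ := mem_hull_image_iff.mp hm
    have h1 := dotProduct_sum_smul_eq hG h
    rw [hk] at h1
    have h2 : |(m i : ℝ)| ≤ k * M := by
      have : (m i : ℝ) = ∑ a ∈ G, x a * a i := by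
        have := congrFun h i
        simpa [toReal] using this
      rw [this, h1, Finset.sum_mul]
      refine (Finset.abs_sum_le_sum_abs _ _).trans (Finset.sum_le_sum fun a ha => ?_)
      rw [abs_mul, abs_of_nonneg (hx a ha)]
      exact mul_le_mul_of_nonneg_left (by exact_mod_cast hM a ha i) (hx a ha)
    have h3 : |m i| ≤ k * M := by exact_mod_cast h2
    exact Set.mem_Icc.mpr (abs_le.mp h3)

variable {R : Type*} [CommRing R] {w : ι → ℤ} {χ : (ι → ℤ) → R}

/-- The generating function of the set `S` of lattice points, with the weights `χ`. -/
def genFun (w : ι → ℤ) (χ : (ι → ℤ) → R) (S : Set (ι → ℤ)) : PowerSeries R :=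
  PowerSeries.mk fun k => ∑ᶠ m ∈ {m ∈ S | m ⬝ᵥ w = (k : ℤ)}, χ m

theorem genFun_union {S S' : Set (ι → ℤ)} (hS : IsGraded w S) (hS' : IsGraded w S')
    (hd : Disjoint S S') : genFun w χ (S ∪ S') = genFun w χ S + genFun w χ S' := by
  ext k
  simp only [genFun, map_add, PowerSeries.coeff_mk]
  have h : {m ∈ S ∪ S' | m ⬝ᵥ w = (k : ℤ)} =
      {m ∈ S | m ⬝ᵥ w = (k : ℤ)} ∪ {m ∈ S' | m ⬝ᵥ w = (k : ℤ)} := by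
    ext m; simp [or_and_right]
  rw [h, finsum_mem_union (hd.mono (fun _ h => h.1) (fun _ h => h.1)) (hS.finite k) (hS'.finite k)]

theorem genFun_biUnion {α : Type*} (T : Finset α) (S : α → Set (ι → ℤ)) {S' : Set (ι → ℤ)}
    (hS' : IsGraded w S') (h : ∀ m, m ∈ S' ↔ ∃ σ ∈ T, m ∈ S σ)
    (hd : ∀ m, ∀ σ ∈ T, ∀ τ ∈ T, m ∈ S σ → m ∈ S τ → σ = τ) :
    genFun w χ S' = ∑ σ ∈ T, genFun w χ (S σ) := by
  classical
  induction T using Finset.induction_on generalizing S' with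
  | empty =>
    have : S' = ∅ := by ext m; simp [h m]
    ext k
    simp [this, genFun]
  | insert a T ha ih =>
    have h1 : S' = S a ∪ {m | ∃ σ ∈ T, m ∈ S σ} := by
      ext m; simp [h m]
    have hsub : {m | ∃ σ ∈ T, m ∈ S σ} ⊆ S' := by rw [h1]; exact Set.subset_union_right
    have hsub' : S a ⊆ S' := by rw [h1]; exact Set.subset_union_left
    rw [Finset.sum_insert ha, ← ih (hS'.mono hsub) (fun m => Iff.rfl) fun m σ hσ τ hτ =>
      hd m σ (Finset.mem_insert_of_mem hσ) τ (Finset.mem_insert_of_mem hτ), h1,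
      genFun_union (hS'.mono hsub') (hS'.mono hsub)]
    rw [Set.disjoint_left]
    rintro m hm ⟨σ, hσ, hmσ⟩
    have := hd m a (Finset.mem_insert_self _ _) σ (Finset.mem_insert_of_mem hσ) hm hmσ
    exact ha (this ▸ hσ)

theorem genFun_image_add (hχ : ∀ a b, χ (a + b) = χ a * χ b) {S : Set (ι → ℤ)} (hS : IsGraded w S)
    {a : ι → ℤ} (ha : a ⬝ᵥ w = 1) :
    genFun w χ ((a + ·) '' S) = PowerSeries.C (χ a) * PowerSeries.X * genFun w χ S := by
  ext k
  rw [mul_assoc, PowerSeries.coeff_C_mul]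
  cases k with
  | zero =>
    rw [PowerSeries.coeff_zero_X_mul, mul_zero, genFun, PowerSeries.coeff_mk]
    have : {m ∈ (a + ·) '' S | m ⬝ᵥ w = ((0 : ℕ) : ℤ)} = ∅ := by
      ext m
      simp only [Set.mem_ofPred_eq, Set.mem_empty_iff_false, iff_false, not_and]
      rintro ⟨b, hb, rfl⟩
      have := hS.nonneg b hb
      simp only [add_dotProduct, ha]
      push_cast; omega
    rw [this, finsum_mem_empty]
  | succ k =>
    rw [PowerSeries.coeff_succ_X_mul, genFun, genFun, PowerSeries.coeff_mk, PowerSeries.coeff_mk]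
    have : {m ∈ (a + ·) '' S | m ⬝ᵥ w = ((k + 1 : ℕ) : ℤ)} =
        (a + ·) '' {m ∈ S | m ⬝ᵥ w = (k : ℤ)} := by
      ext m
      constructor
      · rintro ⟨⟨b, hb, rfl⟩, h⟩
        refine ⟨b, ⟨hb, ?_⟩, rfl⟩
        simp only [add_dotProduct, ha] at h
        push_cast at h; omega
      · rintro ⟨b, ⟨hb, h⟩, rfl⟩
        refine ⟨⟨b, hb, rfl⟩, ?_⟩
        simp only [add_dotProduct, ha, h]
        push_cast; ring
    rw [this, finsum_mem_image (fun x _ y _ h => add_left_cancel h)]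
    simp_rw [hχ]
    rw [finsum_mem_eq_finite_toFinset_sum _ (hS.finite k),
      finsum_mem_eq_finite_toFinset_sum _ (hS.finite k), Finset.mul_sum]

/-- The lattice points which are combinations of `σ` with coefficients in the sets `U s`. -/
def latticeBox (σ : Finset (ι → ℤ)) (U : (ι → ℤ) → Set ℝ) : Set (ι → ℤ) :=
  {m | ∃ x : (ι → ℤ) → ℝ, (∀ s ∈ σ, x s ∈ U s) ∧ toReal m = ∑ s ∈ σ, x s • toReal s}

theorem isGraded_latticeBox {σ : Finset (ι → ℤ)} (hσ : ∀ s ∈ σ, s ⬝ᵥ w = 1)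
    {U : (ι → ℤ) → Set ℝ} (hU : ∀ s ∈ σ, U s ⊆ Set.Ici 0) : IsGraded w (latticeBox σ U) :=
  (isGraded_hull hσ).mono fun _ ⟨x, hx, h⟩ =>
    mem_hull_image_iff.mpr ⟨x, fun s hs => hU s hs (hx s hs), h⟩

/-- The box is the disjoint union of the box with V in the place of `U a` and of its own translate
by a. Multiplication by 1 - χ a X removes the translate; disjointness uses the uniqueness of
coordinates. -/
theorem genFun_latticeBox_update [DecidableEq (ι → ℤ)] (hχ : ∀ a b, χ (a + b) = χ a * χ b)
    {σ : Finset (ι → ℤ)}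
    (hσ : ∀ s ∈ σ, s ⬝ᵥ w = 1) (hli : LinearIndepOn ℝ toReal (σ : Set (ι → ℤ)))
    {U : (ι → ℤ) → Set ℝ} (hU : ∀ s ∈ σ, U s ⊆ Set.Ici 0) {a : ι → ℤ} (ha : a ∈ σ) {V : Set ℝ}
    (hV : U a = V ∪ (1 + ·) '' U a) (hd : Disjoint V ((1 + ·) '' U a)) :
    (1 - PowerSeries.C (χ a) * PowerSeries.X) * genFun w χ (latticeBox σ U) =
      genFun w χ (latticeBox σ (Function.update U a V)) := by
  have hVU : V ⊆ U a := by rw [hV]; exact Set.subset_union_left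
  have hU' : ∀ s ∈ σ, Function.update U a V s ⊆ Set.Ici 0 := by
    intro s hs
    by_cases h : s = a
    · subst h; rw [Function.update_self]; exact hVU.trans (hU s hs)
    · rw [Function.update_of_ne h]; exact hU s hs
  have hsum : ∀ x : (ι → ℤ) → ℝ, ∑ s ∈ σ, (x s + if s = a then 1 else 0) • toReal s =
      ∑ s ∈ σ, x s • toReal s + toReal a := by
    intro x
    simp only [add_smul, Finset.sum_add_distrib]
    simp [ha]
  have hunion : latticeBox σ U =
      latticeBox σ (Function.update U a V) ∪ (a + ·) '' latticeBox σ U := by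
    ext m
    constructor
    · rintro ⟨x, hx, hm⟩
      have := hx a ha
      rw [hV] at this
      rcases this with h | ⟨y, hy, h⟩
      · refine Or.inl ⟨x, fun s hs => ?_, hm⟩
        by_cases hs' : s = a
        · subst hs'; rwa [Function.update_self]
        · rw [Function.update_of_ne hs']; exact hx s hs
      · refine Or.inr ⟨m - a, ⟨Function.update x a y, fun s hs => ?_, ?_⟩, by simp⟩
        · by_cases hs' : s = a
          · subst hs'; rwa [Function.update_self]
          · rw [Function.update_of_ne hs']; exact hx s hs
        · rw [toReal_sub, hm, sub_eq_iff_eq_add, ← hsum]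
          refine Finset.sum_congr rfl fun s hs => ?_
          by_cases hs' : s = a
          · subst hs'; rw [Function.update_self, if_pos rfl, ← h, add_comm]
          · rw [Function.update_of_ne hs', if_neg hs', add_zero]
    · rintro (⟨x, hx, hm⟩ | ⟨_, ⟨x, hx, hm⟩, rfl⟩)
      · refine ⟨x, fun s hs => ?_, hm⟩
        have := hx s hs
        by_cases hs' : s = a
        · subst hs'; rw [Function.update_self] at this; exact hVU this
        · rwa [Function.update_of_ne hs'] at this
      · refine ⟨fun s => x s + if s = a then 1 else 0, fun s hs => ?_, ?_⟩
        · by_cases hs' : s = a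
          · subst hs'
            simp only [if_true]
            rw [hV]
            exact Or.inr ⟨x s, hx s hs, add_comm _ _⟩
          · simpa [hs'] using hx s hs
        · rw [hsum, ← hm, toReal_add, add_comm]
  have hG := isGraded_latticeBox hσ hU
  have hG' := isGraded_latticeBox hσ hU'
  have hdisj : Disjoint (latticeBox σ (Function.update U a V)) ((a + ·) '' latticeBox σ U) := by
    rw [Set.disjoint_left]
    rintro _ ⟨x, hx, hm⟩ ⟨m, ⟨y, hy, hm'⟩, rfl⟩
    simp only [toReal_add] at hm
    rw [hm', add_comm, ← hsum] at hm
    have h1 := congrArg (coordFn toReal σ a) hm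
    rw [coordFn_sum hli ha, coordFn_sum hli ha, if_pos rfl] at h1
    have h2 := hx a ha
    rw [Function.update_self, ← h1] at h2
    exact Set.disjoint_left.mp hd h2 ⟨y a, hy a ha, add_comm _ _⟩
  have h := genFun_union (χ := χ) hG' (hG.mono (by conv_rhs => rw [hunion]
                                                   exact Set.subset_union_right)) hdisj
  rw [← hunion, genFun_image_add hχ hG (hσ a ha)] at h
  linear_combination h

theorem prod_mul_genFun_latticeBox (hχ : ∀ a b, χ (a + b) = χ a * χ b) {σ : Finset (ι → ℤ)}
    (hσ : ∀ s ∈ σ, s ⬝ᵥ w = 1) (hli : LinearIndepOn ℝ toReal (σ : Set (ι → ℤ)))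
    {U V : (ι → ℤ) → Set ℝ} (hU : ∀ s ∈ σ, U s ⊆ Set.Ici 0)
    (hV : ∀ s ∈ σ, U s = V s ∪ (1 + ·) '' U s) (hd : ∀ s ∈ σ, Disjoint (V s) ((1 + ·) '' U s)) :
    (∏ s ∈ σ, (1 - PowerSeries.C (χ s) * PowerSeries.X)) * genFun w χ (latticeBox σ U) =
      genFun w χ (latticeBox σ V) := by
  classical
  have key : ∀ B ⊆ σ, (∏ s ∈ B, (1 - PowerSeries.C (χ s) * PowerSeries.X)) *
      genFun w χ (latticeBox σ U) =
        genFun w χ (latticeBox σ fun s => if s ∈ B then V s else U s) := by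
    intro B
    induction B using Finset.induction_on with
    | empty => intro _; simp
    | insert a B ha ih =>
      intro hB
      have haσ := hB (Finset.mem_insert_self _ _)
      have hBσ : B ⊆ σ := (Finset.subset_insert _ _).trans hB
      have hVU : ∀ s ∈ σ, V s ⊆ Set.Ici 0 := fun s hs =>
        (by rw [hV s hs]; exact Set.subset_union_left : V s ⊆ U s).trans (hU s hs)
      rw [Finset.prod_insert ha, mul_assoc, ih hBσ]
      rw [genFun_latticeBox_update hχ hσ hli (V := V a) (fun s hs => ?_) haσ]
      · congr 2
        ext s : 1
        by_cases hs : s = a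
        · subst hs; simp
        · simp [hs]
      · simp only [if_neg ha]; exact hV a haσ
      · simp only [if_neg ha]; exact hd a haσ
      · split_ifs
        · exact hVU s hs
        · exact hU s hs
  rw [key σ subset_rfl]
  congr 1
  ext m
  constructor <;> rintro ⟨x, hx, hm⟩ <;> refine ⟨x, fun s hs => ?_, hm⟩
  · simpa [hs] using hx s hs
  · simpa [hs] using hx s hs

/-- The generating function of a finite set of lattice points as a polynomial. -/
def genPoly (w : ι → ℤ) (χ : (ι → ℤ) → R) (S : Set (ι → ℤ)) : Polynomial R :=
  ∑ᶠ m ∈ S, Polynomial.monomial (m ⬝ᵥ w).toNat (χ m)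

theorem coe_genPoly {S : Set (ι → ℤ)} (hS : IsGraded w S) (hfin : S.Finite) :
    (genPoly w χ S : PowerSeries R) = genFun w χ S := by
  classical
  ext k
  rw [Polynomial.coeff_coe, genPoly, finsum_mem_eq_finite_toFinset_sum _ hfin,
    Polynomial.finsetSum_coeff, genFun, PowerSeries.coeff_mk,
    finsum_mem_eq_finite_toFinset_sum _ (hS.finite k)]
  simp only [Polynomial.coeff_monomial]
  rw [← Finset.sum_filter]
  refine Finset.sum_congr ?_ fun _ _ => rfl
  ext m
  simp only [Finset.mem_filter, Set.Finite.mem_toFinset, Set.mem_ofPred_eq]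
  refine and_congr_right fun hm => ?_
  have := hS.nonneg m hm
  omega

theorem finite_latticeBox {σ : Finset (ι → ℤ)} (hσ : ∀ s ∈ σ, s ⬝ᵥ w = 1)
    {U : (ι → ℤ) → Set ℝ} (hU : ∀ s ∈ σ, U s ⊆ Set.Icc 0 1) : (latticeBox σ U).Finite := by
  have hG := isGraded_latticeBox hσ fun s hs => (hU s hs).trans fun _ h => h.1
  refine ((Finset.range (σ.card + 1)).finite_toSet.biUnion fun k _ => hG.finite (k : ℤ)).subset ?_
  rintro m ⟨x, hx, hm⟩
  have h0 := hG.nonneg m ⟨x, hx, hm⟩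
  have h1 := dotProduct_sum_smul_eq hσ hm
  have h2 : ((m ⬝ᵥ w : ℤ) : ℝ) ≤ σ.card := by
    rw [h1]
    refine (Finset.sum_le_sum fun s hs => (hU s hs (hx s hs)).2).trans (by simp)
  have h3 : m ⬝ᵥ w ≤ σ.card := by exact_mod_cast h2
  simp only [Set.mem_iUnion]
  refine ⟨(m ⬝ᵥ w).toNat, ?_, ⟨x, hx, hm⟩, ?_⟩
  · simp only [Finset.coe_range, Set.mem_Iio]; omega
  · omega

theorem dotProduct_le_card_of_mem_latticeBox {σ : Finset (ι → ℤ)} (hσ : ∀ s ∈ σ, s ⬝ᵥ w = 1)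
    {U : (ι → ℤ) → Set ℝ} (hU : ∀ s ∈ σ, U s ⊆ Set.Icc 0 1) {m : ι → ℤ} (hm : m ∈ latticeBox σ U) :
    0 ≤ m ⬝ᵥ w ∧ m ⬝ᵥ w ≤ σ.card := by
  obtain ⟨x, hx, hm⟩ := hm
  have h1 := dotProduct_sum_smul_eq hσ hm
  constructor
  · have := Finset.sum_nonneg fun s hs => (hU s hs (hx s hs)).1
    rw [← h1] at this; exact_mod_cast this
  · have h2 : ((m ⬝ᵥ w : ℤ) : ℝ) ≤ σ.card := by
      rw [h1]
      refine (Finset.sum_le_sum fun s hs => (hU s hs (hx s hs)).2).trans (by simp)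
    exact_mod_cast h2

open Classical in
/-- The lattice points in the half-open parallelepiped of `σ`, without the facets through the origin
opposite to the elements of `J`. -/
def parallelepiped (σ J : Finset (ι → ℤ)) : Set (ι → ℤ) :=
  latticeBox σ fun s => if s ∈ J then Set.Ioc 0 1 else Set.Ico 0 1

/-- The ray (0, ∞) is (0, 1] together with its translate by 1, and [0, ∞) is [0, 1) together with
its translate. So each generator contributes one factor, and the parallelepiped remains. -/
theorem prod_mul_genFun_halfOpenCone (hχ : ∀ a b, χ (a + b) = χ a * χ b) {σ J : Finset (ι → ℤ)}
    (hσ : ∀ s ∈ σ, s ⬝ᵥ w = 1) (hli : LinearIndepOn ℝ toReal (σ : Set (ι → ℤ))) (hJ : J ⊆ σ) :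
    (∏ s ∈ σ, (1 - PowerSeries.C (χ s) * PowerSeries.X)) *
        genFun w χ {m | toReal m ∈ halfOpenCone toReal σ J} =
      (genPoly w χ (parallelepiped σ J) : PowerSeries R) := by
  classical
  have h1 : {m : ι → ℤ | toReal m ∈ halfOpenCone toReal σ J} =
      latticeBox σ fun s => if s ∈ J then Set.Ioi 0 else Set.Ici 0 := by
    ext m
    constructor
    · rintro ⟨x, hx, hxJ, hm⟩
      refine ⟨x, fun s hs => ?_, hm⟩
      dsimp only
      split_ifs with h
      · exact hxJ s h
      · exact hx s hs
    · rintro ⟨x, hx, hm⟩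
      refine ⟨x, fun s hs => ?_, fun s hs => ?_, hm⟩
      · have := hx s hs
        dsimp only at this
        split_ifs at this with h
        · exact le_of_lt this
        · exact this
      · have := hx s (hJ hs)
        dsimp only at this
        rwa [if_pos hs] at this
  have hIcc : ∀ s ∈ σ, (if s ∈ J then Set.Ioc (0 : ℝ) 1 else Set.Ico 0 1) ⊆ Set.Icc 0 1 := by
    intro s _
    split_ifs
    · exact Set.Ioc_subset_Icc_self
    · exact Set.Ico_subset_Icc_self
  rw [h1, parallelepiped, coe_genPoly (isGraded_latticeBox hσ fun s hs =>
    (hIcc s hs).trans fun _ h => h.1) (finite_latticeBox hσ hIcc)]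
  refine prod_mul_genFun_latticeBox hχ hσ hli ?_ ?_ ?_
  · intro s _
    split_ifs
    · exact Set.Ioi_subset_Ici_self
    · exact subset_rfl
  · intro s _
    split_ifs
    · rw [Set.image_const_add_Ioi, add_zero, Set.Ioc_union_Ioi_eq_Ioi zero_le_one]
    · rw [Set.image_const_add_Ici, add_zero, Set.Ico_union_Ici_eq_Ici zero_le_one]
  · intro s _
    split_ifs
    · rw [Set.image_const_add_Ioi, add_zero, Set.disjoint_left]
      rintro x hx hx'
      exact absurd hx.2 (not_le.mpr hx')
    · rw [Set.image_const_add_Ici, add_zero, Set.disjoint_left]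
      rintro x hx hx'
      exact absurd hx.2 (not_lt.mpr hx')

end GeneratingFunctions

/-! ### Reciprocity for the lattice points of a cone and of its interior -/

section Reciprocity

open Polynomial

variable {ι : Type*} [Fintype ι] {R : Type*} [CommRing R] {w : ι → ℤ} {χ : (ι → ℤ) → R}

theorem finite_parallelepiped {σ : Finset (ι → ℤ)} (hσ : ∀ s ∈ σ, s ⬝ᵥ w = 1) (J : Finset (ι → ℤ)) :
    (parallelepiped σ J).Finite := by
  refine finite_latticeBox hσ fun s _ => ?_
  split_ifs
  · exact Set.Ioc_subset_Icc_self
  · exact Set.Ico_subset_Icc_self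

theorem degree_parallelepiped {σ : Finset (ι → ℤ)} (hσ : ∀ s ∈ σ, s ⬝ᵥ w = 1) {J : Finset (ι → ℤ)}
    {m : ι → ℤ} (hm : m ∈ parallelepiped σ J) : 0 ≤ m ⬝ᵥ w ∧ m ⬝ᵥ w ≤ σ.card := by
  refine dotProduct_le_card_of_mem_latticeBox hσ (fun s _ => ?_) hm
  split_ifs
  · exact Set.Ioc_subset_Icc_self
  · exact Set.Ico_subset_Icc_self

theorem natDegree_genPoly_parallelepiped {σ : Finset (ι → ℤ)} (hσ : ∀ s ∈ σ, s ⬝ᵥ w = 1)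
    (J : Finset (ι → ℤ)) : (genPoly w χ (parallelepiped σ J)).natDegree ≤ σ.card := by
  rw [genPoly, finsum_mem_eq_finite_toFinset_sum _ (finite_parallelepiped hσ J)]
  refine natDegree_sum_le_of_forall_le _ _ fun m hm => (natDegree_monomial_le _).trans ?_
  have := degree_parallelepiped hσ ((Set.Finite.mem_toFinset _).mp hm)
  omega

/-- The coordinates change from x to 1 - x, which exchanges (0, 1] and [0, 1). -/
theorem sub_mem_parallelepiped {σ J J' : Finset (ι → ℤ)} (hJJ' : ∀ s ∈ σ, s ∈ J' ↔ s ∉ J)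
    {m : ι → ℤ} (hm : m ∈ parallelepiped σ J) : ∑ s ∈ σ, s - m ∈ parallelepiped σ J' := by
  obtain ⟨x, hx, hm⟩ := hm
  refine ⟨fun s => 1 - x s, fun s hs => ?_, ?_⟩
  · have h1 := hx s hs
    have h2 := hJJ' s hs
    dsimp only at h1 ⊢
    by_cases h : s ∈ J
    · rw [if_pos h] at h1
      rw [if_neg (fun h' => h2.mp h' h)]
      exact ⟨by linarith [h1.2], by linarith [h1.1]⟩
    · rw [if_neg h] at h1
      rw [if_pos (h2.mpr h)]
      exact ⟨by linarith [h1.2], by linarith [h1.1]⟩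
  · rw [toReal_sub, toReal_sum, hm]
    simp only [sub_smul, one_smul, Finset.sum_sub_distrib]

theorem reflect_genPoly_parallelepiped (hχ : ∀ a b, χ (a + b) = χ a * χ b) (inv : R →+* R)
    (hinv : ∀ a, inv (χ a) = χ (-a)) {σ J J' : Finset (ι → ℤ)} (hσ : ∀ s ∈ σ, s ⬝ᵥ w = 1)
    (hJJ' : ∀ s ∈ σ, s ∈ J' ↔ s ∉ J) :
    C (χ (∑ s ∈ σ, s)) * reflect σ.card ((genPoly w χ (parallelepiped σ J)).map inv) =
      genPoly w χ (parallelepiped σ J') := by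
  have hJ'J : ∀ s ∈ σ, s ∈ J ↔ s ∉ J' := fun s hs => by rw [hJJ' s hs, not_not]
  rw [genPoly, genPoly, finsum_mem_eq_finite_toFinset_sum _ (finite_parallelepiped hσ J),
    finsum_mem_eq_finite_toFinset_sum _ (finite_parallelepiped hσ J'), Polynomial.map_sum,
    reflect_sum, Finset.mul_sum]
  have hdeg : (∑ s ∈ σ, s) ⬝ᵥ w = σ.card := by
    rw [sum_dotProduct, Finset.sum_congr rfl hσ]; simp
  refine Finset.sum_bij' (fun m _ => ∑ s ∈ σ, s - m) (fun m _ => ∑ s ∈ σ, s - m) ?_ ?_ ?_ ?_ ?_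
  · intro m hm
    rw [Set.Finite.mem_toFinset] at hm ⊢
    exact sub_mem_parallelepiped hJJ' hm
  · intro m hm
    rw [Set.Finite.mem_toFinset] at hm ⊢
    exact sub_mem_parallelepiped hJ'J hm
  · intro m _; abel
  · intro m _; abel
  · intro m hm
    rw [Set.Finite.mem_toFinset] at hm
    have h1 := degree_parallelepiped hσ hm
    rw [map_monomial, hinv, ← C_mul_X_pow_eq_monomial, reflect_C_mul_X_pow, revAt_le (by omega),
      ← mul_assoc, ← C_mul, ← hχ, ← C_mul_X_pow_eq_monomial, sub_dotProduct, hdeg, sub_eq_add_neg]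
    congr 2
    omega

/-- The sets of lattice points `S` and `S'` have decompositions into half-open simplicial cones of
dimension `n` with generators in `A` and with complementary sets of open facets. -/
def HasConeDecomposition (A : Finset (ι → ℤ)) (n : ℕ) (S S' : Set (ι → ℤ)) : Prop :=
  ∃ (T : Finset (Finset (ι → ℤ))) (J J' : Finset (ι → ℤ) → Finset (ι → ℤ)),
    (∀ σ ∈ T, σ ⊆ A ∧ LinearIndepOn ℝ toReal (σ : Set (ι → ℤ)) ∧ σ.card = n ∧
      J σ ⊆ σ ∧ J' σ ⊆ σ ∧ ∀ s ∈ σ, s ∈ J' σ ↔ s ∉ J σ) ∧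
    (∀ m, m ∈ S ↔ ∃ σ ∈ T, toReal m ∈ halfOpenCone toReal σ (J σ)) ∧
    (∀ m, m ∈ S' ↔ ∃ σ ∈ T, toReal m ∈ halfOpenCone toReal σ (J' σ)) ∧
    (∀ p, ∀ σ ∈ T, ∀ τ ∈ T, p ∈ halfOpenCone toReal σ (J σ) → p ∈ halfOpenCone toReal τ (J τ) →
      σ = τ) ∧
    ∀ p, ∀ σ ∈ T, ∀ τ ∈ T, p ∈ halfOpenCone toReal σ (J' σ) → p ∈ halfOpenCone toReal τ (J' τ) →
      σ = τ

theorem isGraded_of_decomposition {A : Finset (ι → ℤ)} (hA : ∀ a ∈ A, a ⬝ᵥ w = 1)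
    {T : Finset (Finset (ι → ℤ))} {J : Finset (ι → ℤ) → Finset (ι → ℤ)} {S : Set (ι → ℤ)}
    (hT : ∀ σ ∈ T, σ ⊆ A) (hS : ∀ m, m ∈ S ↔ ∃ σ ∈ T, toReal m ∈ halfOpenCone toReal σ (J σ)) :
    IsGraded w S := by
  refine (isGraded_hull hA).mono fun m hm => ?_
  obtain ⟨σ, hσ, x, hx, -, h⟩ := (hS m).mp hm
  exact Submodule.span_mono (Set.image_mono (Finset.coe_subset.mpr (hT σ hσ)))
    (mem_hull_image_iff.mpr ⟨x, hx, h⟩)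

theorem HasConeDecomposition.symm {A : Finset (ι → ℤ)} {n : ℕ} {S S' : Set (ι → ℤ)}
    (h : HasConeDecomposition A n S S') : HasConeDecomposition A n S' S := by
  obtain ⟨T, J, J', h1, h2, h3, h4, h5⟩ := h
  refine ⟨T, J', J, fun σ hσ => ?_, h3, h2, h5, h4⟩
  obtain ⟨a, b, c, d, e, f⟩ := h1 σ hσ
  exact ⟨a, b, c, e, d, fun s hs => by rw [f s hs, not_not]⟩

theorem HasConeDecomposition.isGraded {A : Finset (ι → ℤ)} (hA : ∀ a ∈ A, a ⬝ᵥ w = 1) {n : ℕ}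
    {S S' : Set (ι → ℤ)} (h : HasConeDecomposition A n S S') : IsGraded w S := by
  obtain ⟨T, J, J', h1, h2, -⟩ := h
  exact isGraded_of_decomposition hA (fun σ hσ => (h1 σ hσ).1) h2

/-- Ehrhart reciprocity. -/
theorem HasConeDecomposition.exists_sPoly {A : Finset (ι → ℤ)} (hA : ∀ a ∈ A, a ⬝ᵥ w = 1) {n : ℕ}
    {S S' : Set (ι → ℤ)} (h : HasConeDecomposition A n S S') :
    ∃ P : ℤ[X], P.natDegree ≤ n ∧
      (P : PowerSeries ℤ) = (1 - PowerSeries.X) ^ n * genFun w (fun _ => (1 : ℤ)) S ∧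
      (reflect n P : PowerSeries ℤ) = (1 - PowerSeries.X) ^ n * genFun w (fun _ => (1 : ℤ)) S' := by
  have hG := h.isGraded hA
  have hG' := h.symm.isGraded hA
  obtain ⟨T, J, J', h1, h2, h3, h4, h5⟩ := h
  have key : ∀ (J : Finset (ι → ℤ) → Finset (ι → ℤ)) (S : Set (ι → ℤ)), IsGraded w S →
      (∀ σ ∈ T, J σ ⊆ σ) → (∀ m, m ∈ S ↔ ∃ σ ∈ T, toReal m ∈ halfOpenCone toReal σ (J σ)) →
      (∀ p, ∀ σ ∈ T, ∀ τ ∈ T, p ∈ halfOpenCone toReal σ (J σ) →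
        p ∈ halfOpenCone toReal τ (J τ) → σ = τ) →
      ((∑ σ ∈ T, genPoly w (fun _ => (1 : ℤ)) (parallelepiped σ (J σ)) : ℤ[X]) : PowerSeries ℤ) =
        (1 - PowerSeries.X) ^ n * genFun w (fun _ => (1 : ℤ)) S := by
    intro J S hG hJ hS hd
    rw [genFun_biUnion (χ := fun _ => (1 : ℤ)) T (fun σ => {m | toReal m ∈ halfOpenCone toReal σ (J σ)}) hG hS
      (fun m => hd (toReal m)), Finset.mul_sum, ← Polynomial.coeToPowerSeries.ringHom_apply, map_sum]
    refine Finset.sum_congr rfl fun σ hσ => ?_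
    rw [Polynomial.coeToPowerSeries.ringHom_apply, ← prod_mul_genFun_halfOpenCone (by simp)
      (fun s hs => hA s ((h1 σ hσ).1 hs)) (h1 σ hσ).2.1 (hJ σ hσ)]
    simp [(h1 σ hσ).2.2.1]
  -- Every σ has n elements of degree one, so (1 - X)^n is a common denominator. The numerator is
  -- the sum of the parallelepiped polynomials, and reflection exchanges those of J and J'.
  refine ⟨∑ σ ∈ T, genPoly w (fun _ => (1 : ℤ)) (parallelepiped σ (J σ)), ?_, ?_, ?_⟩
  · refine natDegree_sum_le_of_forall_le _ _ fun σ hσ => ?_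
    rw [← (h1 σ hσ).2.2.1]
    exact natDegree_genPoly_parallelepiped (fun s hs => hA s ((h1 σ hσ).1 hs)) _
  · exact key J S hG (fun σ hσ => (h1 σ hσ).2.2.2.1) h2 h4
  · rw [← key J' S' hG' (fun σ hσ => (h1 σ hσ).2.2.2.2.1) h3 h5, reflect_sum]
    congr 1
    refine Finset.sum_congr rfl fun σ hσ => ?_
    have := reflect_genPoly_parallelepiped (χ := fun _ => (1 : ℤ)) (by simp) (RingHom.id ℤ) (by simp)
      (fun s hs => hA s ((h1 σ hσ).1 hs)) (h1 σ hσ).2.2.2.2.2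
    rw [← this, (h1 σ hσ).2.2.1]
    simp

theorem natDegree_prod_one_sub_le (B : Finset (ι → ℤ)) (f : (ι → ℤ) → R) :
    (∏ a ∈ B, (1 - C (f a) * X)).natDegree ≤ B.card := by
  refine (natDegree_prod_le _ _).trans ((Finset.sum_le_sum (g := fun _ => 1) fun a _ => ?_).trans
    (by simp))
  refine (natDegree_sub_le _ _).trans (max_le (by simp) ?_)
  exact natDegree_C_mul_le _ _ |>.trans natDegree_X_le

/-- Factor by factor: χ(a) (X - χ(-a)) = -(1 - χ(a) X). -/
theorem reflect_prod_one_sub (hχ : ∀ a b, χ (a + b) = χ a * χ b) (h0 : χ 0 = 1)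
    (B : Finset (ι → ℤ)) :
    C (χ (∑ a ∈ B, a)) * reflect B.card (∏ a ∈ B, (1 - C (χ (-a)) * X)) =
      (-1) ^ B.card * ∏ a ∈ B, (1 - C (χ a) * X) := by
  classical
  induction B using Finset.induction_on with
  | empty => simp [h0]
  | insert a B ha ih =>
    rw [Finset.sum_insert ha, Finset.prod_insert ha, Finset.prod_insert ha,
      Finset.card_insert_of_notMem ha, hχ, C_mul, add_comm B.card 1, reflect_mul _ _
      (by simpa using natDegree_prod_one_sub_le {a} fun a => χ (-a)) (natDegree_prod_one_sub_le B _)]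
    have h1 : reflect 1 (1 - C (χ (-a)) * X) = X - C (χ (-a)) := by
      rw [sub_eq_add_neg, reflect_add, reflect_neg, reflect_one, reflect_C_mul, reflect_one_X,
        pow_one, mul_one, ← sub_eq_add_neg]
    have h2 : (C (χ a) * C (χ (-a)) : R[X]) = 1 := by
      rw [← C_mul, ← hχ, add_neg_cancel, h0, C_1]
    rw [h1, pow_add]
    linear_combination (C (χ a) * (X - C (χ (-a)))) * ih -
      ((-1) ^ B.card * ∏ a ∈ B, (1 - C (χ a) * X)) * h2

/-- The involution of the numerators of generating functions with denominator
`∏ a ∈ A, (1 - χ a * X)` which corresponds to the inversion of all variables. -/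
def numInvolution (χ : (ι → ℤ) → R) (inv : R →+* R) (A : Finset (ι → ℤ)) (N : R[X]) : R[X] :=
  (-1) ^ A.card * (C (χ (∑ a ∈ A, a)) * reflect A.card (N.map inv))

theorem numInvolution_sum (inv : R →+* R) (A : Finset (ι → ℤ)) {α : Type*} (T : Finset α)
    (N : α → R[X]) : numInvolution χ inv A (∑ σ ∈ T, N σ) =
      ∑ σ ∈ T, numInvolution χ inv A (N σ) := by
  simp only [numInvolution, Polynomial.map_sum, reflect_sum, Finset.mul_sum]

/-- The factors outside σ return with the sign (-1)^|A \ σ|, the parallelepiped of J becomes that of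
J', and the sign (-1)^|A| of the involution leaves (-1)^|σ|. -/
theorem numInvolution_parallelepiped [DecidableEq (ι → ℤ)] (hχ : ∀ a b, χ (a + b) = χ a * χ b) (h0 : χ 0 = 1)
    (inv : R →+* R) (hinv : ∀ a, inv (χ a) = χ (-a)) {A σ J J' : Finset (ι → ℤ)}
    (hA : ∀ a ∈ A, a ⬝ᵥ w = 1) (hσA : σ ⊆ A) (hJJ' : ∀ s ∈ σ, s ∈ J' ↔ s ∉ J) :
    numInvolution χ inv A ((∏ a ∈ A \ σ, (1 - C (χ a) * X)) * genPoly w χ (parallelepiped σ J)) =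
      (-1) ^ σ.card * ((∏ a ∈ A \ σ, (1 - C (χ a) * X)) * genPoly w χ (parallelepiped σ J')) := by
  have hσ : ∀ s ∈ σ, s ⬝ᵥ w = 1 := fun s hs => hA s (hσA hs)
  have hcard : A.card = (A \ σ).card + σ.card := by
    rw [Finset.card_sdiff_add_card_eq_card hσA]
  have hsum : ∑ a ∈ A, a = ∑ a ∈ A \ σ, a + ∑ a ∈ σ, a := by
    rw [Finset.sum_sdiff hσA]
  rw [numInvolution, Polynomial.map_mul, Polynomial.map_prod]
  have hmap : ∀ a, Polynomial.map inv (1 - C (χ a) * X) = 1 - C (χ (-a)) * X := by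
    intro a; simp [hinv]
  simp_rw [hmap]
  rw [hsum, hcard, reflect_mul _ _ (natDegree_prod_one_sub_le _ _)
    (natDegree_map_le.trans (natDegree_genPoly_parallelepiped hσ J)), hχ, C_mul]
  have h1 := reflect_prod_one_sub hχ h0 (A \ σ)
  have h2 := reflect_genPoly_parallelepiped hχ inv hinv hσ hJJ'
  have h3 : ((-1 : R[X]) ^ (A \ σ).card) * (-1) ^ (A \ σ).card = 1 := by
    rw [← mul_pow]; simp
  rw [pow_add, ← h2]
  linear_combination ((-1) ^ (A \ σ).card * (-1) ^ σ.card * C (χ (∑ a ∈ σ, a)) *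
    reflect σ.card ((genPoly w χ (parallelepiped σ J)).map inv)) * h1 + ((-1) ^ σ.card *
    (C (χ (∑ a ∈ σ, a)) * reflect σ.card ((genPoly w χ (parallelepiped σ J)).map inv)) *
    ∏ a ∈ A \ σ, (1 - C (χ a) * X)) * h3

/-- Stanley reciprocity. Inverting the variables makes no sense for power series, so all generating
functions are put over the common denominator of A and the inversion acts on numerators. -/
theorem HasConeDecomposition.exists_numerators (hχ : ∀ a b, χ (a + b) = χ a * χ b) (h0 : χ 0 = 1)
    (inv : R →+* R) (hinv : ∀ a, inv (χ a) = χ (-a)) {A : Finset (ι → ℤ)}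
    (hA : ∀ a ∈ A, a ⬝ᵥ w = 1) {n : ℕ}
    {S S' : Set (ι → ℤ)} (h : HasConeDecomposition A n S S') :
    ∃ N N' : R[X],
      (N : PowerSeries R) = (∏ a ∈ A, (1 - PowerSeries.C (χ a) * PowerSeries.X)) * genFun w χ S ∧
      (N' : PowerSeries R) = (∏ a ∈ A, (1 - PowerSeries.C (χ a) * PowerSeries.X)) * genFun w χ S' ∧
      numInvolution χ inv A N = (-1) ^ n * N' ∧ numInvolution χ inv A N' = (-1) ^ n * N := by
  classical
  have hG := h.isGraded hA
  have hG' := h.symm.isGraded hA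
  obtain ⟨T, J, J', h1, h2, h3, h4, h5⟩ := h
  let num : (Finset (ι → ℤ) → Finset (ι → ℤ)) → R[X] := fun J => ∑ σ ∈ T,
    (∏ a ∈ A \ σ, (1 - C (χ a) * X)) * genPoly w χ (parallelepiped σ (J σ))
  have key : ∀ (J : Finset (ι → ℤ) → Finset (ι → ℤ)) (S : Set (ι → ℤ)), IsGraded w S →
      (∀ σ ∈ T, J σ ⊆ σ) → (∀ m, m ∈ S ↔ ∃ σ ∈ T, toReal m ∈ halfOpenCone toReal σ (J σ)) →
      (∀ p, ∀ σ ∈ T, ∀ τ ∈ T, p ∈ halfOpenCone toReal σ (J σ) →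
        p ∈ halfOpenCone toReal τ (J τ) → σ = τ) →
      (num J : PowerSeries R) =
        (∏ a ∈ A, (1 - PowerSeries.C (χ a) * PowerSeries.X)) * genFun w χ S := by
    intro J S hG hJ hS hd
    rw [genFun_biUnion (χ := χ) T (fun σ => {m | toReal m ∈ halfOpenCone toReal σ (J σ)}) hG hS
      (fun m => hd (toReal m)), Finset.mul_sum, ← Polynomial.coeToPowerSeries.ringHom_apply, map_sum]
    refine Finset.sum_congr rfl fun σ hσ => ?_
    rw [map_mul, Polynomial.coeToPowerSeries.ringHom_apply (φ := genPoly _ _ _),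
      ← prod_mul_genFun_halfOpenCone hχ
      (fun s hs => hA s ((h1 σ hσ).1 hs)) (h1 σ hσ).2.1 (hJ σ hσ), ← mul_assoc,
      ← Finset.prod_sdiff (h1 σ hσ).1, map_prod]
    simp [Polynomial.coeToPowerSeries.ringHom_apply]
  refine ⟨num J, num J', key J S hG (fun σ hσ => (h1 σ hσ).2.2.2.1) h2 h4,
    key J' S' hG' (fun σ hσ => (h1 σ hσ).2.2.2.2.1) h3 h5, ?_, ?_⟩
  · simp only [num]
    rw [numInvolution_sum, Finset.mul_sum]
    refine Finset.sum_congr rfl fun σ hσ => ?_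
    rw [numInvolution_parallelepiped hχ h0 inv hinv hA (h1 σ hσ).1 (h1 σ hσ).2.2.2.2.2,
      (h1 σ hσ).2.2.1]
  · simp only [num]
    rw [numInvolution_sum, Finset.mul_sum]
    refine Finset.sum_congr rfl fun σ hσ => ?_
    rw [numInvolution_parallelepiped hχ h0 inv hinv hA (h1 σ hσ).1 (J' := J σ) (fun s hs => by
      rw [(h1 σ hσ).2.2.2.2.2 s hs, not_not]), (h1 σ hσ).2.2.1]

open Classical in
/-- The Euler relation at a lattice point `m`, for a cone `K` which is the disjoint union of the
relative interiors of its faces. -/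
theorem sum_neg_one_pow_faces {α : Type*} (F : Finset α) (K : α)
    {A : Finset (ι → ℤ)} (hA : ∀ a ∈ A, a ⬝ᵥ w = 1) (n : α → ℕ) (S S' : α → Set (ι → ℤ))
    (h : ∀ f ∈ F, HasConeDecomposition A (n f) (S f) (S' f)) (hK : K ∈ F)
    (hcover : ∀ m, m ∈ S K ↔ ∃ f ∈ F, m ∈ S' f)
    (hdisj : ∀ m, ∀ f ∈ F, ∀ g ∈ F, m ∈ S' f → m ∈ S' g → f = g) (m : ι → ℤ) (hm : 0 ≤ m ⬝ᵥ w) :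
    (-1 : ℤ) ^ n K * (if m ∈ S' K then 1 else 0) =
      ∑ f ∈ F, (-1) ^ n f * if m ∈ S f then 1 else 0 := by
  -- Weights in the group algebra remember the lattice points, so that an identity of generating
  -- functions can be read at the single point m.
  let χ : (ι → ℤ) → AddMonoidAlgebra ℤ (ι → ℤ) := fun a => AddMonoidAlgebra.single a 1
  have hχ : ∀ a b, χ (a + b) = χ a * χ b := fun a b => by
    simp [χ, AddMonoidAlgebra.single_mul_single]
  have h0 : χ 0 = 1 := rfl
  let inv : AddMonoidAlgebra ℤ (ι → ℤ) →+* AddMonoidAlgebra ℤ (ι → ℤ) :=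
    AddMonoidAlgebra.mapDomainRingHom ℤ (negAddMonoidHom : (ι → ℤ) →+ (ι → ℤ))
  have hinv : ∀ a, inv (χ a) = χ (-a) := fun a => by simp [inv, χ]
  have hnum := fun f hf => (h f hf).exists_numerators hχ h0 inv hinv hA
  choose! N N' hN hN' hNN' hN'N using hnum
  have hgf := genFun_biUnion (χ := χ) F S' ((h K hK).isGraded hA) hcover hdisj
  set Θ : PowerSeries (AddMonoidAlgebra ℤ (ι → ℤ)) :=
    ∏ a ∈ A, (1 - PowerSeries.C (χ a) * PowerSeries.X) with hΘ
  have hΘu : IsUnit Θ := by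
    rw [PowerSeries.isUnit_iff_constantCoeff, hΘ, map_prod]
    simp
  have h1 : N K = ∑ f ∈ F, N' f := by
    apply Polynomial.coe_injective
    rw [hN K hK, hgf, Finset.mul_sum, ← Polynomial.coeToPowerSeries.ringHom_apply, map_sum]
    exact Finset.sum_congr rfl fun f hf => by
      rw [Polynomial.coeToPowerSeries.ringHom_apply, hN' f hf]
  -- The involution turns the partition of K into relative interiors into a signed identity between
  -- the interior of K and the closed faces. The denominator Θ has constant term 1 and cancels.
  have h2 := congrArg (numInvolution χ inv A) h1
  rw [numInvolution_sum, hNN' K hK, Finset.sum_congr rfl fun f hf => hN'N f hf] at h2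
  have h3 := congrArg (fun p : (AddMonoidAlgebra ℤ (ι → ℤ))[X] =>
    Polynomial.coeToPowerSeries.ringHom p) h2
  simp only [map_mul, map_sum, map_pow, map_neg, map_one] at h3
  rw [Polynomial.coeToPowerSeries.ringHom_apply, hN' K hK] at h3
  have h4 : Θ * ((-1) ^ n K * genFun w χ (S' K)) =
      Θ * ∑ f ∈ F, (-1) ^ n f * genFun w χ (S f) := by
    rw [Finset.mul_sum]
    calc _ = (-1) ^ n K * (Θ * genFun w χ (S' K)) := by ring
      _ = _ := h3
      _ = _ := Finset.sum_congr rfl fun f hf => by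
          rw [Polynomial.coeToPowerSeries.ringHom_apply, hN f hf]; ring
  have h5 := hΘu.mul_left_cancel h4
  have hcoeff : ∀ S : Set (ι → ℤ), IsGraded w S → ∀ k : ℕ,
      (PowerSeries.coeff (m ⬝ᵥ w).toNat ((-1) ^ k * genFun w χ S)).coeff m =
        (-1) ^ k * if m ∈ S then 1 else 0 := by
    intro S hS k
    have e1 : (-1 : PowerSeries (AddMonoidAlgebra ℤ (ι → ℤ))) ^ k =
        PowerSeries.C ((((-1) ^ k : ℤ) : AddMonoidAlgebra ℤ (ι → ℤ))) := by simp
    rw [e1, PowerSeries.coeff_C_mul, genFun, PowerSeries.coeff_mk,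
      finsum_mem_eq_finite_toFinset_sum _ (hS.finite _), ← zsmul_eq_mul,
      AddMonoidAlgebra.coeff_smul_apply, smul_eq_mul, AddMonoidAlgebra.coeff_sum,
      Finsupp.finsetSum_apply]
    congr 1
    simp only [χ, AddMonoidAlgebra.coeff_single, Finsupp.single_apply]
    rw [Finset.sum_ite_eq']
    simp only [Set.Finite.mem_toFinset, Set.mem_ofPred_eq, Int.toNat_of_nonneg hm, and_true]
  have h6 := congrArg (fun p : PowerSeries (AddMonoidAlgebra ℤ (ι → ℤ)) =>
    (PowerSeries.coeff (m ⬝ᵥ w).toNat p).coeff m) h5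
  rw [hcoeff _ ((h K hK).symm.isGraded hA), map_sum, AddMonoidAlgebra.coeff_sum,
    Finsupp.finsetSum_apply] at h6
  rw [h6]
  exact Finset.sum_congr rfl fun f hf => hcoeff _ ((h f hf).isGraded hA) _

end Reciprocity

/-! ### Faces of dual pairs of lattice cones -/

section ConePair

open Filter Topology

variable {ι : Type*} [Fintype ι]

/-- `C` and its dual cone are generated by the finite sets `A` and `A'` of lattice points of
degree one with respect to `w`. -/
structure IsConePair (w : ι → ℤ) (C : PointedCone ℝ (ι → ℝ)) (A A' : Finset (ι → ℤ)) : Prop where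
  eq_hull : C = PointedCone.hull ℝ (toReal '' (A : Set (ι → ℤ)))
  dual_eq : dualCone C = PointedCone.hull ℝ (toReal '' (A' : Set (ι → ℤ)))
  dual_dual : dualCone (dualCone C) = C
  deg : ∀ a ∈ A, a ⬝ᵥ w = 1
  deg' : ∀ a ∈ A', a ⬝ᵥ w = 1

theorem mem_dualCone {C : PointedCone ℝ (ι → ℝ)} {n : ι → ℝ} :
    n ∈ dualCone C ↔ ∀ m ∈ C, 0 ≤ m ⬝ᵥ n := Iff.rfl

theorem mem_dualCone_hull {S : Set (ι → ℝ)} {n : ι → ℝ} :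
    n ∈ dualCone (PointedCone.hull ℝ S) ↔ ∀ m ∈ S, 0 ≤ m ⬝ᵥ n := by
  rw [dualCone, PointedCone.dual_hull]; rfl

variable {w : ι → ℤ} {C : PointedCone ℝ (ι → ℝ)} {A A' : Finset (ι → ℤ)}

namespace IsConePair

theorem symm (h : IsConePair w C A A') : IsConePair w (dualCone C) A' A where
  eq_hull := h.dual_eq
  dual_eq := by rw [h.dual_dual]; exact h.eq_hull
  dual_dual := by rw [h.dual_dual]
  deg := h.deg'
  deg' := h.deg

theorem mem_iff (h : IsConePair w C A A') {p : ι → ℝ} :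
    p ∈ C ↔ ∀ n ∈ A', 0 ≤ p ⬝ᵥ toReal n := by
  conv_lhs => rw [← h.dual_dual, h.dual_eq]
  rw [mem_dualCone_hull, Set.forall_mem_image]
  simp_rw [dotProduct_comm p]
  rfl

theorem mem_gen (h : IsConePair w C A A') {a : ι → ℤ} (ha : a ∈ A) : toReal a ∈ C := by
  rw [h.eq_hull]; exact PointedCone.subset_hull ⟨a, ha, rfl⟩

end IsConePair

open Classical in
/-- The generators of a face. -/
def faceGens (A : Finset (ι → ℤ)) (F : PointedCone ℝ (ι → ℝ)) : Finset (ι → ℤ) :=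
  A.filter fun a => toReal a ∈ F

open Classical in
/-- The equations of a face. -/
def faceEqs (A' : Finset (ι → ℤ)) (F : PointedCone ℝ (ι → ℝ)) : Finset (ι → ℤ) :=
  A'.filter fun n => ∀ p ∈ F, p ⬝ᵥ toReal n = 0

open Classical in
/-- The inequalities which are not equations of a face. -/
def faceIneqs (A' : Finset (ι → ℤ)) (F : PointedCone ℝ (ι → ℝ)) : Finset (ι → ℤ) :=
  A'.filter fun n => ¬ ∀ p ∈ F, p ⬝ᵥ toReal n = 0

theorem mem_faceEqs {F : PointedCone ℝ (ι → ℝ)} {n : ι → ℤ} :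
    n ∈ faceEqs A' F ↔ n ∈ A' ∧ ∀ p ∈ F, p ⬝ᵥ toReal n = 0 := by
  simp [faceEqs]

theorem mem_faceIneqs {F : PointedCone ℝ (ι → ℝ)} {n : ι → ℤ} :
    n ∈ faceIneqs A' F ↔ n ∈ A' ∧ n ∉ faceEqs A' F := by
  simp only [faceIneqs, faceEqs, Finset.mem_filter, not_and]
  exact and_congr_right fun h => ⟨fun h' _ => h', fun h' => h' h⟩

theorem mem_faceGens {F : PointedCone ℝ (ι → ℝ)} {n : ι → ℤ} :
    n ∈ faceGens A F ↔ n ∈ A ∧ toReal n ∈ F := by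
  simp [faceGens]

/-- A lattice point in the relative interior of a face. -/
def faceSum (A : Finset (ι → ℤ)) (F : PointedCone ℝ (ι → ℝ)) : ι → ℤ := ∑ a ∈ faceGens A F, a

theorem toReal_faceSum_mem (A : Finset (ι → ℤ)) (F : PointedCone ℝ (ι → ℝ)) :
    toReal (faceSum A F) ∈ F := by
  rw [faceSum, toReal_sum]
  exact Submodule.sum_mem _ fun a ha => (mem_faceGens.mp ha).2

namespace IsConePair

variable {F F' : PointedCone ℝ (ι → ℝ)}

/-- If a nonnegative combination of generators lies in the face, the face property puts every
generator with positive coefficient there. -/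
theorem face_eq_hull (h : IsConePair w C A A') (hF : F.IsFaceOf C) :
    F = PointedCone.hull ℝ (toReal '' (faceGens A F : Set (ι → ℤ))) := by
  refine le_antisymm (fun p hp => ?_) (Submodule.span_le.mpr ?_)
  · have hpC := hF.le hp
    rw [h.eq_hull, mem_hull_image_iff] at hpC
    obtain ⟨x, hx, rfl⟩ := hpC
    refine Submodule.sum_mem _ fun a ha => ?_
    rcases (hx a ha).eq_or_lt with h0 | h0
    · rw [← h0, zero_smul]; exact Submodule.zero_mem _
    · have : toReal a ∈ F := by
        rw [← Finset.sum_coe_sort] at hp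
        exact hF.mem_of_sum_smul_mem (f := fun a : A => toReal a.1) (c := fun a : A => x a)
          (fun a => h.mem_gen a.2) (fun a => hx a a.2) hp ⟨a, ha⟩ h0
      exact PointedCone.smul_mem _ (hx a ha)
        (PointedCone.subset_hull ⟨a, mem_faceGens.mpr ⟨ha, this⟩, rfl⟩)
  · rintro _ ⟨a, ha, rfl⟩
    exact (mem_faceGens.mp ha).2

theorem nonneg_of_mem (h : IsConePair w C A A') (hF : F.IsFaceOf C) {p : ι → ℝ} (hp : p ∈ F)
    {n : ι → ℤ} (hn : n ∈ A') : 0 ≤ p ⬝ᵥ toReal n := h.mem_iff.mp (hF.le hp) n hn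

/-- All generators of the face pair nonnegatively with n; if their sum pairs to zero, n vanishes on
each of them and so on F. -/
theorem faceSum_pos (h : IsConePair w C A A') (hF : F.IsFaceOf C) {n : ι → ℤ}
    (hn : n ∈ faceIneqs A' F) : 0 < toReal (faceSum A F) ⬝ᵥ toReal n := by
  obtain ⟨hnA, hn⟩ := mem_faceIneqs.mp hn
  refine lt_of_le_of_ne (h.nonneg_of_mem hF (toReal_faceSum_mem A F) hnA) fun h0 => hn ?_
  refine mem_faceEqs.mpr ⟨hnA, fun p hp => ?_⟩
  rw [faceSum, toReal_sum, sum_dotProduct, eq_comm, Finset.sum_eq_zero_iff_of_nonneg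
    fun a ha => h.nonneg_of_mem hF (mem_faceGens.mp ha).2 hnA] at h0
  rw [h.face_eq_hull hF, mem_hull_image_iff] at hp
  obtain ⟨x, -, rfl⟩ := hp
  rw [sum_dotProduct]
  exact Finset.sum_eq_zero fun a ha => by rw [smul_dotProduct, h0 a ha, smul_zero]

theorem eventually_add_smul_mem (h : IsConePair w C A A') (hF : F.IsFaceOf C) {p : ι → ℝ}
    (hp : ∀ n ∈ faceEqs A' F, p ⬝ᵥ toReal n = 0) :
    ∀ᶠ e in 𝓝[>] (0 : ℝ), toReal (faceSum A F) + e • p ∈ C := by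
  filter_upwards [(Filter.eventually_all_finset (faceIneqs A' F)).mpr fun n hn =>
    eventually_pos_of_pos (p ⬝ᵥ toReal n) (h.faceSum_pos hF hn)] with e he
  refine h.mem_iff.mpr fun n hn => ?_
  rw [add_dotProduct, smul_dotProduct, smul_eq_mul]
  by_cases hn' : n ∈ faceEqs A' F
  · rw [hp n hn', (mem_faceEqs.mp hn').2 _ (toReal_faceSum_mem A F)]; simp
  · exact (he n (mem_faceIneqs.mpr ⟨hn, hn'⟩)).le

/-- If p ∈ C satisfies the equations of F, then `faceSum` - e p lies in C for small e > 0. Thus a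
point of F is the sum of e p and a point of C, and the face property gives p ∈ F. -/
theorem mem_face_iff (h : IsConePair w C A A') (hF : F.IsFaceOf C) {p : ι → ℝ} (hp : p ∈ C) :
    p ∈ F ↔ ∀ n ∈ faceEqs A' F, p ⬝ᵥ toReal n = 0 := by
  refine ⟨fun hpF n hn => (mem_faceEqs.mp hn).2 p hpF, fun hpn => ?_⟩
  obtain ⟨e, he, he0⟩ := ((h.eventually_add_smul_mem hF (p := -p) (fun n hn => by
    rw [neg_dotProduct, hpn n hn, neg_zero])).and self_mem_nhdsWithin).exists
  refine hF.mem_of_smul_add_mem hp he he0 ?_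
  rw [smul_neg, add_neg_cancel_comm_assoc]
  exact toReal_faceSum_mem A F

theorem mem_span_face_iff (h : IsConePair w C A A') (hF : F.IsFaceOf C) {p : ι → ℝ} :
    p ∈ Submodule.span ℝ (F : Set (ι → ℝ)) ↔ ∀ n ∈ faceEqs A' F, p ⬝ᵥ toReal n = 0 := by
  refine ⟨fun hp n hn => ?_, fun hp => ?_⟩
  · induction hp using Submodule.span_induction with
    | mem x hx => exact (mem_faceEqs.mp hn).2 x hx
    | zero => simp
    | add x y _ _ hx hy => rw [add_dotProduct, hx, hy, add_zero]
    | smul c x _ hx => rw [smul_dotProduct, hx, smul_zero]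
  · obtain ⟨e, he, he0⟩ := ((h.eventually_add_smul_mem hF hp).and self_mem_nhdsWithin).exists
    have he0 : 0 < e := he0
    have hF1 := toReal_faceSum_mem A F
    have hF2 : toReal (faceSum A F) + e • p ∈ F := by
      refine (h.mem_face_iff hF he).mpr fun n hn => ?_
      rw [add_dotProduct, smul_dotProduct, hp n hn, (mem_faceEqs.mp hn).2 _ hF1]; simp
    have : p = e⁻¹ • ((toReal (faceSum A F) + e • p) - toReal (faceSum A F)) := by
      rw [add_sub_cancel_left, smul_smul, inv_mul_cancel₀ he0.ne', one_smul]
    rw [this]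
    exact Submodule.smul_mem _ _ (Submodule.sub_mem _ (Submodule.subset_span hF2)
      (Submodule.subset_span hF1))

theorem mem_face_iff_of_mem_span (h : IsConePair w C A A') (hF : F.IsFaceOf C) {p : ι → ℝ}
    (hp : p ∈ Submodule.span ℝ (F : Set (ι → ℝ))) :
    p ∈ F ↔ ∀ n ∈ faceIneqs A' F, 0 ≤ p ⬝ᵥ toReal n := by
  refine ⟨fun hpF n hn => h.nonneg_of_mem hF hpF (mem_faceIneqs.mp hn).1, fun hpn => ?_⟩
  have hp0 := (h.mem_span_face_iff hF).mp hp
  refine (h.mem_face_iff hF (h.mem_iff.mpr fun n hn => ?_)).mpr hp0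
  by_cases hn' : n ∈ faceEqs A' F
  · rw [hp0 n hn']
  · exact hpn n (mem_faceIneqs.mpr ⟨hn, hn'⟩)

/-- An interior point can be moved a little in the direction -`faceSum` within F, and all the
inequalities are strict at `faceSum`. Conversely, finitely many strict inequalities define a
relatively open set. -/
theorem mem_intrinsicInterior_iff (h : IsConePair w C A A') (hF : F.IsFaceOf C) {p : ι → ℝ} :
    p ∈ intrinsicInterior ℝ (F : Set (ι → ℝ)) ↔
      p ∈ Submodule.span ℝ (F : Set (ι → ℝ)) ∧ ∀ n ∈ faceIneqs A' F, 0 < p ⬝ᵥ toReal n := by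
  have haff : ∀ x, x ∈ affineSpan ℝ (F : Set (ι → ℝ)) ↔
      x ∈ Submodule.span ℝ (F : Set (ι → ℝ)) := by
    intro x
    rw [← SetLike.mem_coe, ← SetLike.mem_coe (p := Submodule.span ℝ _), ← affineSpan_insert_zero,
      Set.insert_eq_of_mem (s := (F : Set (ι → ℝ))) F.zero_mem]
  rw [mem_intrinsicInterior]
  constructor
  · rintro ⟨y, hy, rfl⟩
    refine ⟨(haff y).mp y.2, fun n hn => ?_⟩
    let f : ℝ → affineSpan ℝ (F : Set (ι → ℝ)) := fun e =>
      ⟨y - e • toReal (faceSum A F), (haff _).mpr (Submodule.sub_mem _ ((haff y).mp y.2)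
        (Submodule.smul_mem _ _ (Submodule.subset_span (toReal_faceSum_mem A F))))⟩
    have hf : Continuous f := by
      apply Continuous.subtype_mk
      fun_prop
    have hf0 : f 0 = y := by ext; simp [f]
    have hev : ∀ᶠ e in 𝓝[>] (0 : ℝ), f e ∈ interior
        ((↑) ⁻¹' (F : Set (ι → ℝ)) : Set (affineSpan ℝ (F : Set (ι → ℝ)))) := by
      refine (hf.tendsto 0).mono_left nhdsWithin_le_nhds |>.eventually ?_
      rw [hf0]
      exact isOpen_interior.mem_nhds hy
    obtain ⟨e, he, he0⟩ := (hev.and self_mem_nhdsWithin).exists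
    have he0 : 0 < e := he0
    have h1 : (y : ι → ℝ) - e • toReal (faceSum A F) ∈ F := by
      have : f e ∈ ((↑) ⁻¹' (F : Set (ι → ℝ)) : Set (affineSpan ℝ (F : Set (ι → ℝ)))) :=
        interior_subset he
      exact this
    have h2 := h.nonneg_of_mem hF h1 (mem_faceIneqs.mp hn).1
    rw [sub_dotProduct, smul_dotProduct, smul_eq_mul] at h2
    have := mul_pos he0 (h.faceSum_pos hF hn)
    linarith
  · rintro ⟨hp, hpn⟩
    refine ⟨⟨p, (haff p).mpr hp⟩, ?_, rfl⟩
    rw [mem_interior]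
    refine ⟨{y | ∀ n ∈ faceIneqs A' F, 0 < (y : ι → ℝ) ⬝ᵥ toReal n}, fun y hy => ?_, ?_, hpn⟩
    · exact (h.mem_face_iff_of_mem_span hF ((haff y).mp y.2)).mpr fun n hn => (hy n hn).le
    · have : {y : affineSpan ℝ (F : Set (ι → ℝ)) |
          ∀ n ∈ faceIneqs A' F, 0 < (y : ι → ℝ) ⬝ᵥ toReal n} =
          ⋂ n ∈ faceIneqs A' F, {y : affineSpan ℝ (F : Set (ι → ℝ)) | 0 < (y : ι → ℝ) ⬝ᵥ toReal n} := by
        ext y; simp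
      rw [this]
      refine isOpen_biInter_finset fun n _ => isOpen_lt continuous_const ?_
      exact (continuous_id.dotProduct continuous_const).comp continuous_subtype_val

theorem faceSum_mem_intrinsicInterior (h : IsConePair w C A A') (hF : F.IsFaceOf C) :
    toReal (faceSum A F) ∈ intrinsicInterior ℝ (F : Set (ι → ℝ)) :=
  (h.mem_intrinsicInterior_iff hF).mpr
    ⟨Submodule.subset_span (toReal_faceSum_mem A F), fun _ hn => h.faceSum_pos hF hn⟩

theorem le_of_mem_intrinsicInterior (h : IsConePair w C A A') (hF : F.IsFaceOf C)
    (hF' : F'.IsFaceOf C) {p : ι → ℝ} (hp : p ∈ intrinsicInterior ℝ (F : Set (ι → ℝ)))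
    (hp' : p ∈ F') : F ≤ F' := by
  intro x hx
  refine (h.mem_face_iff hF' (hF.le hx)).mpr fun n hn => ?_
  obtain ⟨hnA, hn⟩ := mem_faceEqs.mp hn
  have h1 := (h.mem_intrinsicInterior_iff hF).mp hp
  by_cases hnF : n ∈ faceEqs A' F
  · exact (mem_faceEqs.mp hnF).2 x hx
  · exact absurd (hn p hp') (h1.2 n (mem_faceIneqs.mpr ⟨hnA, hnF⟩)).ne'

/-- The face is cut out by the inequalities that are equalities at p; the others are strict at p. -/
theorem exists_face_of_mem (h : IsConePair w C A A') {p : ι → ℝ} (hp : p ∈ C) :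
    ∃ F : PointedCone ℝ (ι → ℝ), F.IsFaceOf C ∧ p ∈ intrinsicInterior ℝ (F : Set (ι → ℝ)) := by
  let F : PointedCone ℝ (ι → ℝ) :=
    { carrier := {x | x ∈ C ∧ ∀ n ∈ A', p ⬝ᵥ toReal n = 0 → x ⬝ᵥ toReal n = 0}
      add_mem' := fun {x y} hx hy => ⟨C.add_mem hx.1 hy.1, fun n hn h0 => by
        rw [add_dotProduct, hx.2 n hn h0, hy.2 n hn h0, add_zero]⟩
      zero_mem' := ⟨C.zero_mem, fun n _ _ => zero_dotProduct _⟩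
      smul_mem' := fun c x hx => ⟨Submodule.smul_mem C c hx.1, fun n hn h0 => by
        rw [smul_dotProduct, hx.2 n hn h0, smul_zero]⟩ }
  have hFC : F.IsFaceOf C := by
    refine ⟨fun x hx => hx.1, fun {x y a} hx hy ha hxy => ⟨hx, fun n hn h0 => ?_⟩⟩
    have h1 := hxy.2 n hn h0
    rw [add_dotProduct, smul_dotProduct, smul_eq_mul] at h1
    have h2 := h.mem_iff.mp hx n hn
    have h3 := h.mem_iff.mp hy n hn
    have h4 := mul_nonneg ha.le h2
    have h5 : a * x ⬝ᵥ toReal n = 0 := by linarith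
    exact (mul_eq_zero.mp h5).resolve_left ha.ne'
  have hpF : p ∈ F := ⟨hp, fun n _ h0 => h0⟩
  refine ⟨F, hFC, (h.mem_intrinsicInterior_iff hFC).mpr ⟨Submodule.subset_span hpF, fun n hn => ?_⟩⟩
  obtain ⟨hnA, hn⟩ := mem_faceIneqs.mp hn
  refine lt_of_le_of_ne (h.mem_iff.mp hp n hnA) fun h0 => hn ?_
  exact mem_faceEqs.mpr ⟨hnA, fun x hx => hx.2 n hnA h0.symm⟩

theorem span_faceGens (h : IsConePair w C A A') (hF : F.IsFaceOf C) :
    Submodule.span ℝ (toReal '' (faceGens A F : Set (ι → ℤ))) =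
      Submodule.span ℝ (F : Set (ι → ℝ)) := by
  refine le_antisymm (Submodule.span_mono ?_) (Submodule.span_le.mpr fun p hp => ?_)
  · rintro _ ⟨a, ha, rfl⟩
    exact (mem_faceGens.mp ha).2
  · rw [SetLike.mem_coe, h.face_eq_hull hF] at hp
    exact PointedCone.hull_le_span ℝ _ hp

theorem hasConeDecomposition (h : IsConePair w C A A') (hF : F.IsFaceOf C) :
    HasConeDecomposition A (dim (F : Set (ι → ℝ))) {m | toReal m ∈ F}
      {m | toReal m ∈ intrinsicInterior ℝ (F : Set (ι → ℝ))} := by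
  have hspan := h.span_faceGens hF
  have hhull := h.face_eq_hull hF
  obtain ⟨T, J, J', h1, h2, h3, h4, h5⟩ := exists_halfOpen_decomposition (v := toReal)
    (G := faceGens A F) ((dotProductBilin ℝ ℝ).flip (toReal w)) (fun a ha => by
      change toReal a ⬝ᵥ toReal w = 1
      rw [toReal_dotProduct, h.deg a (mem_faceGens.mp ha).1, Int.cast_one])
    (faceIneqs A' F) (fun n => (dotProductBilin ℝ ℝ).flip (toReal n))
    (fun p hp => by
      rw [← hhull]
      rw [hspan] at hp
      exact h.mem_face_iff_of_mem_span hF hp)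
    ⟨toReal (faceSum A F), by
      rw [hspan]; exact Submodule.subset_span (toReal_faceSum_mem A F),
      fun n hn => h.faceSum_pos hF hn⟩
  refine ⟨T, J, J', fun σ hσ => ?_, fun m => ?_, fun m => ?_, h4, h5⟩
  · obtain ⟨hB, e1, e2, e3⟩ := h1 σ hσ
    refine ⟨fun a ha => (mem_faceGens.mp (hB.subset ha)).1, hB.indep, ?_, e1, e2, e3⟩
    have := finrank_span_eq_card hB.indep.linearIndependent
    rw [dim, ← hspan, ← hB.span_eq, Set.image_eq_range]
    exact (this.trans (by simp)).symm
  · rw [← h2, ← hhull]; rfl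
  · rw [← h3, hspan]
    exact h.mem_intrinsicInterior_iff hF

theorem finite_face (h : IsConePair w C A A') : Finite (Face C) := by
  refine Finite.of_injective (β := A.powerset)
    (fun F => ⟨faceGens A F.1, Finset.mem_powerset.mpr fun a ha => (mem_faceGens.mp ha).1⟩) ?_
  intro F F' hFF'
  have : faceGens A F.1 = faceGens A F'.1 := congrArg Subtype.val hFF'
  apply Subtype.ext
  rw [h.face_eq_hull F.2, h.face_eq_hull F'.2, this]

theorem strictMono_rank (h : IsConePair w C A A') : StrictMono (rank : Face C → ℕ) := by
  intro x y hxy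
  have hle : x.1 ≤ y.1 := hxy.le
  have hs : Submodule.span ℝ (x.1 : Set (ι → ℝ)) ≤ Submodule.span ℝ (y.1 : Set (ι → ℝ)) :=
    Submodule.span_mono hle
  refine lt_of_le_of_ne (Submodule.finrank_mono hs) fun heq => hxy.not_ge ?_
  have heq := Submodule.eq_of_le_of_finrank_eq hs heq
  intro p hp
  refine (h.mem_face_iff x.2 (y.2.le hp)).mpr ?_
  rw [← h.mem_span_face_iff x.2, heq]
  exact Submodule.subset_span hp

/-- Apply the Euler relation of the face y at a lattice point in the relative interior of x. The
faces of y which contain the point are those in [x, y], and as x < y it is not in the relative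
interior of y, so the sum is zero. -/
theorem isEulerianRank [Fintype (Face C)] (h : IsConePair w C A A') :
    IsEulerianRank (rank : Face C → ℕ) := by
  classical
  intro x y hxy
  have hmem : ∀ z : Face C, toReal (faceSum A x.1) ∈ z.1 ↔ x ≤ z := fun z =>
    ⟨fun hz => h.le_of_mem_intrinsicInterior x.2 z.2 (h.faceSum_mem_intrinsicInterior x.2) hz,
      fun hz => hz (toReal_faceSum_mem A x.1)⟩
  have hint : ∀ z : Face C, toReal (faceSum A x.1) ∈ intrinsicInterior ℝ (z.1 : Set (ι → ℝ)) →
      z ≤ x := fun z hz => h.le_of_mem_intrinsicInterior z.2 x.2 hz (toReal_faceSum_mem A x.1)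
  have key := sum_neg_one_pow_faces (w := w) (Finset.univ.filter (· ≤ y)) y h.deg
    (fun z : Face C => rank z) (fun z => {m | toReal m ∈ z.1})
    (fun z => {m | toReal m ∈ intrinsicInterior ℝ (z.1 : Set (ι → ℝ))})
    (fun z _ => h.hasConeDecomposition z.2) (by simp) (fun m => ?_) (fun m f _ g _ hf hg => ?_)
    (faceSum A x.1) ?_
  · rw [finsum_mem_eq_sum_of_inter_support_eq (t := Finset.univ.filter (· ∈ Set.Icc x y)) _
      (by ext; simp)]
    simp only [Set.mem_ofPred_eq] at key
    rw [if_neg (fun h' => hxy.not_ge (hint y h')), mul_zero] at key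
    rw [key]
    simp only [hmem, mul_ite, mul_one, mul_zero]
    rw [← Finset.sum_filter, Finset.filter_filter]
    refine Finset.sum_congr ?_ fun _ _ => rfl
    ext z; simp [and_comm]
  · simp only [Set.mem_ofPred_eq, Finset.mem_filter, Finset.mem_univ, true_and]
    constructor
    · intro hm
      obtain ⟨F, hF, hmF⟩ := h.exists_face_of_mem (y.2.le hm)
      exact ⟨⟨F, hF⟩, h.le_of_mem_intrinsicInterior hF y.2 hmF hm, hmF⟩
    · rintro ⟨z, hz, hm⟩
      exact hz (intrinsicInterior_subset hm)
  · exact Subtype.ext (le_antisymm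
      (h.le_of_mem_intrinsicInterior f.2 g.2 hf (intrinsicInterior_subset hg))
      (h.le_of_mem_intrinsicInterior g.2 f.2 hg (intrinsicInterior_subset hf)))
  · rw [faceSum, sum_dotProduct]
    exact Finset.sum_nonneg fun a ha => by rw [h.deg a (mem_faceGens.mp ha).1]; exact zero_le_one

theorem rank_le_card (x : Face C) : rank x ≤ Fintype.card ι := by
  rw [rank, dim, ← Module.finrank_fintype_fun_eq_card (R := ℝ)]
  exact Submodule.finrank_le _

/-- The face of the dual cone which corresponds to a face. -/
def dualFaceCone (x : Face C) : Face (dualCone C) :=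
  ⟨{ carrier := dualFace x
     add_mem' := fun {a b} ha hb => ⟨(dualCone C).add_mem ha.1 hb.1, fun m hm => by
       rw [dotProduct_add, ha.2 m hm, hb.2 m hm, add_zero]⟩
     zero_mem' := ⟨(dualCone C).zero_mem, fun m _ => dotProduct_zero _⟩
     smul_mem' := fun c a ha => ⟨Submodule.smul_mem (dualCone C) c ha.1, fun m hm => by
       rw [dotProduct_smul, ha.2 m hm, smul_zero]⟩ },
   ⟨fun _ hn => hn.1, fun {a b c} ha hb hc hab => ⟨ha, fun m hm => by
     have h1 := hab.2 m hm
     rw [dotProduct_add, dotProduct_smul, smul_eq_mul] at h1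
     have h2 := mem_dualCone.mp ha m (x.2.le hm)
     have h3 := mem_dualCone.mp hb m (x.2.le hm)
     have h4 := mul_nonneg hc.le h2
     have h5 : c * m ⬝ᵥ a = 0 := by linarith
     exact (mul_eq_zero.mp h5).resolve_left hc.ne'⟩⟩⟩

theorem coe_dualFaceCone (x : Face C) : ((dualFaceCone x).1 : Set (ι → ℝ)) = dualFace x := rfl

/-- The equations of x are exactly the generators of the dual face, so the span of x is the
orthogonal complement of the span of the dual face. -/
theorem dim_dualFace (h : IsConePair w C A A') (x : Face C) :
    dim (dualFace x) = Fintype.card ι - rank x := by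
  have hgens : faceGens A' (dualFaceCone x).1 = faceEqs A' x.1 := by
    ext n
    rw [mem_faceGens, mem_faceEqs]
    exact and_congr_right fun hn => ⟨fun h' => h'.2, fun h' => ⟨h.symm.mem_gen hn, h'⟩⟩
  let B : LinearMap.BilinForm ℝ (ι → ℝ) := dotProductBilin ℝ ℝ
  have hBr : B.IsRefl := fun a b hab => by
    change b ⬝ᵥ a = 0
    rw [dotProduct_comm]; exact hab
  have hB : B.Nondegenerate := by
    refine hBr.nondegenerate_iff_separatingLeft.mpr fun a ha => ?_
    exact dotProduct_eq_zero a ha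
  have hs : Submodule.span ℝ (x.1 : Set (ι → ℝ)) =
      B.orthogonal (Submodule.span ℝ (dualFace x)) := by
    rw [← coe_dualFaceCone, ← h.symm.span_faceGens (dualFaceCone x).2, hgens]
    ext p
    rw [h.mem_span_face_iff x.2, LinearMap.BilinForm.mem_orthogonal_iff]
    constructor
    · intro hp n hn
      change n ⬝ᵥ p = 0
      induction hn using Submodule.span_induction with
      | mem n hn =>
        obtain ⟨a, ha, rfl⟩ := hn
        rw [dotProduct_comm]; exact hp a ha
      | zero => simp
      | add a b _ _ ha hb => rw [add_dotProduct, ha, hb, add_zero]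
      | smul c a _ ha => rw [smul_dotProduct, ha, smul_zero]
    · intro hp n hn
      rw [dotProduct_comm]
      exact hp _ (Submodule.subset_span ⟨n, hn, rfl⟩)
  have h1 := LinearMap.BilinForm.finrank_orthogonal hB (Submodule.span ℝ (dualFace x))
  rw [← hs, Module.finrank_fintype_fun_eq_card] at h1
  have h2 := Submodule.finrank_le (Submodule.span ℝ (dualFace x))
  rw [Module.finrank_fintype_fun_eq_card] at h2
  simp only [rank, dim]
  omega

end IsConePair

end ConePair

/-! ### The cone pair of a nef partition -/

section Bipolar

variable {ι : Type*} [Fintype ι] {w : ι → ℤ} {A : Finset (ι → ℤ)}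

/-- Near p the degree is bounded, and so are the nonnegative coefficients, which sum to it. Locally
the cone is thus contained in the image of a compact box of coefficients. -/
theorem isClosed_hull (hA : ∀ a ∈ A, a ⬝ᵥ w = 1) :
    IsClosed (PointedCone.hull ℝ (toReal '' (A : Set (ι → ℤ))) : Set (ι → ℝ)) := by
  refine isClosed_of_closure_subset fun p hp => ?_
  let U : Set (ι → ℝ) := {q | q ⬝ᵥ toReal w < p ⬝ᵥ toReal w + 1}
  have hU : IsOpen U := isOpen_lt (continuous_id.dotProduct continuous_const) continuous_const
  let K : Set (ι → ℝ) := (fun x : A → ℝ => ∑ a : A, x a • toReal a.1) ''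
    Set.Icc 0 (fun _ => p ⬝ᵥ toReal w + 1)
  have hK : IsCompact K := isCompact_Icc.image (by fun_prop)
  have hpU : p ∈ U := by simp [U]
  have hpK : p ∈ closure (U ∩ (PointedCone.hull ℝ (toReal '' (A : Set (ι → ℤ))) : Set (ι → ℝ))) :=
    hU.inter_closure ⟨hpU, hp⟩
  have hsub : U ∩ (PointedCone.hull ℝ (toReal '' (A : Set (ι → ℤ))) : Set (ι → ℝ)) ⊆ K := by
    rintro q ⟨hqU, hq⟩
    rw [SetLike.mem_coe, mem_hull_image_iff] at hq
    obtain ⟨x, hx, rfl⟩ := hq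
    refine ⟨fun a => x a, ⟨fun a => hx a a.2, fun a => ?_⟩,
      Finset.sum_coe_sort A fun a => x a • toReal a⟩
    have h1 : (∑ b ∈ A, x b • toReal b) ⬝ᵥ toReal w = ∑ b ∈ A, x b := by
      rw [sum_dotProduct]
      refine Finset.sum_congr rfl fun b hb => ?_
      rw [smul_dotProduct, toReal_dotProduct, hA b hb]; simp
    have h2 : ∑ b ∈ A, x b < p ⬝ᵥ toReal w + 1 := h1 ▸ hqU
    exact (Finset.single_le_sum hx a.2).trans h2.le
  obtain ⟨x, hx, rfl⟩ := closure_minimal hsub hK.isClosed hpK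
  rw [SetLike.mem_coe, mem_hull_image_iff]
  classical
  refine ⟨fun a => if h : a ∈ A then x ⟨a, h⟩ else 0, fun a ha => ?_, ?_⟩
  · simpa [ha] using hx.1 ⟨a, ha⟩
  · rw [← Finset.sum_coe_sort A]
    exact Finset.sum_congr rfl fun a _ => by simp

/-- The bipolar theorem: a point outside the closed cone is separated from it by a linear form, and
this form belongs to the dual cone. -/
theorem dualCone_dualCone_hull (hA : ∀ a ∈ A, a ⬝ᵥ w = 1) :
    dualCone (dualCone (PointedCone.hull ℝ (toReal '' (A : Set (ι → ℤ))))) =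
      PointedCone.hull ℝ (toReal '' (A : Set (ι → ℤ))) := by
  refine le_antisymm (fun p hp => ?_) (fun p hp n hn => ?_)
  · by_contra hpC
    obtain ⟨f, hf, hfp⟩ := ProperCone.hyperplane_separation_point
      (⟨PointedCone.hull ℝ (toReal '' (A : Set (ι → ℤ))), isClosed_hull hA⟩ : ProperCone ℝ _) hpC
    classical
    have hfd : ∀ x, f x = x ⬝ᵥ fun i => f fun j => if i = j then 1 else 0 := fun x =>
      LinearMap.pi_apply_eq_sum_univ f.toLinearMap x
    have h1 : (fun i => f fun j => if i = j then 1 else 0) ∈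
        dualCone (PointedCone.hull ℝ (toReal '' (A : Set (ι → ℤ)))) := by
      rw [mem_dualCone]
      intro m hm
      rw [← hfd]
      exact hf m hm
    have h2 := mem_dualCone.mp hp _ h1
    rw [dotProduct_comm, ← hfd] at h2
    exact absurd hfp h2.not_gt
  · change 0 ≤ n ⬝ᵥ p
    rw [dotProduct_comm]
    exact mem_dualCone.mp hn p hp

end Bipolar

/-! ### Normal cones and support functions of a polytope with bounded polar. -/

section Polytope

open Topology

variable {d : ℕ} {Δ : Set (Fin d → ℝ)} {s : Finset (Fin d → ℤ)}

theorem mem_polar_convexHull_iff {x : Fin d → ℝ} :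
    x ∈ polar (convexHull ℝ (toReal '' (s : Set (Fin d → ℤ)))) ↔ ∀ y ∈ s, -1 ≤ toReal y ⬝ᵥ x := by
  refine ⟨fun hx y hy => hx _ (subset_convexHull ℝ _ ⟨y, hy, rfl⟩), fun hx y hy => ?_⟩
  have hc : Convex ℝ {y : Fin d → ℝ | -1 ≤ y ⬝ᵥ x} :=
    convex_halfSpace_ge ⟨fun a b => add_dotProduct a b x, fun c a => smul_dotProduct c a x⟩ _
  refine convexHull_min ?_ hc hy
  rintro _ ⟨y, hy, rfl⟩
  exact hx y hy

theorem zero_mem_polar : (0 : Fin d → ℝ) ∈ polar Δ := fun y _ => by simp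

/-- Otherwise the whole ray through z would lie in the bounded polar set. -/
theorem exists_dotProduct_neg
    (hb : Bornology.IsBounded (polar (convexHull ℝ (toReal '' (s : Set (Fin d → ℤ))))))
    {z : Fin d → ℝ} (hz : z ≠ 0) : ∃ y ∈ s, toReal y ⬝ᵥ z < 0 := by
  by_contra! h
  obtain ⟨R, hR⟩ := hb.exists_norm_le
  have hR0 : 0 ≤ R := by simpa using hR 0 zero_mem_polar
  have h1 : ((R + 1) / ‖z‖) • z ∈ polar (convexHull ℝ (toReal '' (s : Set (Fin d → ℤ)))) := by
    refine mem_polar_convexHull_iff.mpr fun y hy => ?_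
    rw [dotProduct_smul, smul_eq_mul]
    have := mul_nonneg (a := (R + 1) / ‖z‖) (by positivity) (h y hy)
    linarith
  have h2 := hR _ h1
  rw [norm_smul, Real.norm_of_nonneg (by positivity), div_mul_cancel₀ _ (norm_ne_zero_iff.mpr hz)]
    at h2
  linarith

/-- The cone of the linear forms which attain their minimum on `s` at `y`. -/
def normalCone (s : Finset (Fin d → ℤ)) (y : Fin d → ℤ) : Set (Fin d → ℝ) :=
  {z | ∀ y' ∈ s, toReal y ⬝ᵥ z ≤ toReal y' ⬝ᵥ z}

/-- The face of the polar set on which `y` takes the value `-1`. -/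
def polarFace (Δ : Set (Fin d → ℝ)) (y : Fin d → ℤ) : Set (Fin d → ℝ) :=
  {x | x ∈ polar Δ ∧ toReal y ⬝ᵥ x = -1}

theorem isClosed_normalCone (y : Fin d → ℤ) : IsClosed (normalCone s y) := by
  have : normalCone s y =
      ⋂ y' ∈ s, {z : Fin d → ℝ | toReal y ⬝ᵥ z ≤ toReal y' ⬝ᵥ z} := by
    ext z; simp [normalCone]
  rw [this]
  exact isClosed_biInter fun y' _ => isClosed_le (continuous_const.dotProduct continuous_id)
    (continuous_const.dotProduct continuous_id)

theorem isExposed_polarFace {y : Fin d → ℤ} (hy : toReal y ∈ Δ) :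
    IsExposed ℝ (polar Δ) (polarFace Δ y) := by
  rintro ⟨x₀, hx₀, hx₀'⟩
  refine ⟨-(LinearMap.toContinuousLinearMap (dotProductBilin ℝ ℝ (toReal y))), ?_⟩
  ext x
  change x ∈ polar Δ ∧ _ ↔ x ∈ polar Δ ∧ ∀ y' ∈ polar Δ, -(toReal y ⬝ᵥ y') ≤ -(toReal y ⬝ᵥ x)
  refine and_congr_right fun hx => ⟨fun h x' hx' => ?_, fun h => ?_⟩
  · have := hx' _ hy
    linarith
  · have h1 := h x₀ hx₀
    have h2 := hx _ hy
    linarith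

theorem polarFace_ne (y : Fin d → ℤ) : polarFace Δ y ≠ polar Δ := fun h => by
  have h0 : (0 : Fin d → ℝ) ∈ polarFace Δ y := h ▸ zero_mem_polar
  have := h0.2
  simp at this

/-- The minimum of z on s is negative, and scaling z so that this minimum becomes -1 moves z to the
face of the polar. So the domains of linearity of the support functions contain the normal cones. -/
theorem normalCone_eq_zero_or
    (hb : Bornology.IsBounded (polar (convexHull ℝ (toReal '' (s : Set (Fin d → ℤ))))))
    {y : Fin d → ℤ} {z : Fin d → ℝ} (hz : z ∈ normalCone s y) :
    z = 0 ∨ ∃ c : ℝ, 0 < c ∧ c • z ∈ polarFace (convexHull ℝ (toReal '' (s : Set (Fin d → ℤ)))) y := by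
  refine or_iff_not_imp_left.mpr fun hz0 => ?_
  obtain ⟨y₁, hy₁, hneg⟩ := exists_dotProduct_neg hb hz0
  have hneg : toReal y ⬝ᵥ z < 0 := (hz y₁ hy₁).trans_lt hneg
  refine ⟨(-(toReal y ⬝ᵥ z))⁻¹, by simpa using hneg, mem_polar_convexHull_iff.mpr fun y' hy' => ?_, ?_⟩
  · have h1 := hz y' hy'
    rw [dotProduct_smul, smul_eq_mul, inv_mul_eq_div, le_div_iff₀ (by linarith)]
    linarith
  · rw [dotProduct_smul, smul_eq_mul, inv_neg, neg_mul, inv_mul_cancel₀ hneg.ne]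

/-- Krein-Milman; the closure is superfluous since there are only finitely many extreme points. -/
theorem convexHull_extremePoints_of_finite {E : Type*} [AddCommGroup E] [Module ℝ E]
    [TopologicalSpace E] [IsTopologicalAddGroup E] [ContinuousSMul ℝ E] [LocallyConvexSpace ℝ E]
    [T2Space E] {S : Set E} (hS : S.Finite) :
    convexHull ℝ ((convexHull ℝ S).extremePoints ℝ) = convexHull ℝ S := by
  have h := closure_convexHull_extremePoints (hS.isCompact_convexHull ℝ) (convex_convexHull ℝ S)
  have hfin : ((convexHull ℝ S).extremePoints ℝ).Finite := hS.subset (extremePoints_convexHull_subset (𝕜 := ℝ))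
  rwa [(hfin.isClosed_convexHull ℝ).closure_eq] at h

/-- Finitely many closed normal cones cover the space, so by Baire their interiors have dense union.
The closures of these interiors, being finite in number, still cover. -/
theorem exists_normalCone_interior (hs : s.Nonempty) (z : Fin d → ℝ) :
    ∃ y ∈ s, (interior (normalCone s y)).Nonempty ∧ z ∈ normalCone s y := by
  have hU : ⋃ y : s, normalCone s y.1 = Set.univ := by
    refine Set.eq_univ_of_forall fun z => ?_
    obtain ⟨y, hy, hmin⟩ := s.exists_min_image (fun y => toReal y ⬝ᵥ z) hs
    exact Set.mem_iUnion.mpr ⟨⟨y, hy⟩, hmin⟩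
  have hd := dense_iUnion_interior_of_closed (fun y : s => isClosed_normalCone (s := s) y.1) hU
  have hz : z ∈ closure (⋃ y : s, interior (normalCone s y.1)) := hd z
  rw [closure_iUnion_of_finite] at hz
  obtain ⟨y, hy⟩ := Set.mem_iUnion.mp hz
  exact ⟨y, y.2, closure_nonempty_iff.mp ⟨z, hy⟩,
    closure_minimal interior_subset (isClosed_normalCone _) hy⟩

/-- Take p in the interior of N and continue the segment from z to p slightly beyond p, staying in
N. Convexity on this segment, with linear values at its two points in N, bounds φ z from below. -/
theorem dotProduct_le_of_convexOn {φ : (Fin d → ℝ) → ℝ} (hφ : ConvexOn ℝ Set.univ φ)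
    {m : Fin d → ℝ} {N : Set (Fin d → ℝ)} (hN : (interior N).Nonempty)
    (hφN : ∀ z ∈ N, φ z = m ⬝ᵥ z) (z : Fin d → ℝ) : m ⬝ᵥ z ≤ φ z := by
  obtain ⟨p, hp⟩ := hN
  have hev : ∀ᶠ e in 𝓝[>] (0 : ℝ), p + e • (p - z) ∈ N := by
    have : Continuous fun e : ℝ => p + e • (p - z) := by fun_prop
    refine ((this.tendsto 0).mono_left nhdsWithin_le_nhds).eventually ?_
    simpa using mem_interior_iff_mem_nhds.mp hp
  obtain ⟨e, he, he0⟩ := (hev.and self_mem_nhdsWithin).exists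
  have he0 : 0 < e := he0
  have h1 := hφ.2 (Set.mem_univ z) (Set.mem_univ (p + e • (p - z))) 
    (show 0 ≤ e / (1 + e) by positivity) (show 0 ≤ 1 / (1 + e) by positivity) (by field_simp; ring)
  have h2 : (e / (1 + e)) • z + (1 / (1 + e)) • (p + e • (p - z)) = p := by
    ext i
    simp only [Pi.add_apply, Pi.smul_apply, Pi.sub_apply, smul_eq_mul]
    field_simp
    ring
  rw [h2, hφN _ (interior_subset hp), hφN _ he, dotProduct_add, dotProduct_smul, dotProduct_sub,
    smul_eq_mul, smul_eq_mul, smul_eq_mul, div_mul_eq_mul_div, div_mul_eq_mul_div, ← add_div,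
    le_div_iff₀ (by positivity)] at h1
  have h3 : 0 ≤ e * (φ z - m ⬝ᵥ z) := by linarith
  have := nonneg_of_mul_nonneg_right h3 he0
  linarith

end Polytope

/-! ### Degree-one generators of the Gorenstein cone of a nef partition and of its dual. -/

section NefPartition

variable {d r : ℕ}

theorem sumElim_dotProduct_degreeVector (i : Fin r) (m : Fin d → ℤ) :
    Sum.elim (Pi.single i 1) m ⬝ᵥ degreeVector r d = 1 := by
  simp [degreeVector, dotProduct, Fintype.sum_sum_type]

theorem toReal_sumElim_dotProduct (i : Fin r) (m : Fin d → ℤ) (n : Fin r ⊕ Fin d → ℝ) :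
    toReal (Sum.elim (Pi.single i 1) m) ⬝ᵥ n =
      n (Sum.inl i) + toReal m ⬝ᵥ (fun j => n (Sum.inr j)) := by
  simp [toReal, dotProduct, Fintype.sum_sum_type, Pi.single_apply]

theorem toReal_sumElim (i : Fin r) (m : Fin d → ℤ) :
    toReal (Sum.elim (Pi.single i 1) m) = Sum.elim (Pi.single i 1) (toReal m) := by
  ext (j | j)
  · simp [toReal, Pi.single_apply]
  · simp [toReal]

/-- With m i y the linear form of φ_i on the normal cone of y, the generators of C are (e_i, -m i
y), for those y whose normal cone has interior; the generators of C* are (e_i, 0), and (e_i, e) for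
e in E_i. What needs proof is that every form nonnegative on the first family is a nonnegative
combination of the second; the bipolar theorem does the rest. -/
theorem IsNefPartition.exists_isConePair {Δ : Set (Fin d → ℝ)} {D : Fin r → Set (Fin d → ℝ)}
    (hD : IsNefPartition Δ D) :
    ∃ A A', IsConePair (degreeVector r d) (gorensteinCone D) A A' := by
  classical
  obtain ⟨⟨⟨s, hs, rfl⟩, t, ht, hQ⟩, E, φ, hE, hdisj, hφ, hφ1, hφ0, hDφ⟩ := hD
  set Δ := convexHull ℝ (toReal '' (s : Set (Fin d → ℤ))) with hΔ
  have htfin : (toReal '' (t : Set (Fin d → ℤ))).Finite := t.finite_toSet.image _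
  have hb : Bornology.IsBounded (polar Δ) := hQ ▸ (htfin.isCompact_convexHull ℝ).isBounded
  have hext : (polar Δ).extremePoints ℝ ⊆ toReal '' (t : Set (Fin d → ℤ)) :=
    hQ ▸ extremePoints_convexHull_subset (𝕜 := ℝ)
  have hyΔ : ∀ y ∈ s, toReal y ∈ Δ := fun y hy => subset_convexHull ℝ _ ⟨y, hy, rfl⟩
  choose m hm using fun (i : Fin r) (y : s) =>
    (hφ i).2 _ (isExposed_polarFace (hyΔ y y.2)) (polarFace_ne y.1)
  have hmN : ∀ i (y : s), ∀ z ∈ normalCone s y.1, φ i z = toReal (m i y) ⬝ᵥ z := fun i y z hz =>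
    hm i y z (normalCone_eq_zero_or hb hz)
  -- Interior is needed so that convexity of φ_i gives m i y ≤ φ_i everywhere, which means that -m i
  -- y lies in `D i`.
  let s₀ : Finset s := Finset.univ.filter fun y => (interior (normalCone s y.1)).Nonempty
  have hs₀ : ∀ z, ∃ y ∈ s₀, z ∈ normalCone s y.1 := fun z => by
    obtain ⟨y, hy, hi, hz⟩ := exists_normalCone_interior hs z
    exact ⟨⟨y, hy⟩, by simp [s₀, hi], hz⟩
  have hmφ : ∀ i, ∀ y ∈ s₀, toReal (-m i y) ∈ D i := fun i y hy => by
    rw [hDφ]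
    intro z
    have := dotProduct_le_of_convexOn (hφ i).1 (Finset.mem_filter.mp hy).2 (hmN i y) z
    have h2 : toReal (-m i y) = -toReal (m i y) := by ext j; simp [toReal]
    rw [h2, neg_dotProduct]
    linarith
  let t₀ : Finset (Fin d → ℤ) := t.filter fun e => toReal e ∈ (polar Δ).extremePoints ℝ
  have ht₀ : toReal '' (t₀ : Set (Fin d → ℤ)) = (polar Δ).extremePoints ℝ := by
    ext x
    constructor
    · rintro ⟨e, he, rfl⟩
      exact (Finset.mem_filter.mp he).2
    · intro hx
      obtain ⟨e, he, rfl⟩ := hext hx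
      exact ⟨e, Finset.mem_filter.mpr ⟨he, hx⟩, rfl⟩
  let A : Finset (Fin r ⊕ Fin d → ℤ) :=
    (Finset.univ ×ˢ s₀).image fun p => Sum.elim (Pi.single p.1 1) (-m p.1 p.2)
  let A' : Finset (Fin r ⊕ Fin d → ℤ) :=
    (Finset.univ : Finset (Fin r)).image (fun i => Sum.elim (Pi.single i 1) 0) ∪
      ((Finset.univ ×ˢ t₀).filter fun p => toReal p.2 ∈ E p.1).image
        fun p => Sum.elim (Pi.single p.1 1) p.2
  have hA1 : ∀ a ∈ A, a ⬝ᵥ degreeVector r d = 1 := by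
    intro a ha
    obtain ⟨p, -, rfl⟩ := Finset.mem_image.mp ha
    exact sumElim_dotProduct_degreeVector _ _
  have hA'1 : ∀ a ∈ A', a ⬝ᵥ degreeVector r d = 1 := by
    intro a ha
    rcases Finset.mem_union.mp ha with ha | ha <;> obtain ⟨p, -, rfl⟩ := Finset.mem_image.mp ha <;>
    exact sumElim_dotProduct_degreeVector _ _
  have hAC : PointedCone.hull ℝ (toReal '' (A : Set (Fin r ⊕ Fin d → ℤ))) ≤ gorensteinCone D := by
    refine Submodule.span_le.mpr ?_
    rintro _ ⟨a, ha, rfl⟩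
    obtain ⟨⟨i, y⟩, hy, rfl⟩ := Finset.mem_image.mp ha
    have hy : y ∈ s₀ := (Finset.mem_product.mp hy).2
    refine PointedCone.subset_hull ⟨Pi.single i 1, fun j => toReal (-m j y), fun j => ?_,
      fun j => hmφ j y hy, ?_⟩
    · by_cases h : j = i
      · subst h; simp
      · simp [h]
    · rw [toReal_sumElim]
      congr 1
      simp [Pi.single_apply, ite_smul]
  have hCA' : ∀ p ∈ gorensteinSet D, ∀ n ∈ A', 0 ≤ p ⬝ᵥ toReal n := by
    rintro _ ⟨a, z, ha, hz, rfl⟩ n hn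
    rw [dotProduct_comm]
    rcases Finset.mem_union.mp hn with hn | hn
    · obtain ⟨i, -, rfl⟩ := Finset.mem_image.mp hn
      rw [toReal_sumElim_dotProduct, toReal_zero, zero_dotProduct, add_zero]
      exact ha i
    · obtain ⟨⟨i, e⟩, he, rfl⟩ := Finset.mem_image.mp hn
      have heE : toReal e ∈ E i := (Finset.mem_filter.mp he).2
      rw [toReal_sumElim_dotProduct]
      simp only [Sum.elim_inl, Sum.elim_inr]
      have h1 : toReal e ⬝ᵥ (fun j => (∑ k, a k • z k) j) = ∑ k, a k * (z k ⬝ᵥ toReal e) := by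
        change toReal e ⬝ᵥ (∑ k, a k • z k) = _
        rw [dotProduct_comm, sum_dotProduct]
        exact Finset.sum_congr rfl fun k _ => by rw [smul_dotProduct, smul_eq_mul]
      have h2 : ∑ k, a k * -(φ k (toReal e)) ≤ ∑ k, a k * (z k ⬝ᵥ toReal e) :=
        Finset.sum_le_sum fun k _ => mul_le_mul_of_nonneg_left (by
          have := hz k
          rw [hDφ] at this
          exact this _) (ha k)
      have h3 : ∑ k, a k * -(φ k (toReal e)) = -a i := by
        rw [Finset.sum_eq_single i]
        · rw [hφ1 i _ heE]; ring
        · intro k _ hk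
          rw [hφ0 k _ (hE ▸ Set.mem_iUnion.mpr ⟨i, heE⟩)
            (fun hk' => Set.disjoint_left.mp (hdisj hk) hk' heE)]
          ring
        · simp
      rw [h1]
      linarith
  have hdual : dualCone (PointedCone.hull ℝ (toReal '' (A : Set (Fin r ⊕ Fin d → ℤ)))) ≤
      PointedCone.hull ℝ (toReal '' (A' : Set (Fin r ⊕ Fin d → ℤ))) := by
    intro n hn
    rw [mem_dualCone_hull] at hn
    -- Let z be the last d coordinates of n, and let y be a point of `s₀` whose normal cone contains
    -- z. Then m i y takes the value φ_i(z) at z, and nonnegativity of n on (e_i, -m i y) says that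
    -- its i-th coordinate is at least φ_i(z).
    obtain ⟨y, hy, hz⟩ := hs₀ fun j => n (Sum.inr j)
    have hb0 : ∀ i, 0 ≤ n (Sum.inl i) - toReal (m i y) ⬝ᵥ (fun j => n (Sum.inr j)) := fun i => by
      have h1 := hn _ ⟨_, Finset.mem_image.mpr ⟨(i, y), Finset.mem_product.mpr
        ⟨Finset.mem_univ _, hy⟩, rfl⟩, rfl⟩
      rw [toReal_sumElim_dotProduct] at h1
      have h2 : toReal (-m i y) = -toReal (m i y) := by ext j; simp [toReal]
      rw [h2, neg_dotProduct] at h1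
      linarith
    obtain ⟨x, hx0, hxz, hxy⟩ : ∃ x : (Fin d → ℤ) → ℝ, (∀ e ∈ t₀, 0 ≤ x e) ∧
        (fun j => n (Sum.inr j)) = ∑ e ∈ t₀, x e • toReal e ∧
        ∀ e ∈ t₀, x e ≠ 0 → toReal e ∈ polarFace Δ y := by
      have hconv : convexHull ℝ ((t₀.image toReal : Finset (Fin d → ℝ)) : Set (Fin d → ℝ)) =
          polar Δ := by
        rw [Finset.coe_image, ht₀, hQ, convexHull_extremePoints_of_finite htfin]
      rcases normalCone_eq_zero_or hb hz with h0 | ⟨c, hc, hcz, hcy⟩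
      · exact ⟨0, fun _ _ => le_rfl, by simp [h0], fun _ _ h => absurd rfl h⟩
      · rw [← hΔ, ← hconv, Finset.mem_convexHull'] at hcz
        obtain ⟨x, hx0, hx1, hxz⟩ := hcz
        rw [Finset.sum_image toReal_injective.injOn] at hx1 hxz
        have hx0 : ∀ e ∈ t₀, 0 ≤ x (toReal e) := fun e he => hx0 _ (Finset.mem_image_of_mem _ he)
        -- Each summand is nonnegative, so a convex combination lying on the face where y equals -1
        -- involves only vertices of this face; there all φ_i are linear.
        have hsum : ∑ e ∈ t₀, x (toReal e) * (toReal y.1 ⬝ᵥ toReal e + 1) = 0 := by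
          rw [← hxz, dotProduct_sum] at hcy
          simp only [dotProduct_smul, smul_eq_mul] at hcy
          simp only [mul_add, mul_one]
          rw [Finset.sum_add_distrib, hcy, hx1, neg_add_cancel]
        have hpol : ∀ e ∈ t₀, toReal e ∈ polar Δ := fun e he =>
          extremePoints_subset (Finset.mem_filter.mp he).2
        rw [Finset.sum_eq_zero_iff_of_nonneg fun e he => mul_nonneg (hx0 e he) (by
          have := hpol e he _ (hyΔ y y.2)
          linarith)] at hsum
        refine ⟨fun e => c⁻¹ * x (toReal e), fun e he => mul_nonneg (by positivity) (hx0 e he),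
          ?_, fun e he hne => ⟨hpol e he, ?_⟩⟩
        · simp only [mul_smul]
          rw [← Finset.smul_sum, hxz, smul_smul, inv_mul_cancel₀ hc.ne', one_smul]
        · have := (mul_eq_zero.mp (hsum e he)).resolve_left (right_ne_zero_of_mul hne)
          linarith
    have hmz : ∀ i, toReal (m i y) ⬝ᵥ (fun j => n (Sum.inr j)) =
        ∑ e ∈ t₀, if toReal e ∈ E i then x e else 0 := fun i => by
      rw [hxz, dotProduct_sum]
      refine Finset.sum_congr rfl fun e he => ?_
      rw [dotProduct_smul, smul_eq_mul]
      by_cases hxe : x e = 0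
      · simp [hxe]
      · rw [← hm i y (toReal e) (Or.inr ⟨1, one_pos, by rw [one_smul]; exact hxy e he hxe⟩)]
        split_ifs with heE
        · rw [hφ1 i _ heE, mul_one]
        · rw [hφ0 i _ (Finset.mem_filter.mp he).2 heE, mul_zero]
    -- The part of the i-th coordinate in excess of φ_i(z) goes to (e_i, 0). Since φ_i(z) is the sum
    -- of x e over e in E_i, the vectors (e_i, e) account for the remainder, each vertex e belonging
    -- to exactly one E_i.
    have hn_eq : n = ∑ i, (n (Sum.inl i) - toReal (m i y) ⬝ᵥ (fun j => n (Sum.inr j))) •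
          toReal (Sum.elim (Pi.single i 1) (0 : Fin d → ℤ)) +
        ∑ p ∈ (Finset.univ ×ˢ t₀).filter fun p : Fin r × (Fin d → ℤ) => toReal p.2 ∈ E p.1,
          x p.2 • toReal (Sum.elim (Pi.single p.1 1) p.2) := by
      rw [Finset.sum_filter, Finset.sum_product]
      ext (i | j)
      · simp only [toReal_sumElim, Pi.add_apply, Finset.sum_apply, Pi.smul_apply, Sum.elim_inl,
          smul_eq_mul, apply_ite (fun f : Fin r ⊕ Fin d → ℝ => f (Sum.inl i)), Pi.zero_apply]
        rw [Finset.sum_eq_single i (fun k _ hk => by simp [hk.symm]) (by simp),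
          Finset.sum_eq_single i (fun k _ hk => Finset.sum_eq_zero fun e _ => by
            simp [hk.symm]) (by simp), hmz]
        simp
      · simp only [toReal_sumElim, Pi.add_apply, Finset.sum_apply, Pi.smul_apply, Sum.elim_inr,
          smul_eq_mul, apply_ite (fun f : Fin r ⊕ Fin d → ℝ => f (Sum.inr j)), Pi.zero_apply,
          toReal_zero, mul_zero, Finset.sum_const_zero, zero_add]
        rw [Finset.sum_comm]
        have h1 := congrFun hxz j
        simp only [Finset.sum_apply, Pi.smul_apply, smul_eq_mul] at h1
        rw [h1]
        refine Finset.sum_congr rfl fun e he => ?_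
        obtain ⟨i, hi⟩ := Set.mem_iUnion.mp (hE ▸ (Finset.mem_filter.mp he).2)
        rw [Finset.sum_eq_single i _ (by simp), if_pos hi]
        intro k _ hk
        rw [if_neg fun hk' => Set.disjoint_left.mp (hdisj hk) hk' hi]
    rw [hn_eq]
    refine Submodule.add_mem _ (Submodule.sum_mem _ fun i _ => PointedCone.smul_mem _ (hb0 i)
      (PointedCone.subset_hull ⟨_, Finset.mem_union_left _ (Finset.mem_image_of_mem _
        (Finset.mem_univ i)), rfl⟩)) (Submodule.sum_mem _ fun p hp => PointedCone.smul_mem _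
      (hx0 _ (Finset.mem_product.mp (Finset.mem_filter.mp hp).1).2)
      (PointedCone.subset_hull ⟨_, Finset.mem_union_right _ (Finset.mem_image_of_mem _ hp), rfl⟩))
  have hle : PointedCone.hull ℝ (toReal '' (A' : Set (Fin r ⊕ Fin d → ℤ))) ≤
      dualCone (gorensteinCone D) := by
    refine Submodule.span_le.mpr ?_
    rintro _ ⟨n, hn, rfl⟩
    exact mem_dualCone_hull.mpr fun p hp => hCA' p hp n hn
  -- The dual of C lies in the dual of hull A, which lies in hull A', which lies in the dual of C;
  -- so all three are equal.
  have hdual2 : dualCone (gorensteinCone D) =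
      PointedCone.hull ℝ (toReal '' (A' : Set (Fin r ⊕ Fin d → ℤ))) :=
    le_antisymm (fun n hn => hdual fun m hm => hn (hAC hm)) hle
  have hC : gorensteinCone D = PointedCone.hull ℝ (toReal '' (A : Set (Fin r ⊕ Fin d → ℤ))) := by
    refine le_antisymm ?_ hAC
    rw [← dualCone_dualCone_hull hA1]
    intro p hp n hn
    change 0 ≤ n ⬝ᵥ p
    rw [dotProduct_comm]
    exact mem_dualCone.mp (hle (hdual hn)) p hp
  exact ⟨A, A', hC, hdual2, by rw [hC, dualCone_dualCone_hull hA1], hA1, hA'1⟩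

end NefPartition

/-! ### Evaluation of the generating functions -/

section Analytic

open Polynomial

/-- Induction on n: removing one factor 1 - X is convolution with the geometric series, and Cauchy
products of absolutely convergent series behave well. -/
theorem summable_and_tsum_of_mul_one_sub_X_pow {n : ℕ} {p : ℤ[X]} {a : ℕ → ℤ}
    (h : (p : PowerSeries ℤ) = (1 - PowerSeries.X) ^ n * PowerSeries.mk a) {s : ℂ} (hs : ‖s‖ < 1) :
    Summable (fun k => ‖(a k : ℂ) * s ^ k‖) ∧
      (1 - s) ^ n * ∑' k, (a k : ℂ) * s ^ k = aeval s p := by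
  induction n generalizing a with
  | zero =>
    have ha : ∀ k, a k = p.coeff k := fun k => by
      have := congrArg (PowerSeries.coeff k) h
      simpa using this.symm
    have h0 : ∀ k ∉ p.support, (a k : ℂ) * s ^ k = 0 := fun k hk => by
      rw [ha, Polynomial.notMem_support_iff.mp hk]; simp
    refine ⟨summable_of_ne_finset_zero (s := p.support) fun k hk => by rw [h0 k hk, norm_zero], ?_⟩
    rw [pow_zero, one_mul, tsum_eq_sum h0, aeval_eq_sum_range, ← Polynomial.sum_over_range' p
      (f := fun k c => (c : ℤ) • s ^ k) (by simp) _ (Nat.lt_succ_self _), Polynomial.sum]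
    exact Finset.sum_congr rfl fun k _ => by rw [ha]; simp
  | succ n ih =>
    let b : ℕ → ℤ := fun k => PowerSeries.coeff k ((1 - PowerSeries.X) * PowerSeries.mk a)
    have hb : PowerSeries.mk b = (1 - PowerSeries.X) * PowerSeries.mk a := by ext; simp [b]
    obtain ⟨h1, h2⟩ := ih (a := b) (by rw [h, hb]; ring)
    have hgeom : Summable fun k : ℕ => ‖s ^ k‖ := by
      simpa [norm_pow] using summable_geometric_of_norm_lt_one (x := ‖s‖) (by simpa using hs)
    have hab : ∀ k, (a k : ℂ) * s ^ k =
        ∑ ij ∈ Finset.HasAntidiagonal.antidiagonal k, s ^ ij.1 * ((b ij.2 : ℂ) * s ^ ij.2) := fun k => by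
      have h3 : PowerSeries.mk a = PowerSeries.mk 1 * PowerSeries.mk b := by
        rw [hb, ← mul_assoc, PowerSeries.mk_one_mul_one_sub_eq_one, one_mul]
      have h4 : a k = ∑ ij ∈ Finset.HasAntidiagonal.antidiagonal k, b ij.2 := by
        have := congrArg (PowerSeries.coeff k) h3
        rw [PowerSeries.coeff_mul] at this
        simpa using this
      rw [h4, Int.cast_sum, Finset.sum_mul]
      refine Finset.sum_congr rfl fun ij hij => ?_
      rw [← Finset.HasAntidiagonal.mem_antidiagonal.mp hij, pow_add]
      ring
    simp_rw [hab]
    refine ⟨summable_norm_sum_mul_antidiagonal_of_summable_norm (f := fun k => s ^ k)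
      (g := fun k => (b k : ℂ) * s ^ k) hgeom h1, ?_⟩
    have h1s : 1 - s ≠ 0 := fun h0 => by
      rw [← sub_eq_zero.mp h0, norm_one] at hs
      exact lt_irrefl _ hs
    rw [← tsum_mul_tsum_eq_tsum_sum_antidiagonal_of_summable_norm (f := fun k => s ^ k)
      (g := fun k => (b k : ℂ) * s ^ k) hgeom h1,
      tsum_geometric_of_norm_lt_one hs, ← h2, pow_succ]
    field_simp

theorem summable_and_tsum_of_fibers {T : Type*} (f : T → ℕ) (hf : ∀ k, Finite {m // f m = k})
    {s : ℂ} (hs : Summable fun k => ‖(Nat.card {m // f m = k} : ℂ) * s ^ k‖) :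
    Summable (fun m => ‖s ^ f m‖) ∧
      ∑' m, s ^ f m = ∑' k, (Nat.card {m // f m = k} : ℂ) * s ^ k := by
  -- Stated over a general field because it is used over ℝ for the norms and over ℂ for the values.
  have key : ∀ (R : Type) [NormedField R] (x : R) (k : ℕ),
      ∑' m : {m // f m = k}, x ^ f m.1 = (Nat.card {m // f m = k} : R) * x ^ k := by
    intro R _ x k
    have := Fintype.ofFinite {m // f m = k}
    rw [tsum_fintype, Finset.sum_congr rfl fun m _ => by rw [m.2], Finset.sum_const,
      Finset.card_univ, Nat.card_eq_fintype_card, nsmul_eq_mul]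
  have h1 : Summable fun p : Σ k, {m // f m = k} => ‖s ^ f p.2.1‖ := by
    refine (summable_sigma_of_nonneg fun _ => norm_nonneg _).mpr
      ⟨fun k => Summable.of_finite, ?_⟩
    simp only [norm_pow]
    simp_rw [key ℝ ‖s‖]
    simpa using hs
  refine ⟨(Equiv.sigmaFiberEquiv f).summable_iff.mp h1, ?_⟩
  rw [← (Equiv.sigmaFiberEquiv f).tsum_eq]
  change ∑' p : Σ k, {m // f m = k}, s ^ f p.2.1 = _
  rw [Summable.tsum_sigma (Summable.of_norm h1)]
  exact tsum_congr fun k => key ℂ s k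

end Analytic

/-! ### The polynomials S and the series of interior lattice points. -/

section SPoly

open Polynomial

variable {ι : Type*} [Fintype ι] {w : ι → ℤ} {A : Finset (ι → ℤ)}

theorem genFun_one {S : Set (ι → ℤ)} (hS : IsGraded w S) :
    genFun w (fun _ => (1 : ℤ)) S =
      PowerSeries.mk fun k => (Nat.card {m // m ∈ S ∧ m ⬝ᵥ w = (k : ℤ)} : ℤ) := by
  ext k
  rw [genFun, PowerSeries.coeff_mk, PowerSeries.coeff_mk]
  rw [← Nat.cast_one, ← Nat.cast_finsum_mem (hS.finite k), finsum_one]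
  rfl

theorem exists_eq_sSeries {F : Set (ι → ℝ)} (hA : ∀ a ∈ A, a ⬝ᵥ w = 1)
    (h : HasConeDecomposition A (dim F) {m | toReal m ∈ F}
      {m | toReal m ∈ intrinsicInterior ℝ F}) :
    ∃ p : ℤ[X], (p : PowerSeries ℤ) = sSeries w F := by
  obtain ⟨p, -, hp, -⟩ := h.exists_sPoly hA
  exact ⟨p, by rw [hp, genFun_one (h.isGraded hA)]; rfl⟩

theorem coe_sPoly {F : Set (ι → ℝ)} (hA : ∀ a ∈ A, a ⬝ᵥ w = 1)
    (h : HasConeDecomposition A (dim F) {m | toReal m ∈ F}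
      {m | toReal m ∈ intrinsicInterior ℝ F}) :
    (sPoly w F : PowerSeries ℤ) = sSeries w F := by
  have h := exists_eq_sSeries hA h
  rw [sPoly, dif_pos h]
  exact h.choose_spec

theorem sPoly_reciprocity {F : Set (ι → ℝ)} (hA : ∀ a ∈ A, a ⬝ᵥ w = 1)
    (h : HasConeDecomposition A (dim F) {m | toReal m ∈ F}
      {m | toReal m ∈ intrinsicInterior ℝ F}) :
    (sPoly w F).natDegree ≤ dim F ∧
      (reflect (dim F) (sPoly w F) : PowerSeries ℤ) = (1 - PowerSeries.X) ^ dim F *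
        PowerSeries.mk fun k =>
          (Nat.card {m // toReal m ∈ intrinsicInterior ℝ F ∧ m ⬝ᵥ w = (k : ℤ)} : ℤ) := by
  obtain ⟨p, hp, hp1, hp2⟩ := h.exists_sPoly hA
  have hps : sPoly w F = p := by
    apply Polynomial.coe_injective
    rw [coe_sPoly hA h, hp1, genFun_one (h.isGraded hA)]
    rfl
  rw [hps]
  exact ⟨hp, by rw [hp2, genFun_one (h.symm.isGraded hA)]; rfl⟩

/-- Analytic form of Ehrhart reciprocity: the series of the interior points has the reflected
polynomial as numerator, and reflection at s is s ^ dim F times evaluation at s⁻¹. -/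
theorem summable_and_tsum_intPoints {F : Set (ι → ℝ)} (hA : ∀ a ∈ A, a ⬝ᵥ w = 1)
    (h : HasConeDecomposition A (dim F) {m | toReal m ∈ F}
      {m | toReal m ∈ intrinsicInterior ℝ F}) {s : ℂ} (hs0 : s ≠ 0) (hs : ‖s‖ < 1) :
    Summable (fun m : IntPoints F => ‖s ^ (m.1 ⬝ᵥ w)‖) ∧
      (1 - s) ^ dim F * ∑' m : IntPoints F, s ^ (m.1 ⬝ᵥ w) =
        s ^ dim F * aeval s⁻¹ (sPoly w F) := by
  have hG := h.symm.isGraded hA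
  obtain ⟨hdeg, hr⟩ := sPoly_reciprocity hA h
  obtain ⟨h1, h2⟩ := summable_and_tsum_of_mul_one_sub_X_pow hr hs
  let f : IntPoints F → ℕ := fun m => (m.1 ⬝ᵥ w).toNat
  have hf : ∀ m : IntPoints F, m.1 ⬝ᵥ w = (f m : ℤ) := fun m =>
    (Int.toNat_of_nonneg (hG.nonneg m.1 m.2)).symm
  have hfk : ∀ (m : IntPoints F) (k : ℕ), f m = k ↔ m.1 ⬝ᵥ w = (k : ℤ) := fun m k => by
    rw [hf, Nat.cast_inj]
  let e : ∀ k : ℕ, {m // f m = k} ≃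
      {m : ι → ℤ // toReal m ∈ intrinsicInterior ℝ F ∧ m ⬝ᵥ w = (k : ℤ)} := fun k =>
    (Equiv.subtypeEquivRight fun m => hfk m k).trans
      (Equiv.subtypeSubtypeEquivSubtypeInter
        (fun m : ι → ℤ => toReal m ∈ intrinsicInterior ℝ F) (fun m => m ⬝ᵥ w = (k : ℤ)))
  have hfin : ∀ k, Finite {m // f m = k} := fun k => by
    have : Finite {m : ι → ℤ // toReal m ∈ intrinsicInterior ℝ F ∧ m ⬝ᵥ w = (k : ℤ)} :=
      (hG.finite k).to_subtype
    exact Finite.of_equiv _ (e k).symm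
  have hcard : ∀ k, Nat.card {m // f m = k} =
      Nat.card {m : ι → ℤ // toReal m ∈ intrinsicInterior ℝ F ∧ m ⬝ᵥ w = (k : ℤ)} := fun k =>
    Nat.card_congr (e k)
  simp only [Int.cast_natCast, ← hcard] at h1 h2
  obtain ⟨h3, h4⟩ := summable_and_tsum_of_fibers f hfin h1
  simp only [hf, zpow_natCast]
  refine ⟨h3, ?_⟩
  rw [h4, h2, aeval_reflect (mul_inv_cancel₀ hs0) hdeg]

end SPoly

/-! ### Values of Laurent polynomials -/

section Laurent

open Polynomial

/-- Evaluation at a pair of nonzero complex numbers as a ring homomorphism. -/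
def evalHom {u v : ℂ} (hu : u ≠ 0) (hv : v ≠ 0) : Laurent →ₐ[ℤ] ℂ :=
  AddMonoidAlgebra.lift ℤ ℂ (ℤ × ℤ)
    { toFun := fun p => u ^ p.toAdd.1 * v ^ p.toAdd.2
      map_one' := by simp
      map_mul' := fun p q => by
        simp only [toAdd_mul, Prod.fst_add, Prod.snd_add, zpow_add₀ hu, zpow_add₀ hv]
        ring }

theorem evalHom_apply {u v : ℂ} (hu : u ≠ 0) (hv : v ≠ 0) (E : Laurent) :
    evalHom hu hv E = evalAt u v E := by
  rw [evalHom, AddMonoidAlgebra.lift_apply, evalAt]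
  refine Finsupp.sum_congr fun p _ => ?_
  simp [mul_assoc]

theorem evalHom_mon {u v : ℂ} (hu : u ≠ 0) (hv : v ≠ 0) (a b : ℤ) :
    evalHom hu hv (mon a b) = u ^ a * v ^ b := by
  rw [evalHom, mon, AddMonoidAlgebra.lift_single]
  simp

/-- On the curve v = u^K with K large, distinct monomials restrict to distinct powers of u. The
points u = 2, 3, … of this curve lie in the domain and give infinitely many roots of a polynomial
with the same coefficients. -/
theorem eq_zero_of_evalAt {E : Laurent}
    (hE : ∀ u v : ℂ, 0 < ‖u‖ → ‖u‖ < ‖v‖ → 1 < ‖u * v‖ → evalAt u v E = 0) : E = 0 := by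
  classical
  obtain ⟨M, hM⟩ : ∃ M : ℕ, ∀ p ∈ E.coeff.support, |p.1| ≤ M ∧ |p.2| ≤ M := by
    refine ⟨∑ p ∈ E.coeff.support, (p.1.natAbs + p.2.natAbs), fun p hp => ?_⟩
    have := Finset.single_le_sum (f := fun p : ℤ × ℤ => p.1.natAbs + p.2.natAbs)
      (fun _ _ => Nat.zero_le _) hp
    rw [Int.abs_eq_natAbs, Int.abs_eq_natAbs]
    constructor <;> omega
  -- K exceeds every difference of two exponents of u, which separates the monomials, and K > 1
  -- gives |u| < |v|. The shift N makes all exponents nonnegative.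
  let K : ℕ := 2 * M + 2
  let N : ℕ := M + K * M
  have hN : ∀ p ∈ E.coeff.support, 0 ≤ p.1 + K * p.2 + N := fun p hp => by
    obtain ⟨h1, h2⟩ := hM p hp
    have h3 := (abs_le.mp h1).1
    have h4 : -((K : ℤ) * M) ≤ K * p.2 := by
      rw [← mul_neg]
      exact mul_le_mul_of_nonneg_left (abs_le.mp h2).1 (by positivity)
    simp only [N]
    push_cast
    linarith
  let e : ℤ × ℤ → ℕ := fun p => (p.1 + K * p.2 + N).toNat
  have he : ∀ p ∈ E.coeff.support, ((e p : ℕ) : ℤ) = p.1 + K * p.2 + N := fun p hp =>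
    Int.toNat_of_nonneg (hN p hp)
  have hinj : Set.InjOn e (E.coeff.support : Set (ℤ × ℤ)) := by
    intro p hp q hq hpq
    have h := he p hp
    rw [hpq, he q hq] at h
    obtain ⟨h1, h2⟩ := hM p hp
    obtain ⟨h3, h4⟩ := hM q hq
    rw [abs_le] at h1 h3
    have h5 : q.1 - p.1 = K * (p.2 - q.2) := by linear_combination h
    have h7 : q.1 - p.1 = 0 := by
      refine Int.eq_zero_of_abs_lt_dvd (m := (K : ℤ)) ⟨_, h5⟩ (abs_lt.mpr ?_)
      constructor <;> omega
    have h6 : p.2 - q.2 = 0 :=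
      (mul_eq_zero.mp (h5.symm.trans h7)).resolve_left (by omega)
    exact Prod.ext (by omega) (by omega)
  let P : ℂ[X] := ∑ p ∈ E.coeff.support, monomial (e p) (E.coeff p : ℂ)
  have hP : P = 0 := by
    refine Polynomial.eq_zero_of_infinite_isRoot P ?_
    refine Set.Infinite.mono (s := (fun n : ℕ => ((n + 2 : ℕ) : ℂ)) '' Set.univ) ?_
      (Set.infinite_univ.image (fun a _ b _ hab => by simpa using hab))
    rintro _ ⟨n, -, rfl⟩
    set x : ℂ := ((n + 2 : ℕ) : ℂ) with hx
    have hx1 : 1 < ‖x‖ := by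
      rw [hx, Complex.norm_natCast]
      push_cast
      have : (0 : ℝ) ≤ n := Nat.cast_nonneg n
      linarith
    have hx0 : x ≠ 0 := norm_pos_iff.mp (zero_lt_one.trans hx1)
    have h1 := hE x (x ^ K) (zero_lt_one.trans hx1) (by
      rw [norm_pow]
      exact lt_self_pow₀ hx1 (by omega)) (by
      rw [← pow_succ', norm_pow]
      exact one_lt_pow₀ hx1 (by omega))
    change P.eval x = 0
    have h2 : P.eval x = x ^ N * evalAt x (x ^ K) E := by
      rw [evalAt, Finsupp.sum, eval_finsetSum, Finset.mul_sum]
      refine Finset.sum_congr rfl fun p hp => ?_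
      rw [eval_monomial, ← zpow_natCast x (e p), he p hp, zpow_add₀ hx0, zpow_add₀ hx0, zpow_mul,
        zpow_natCast, zpow_natCast]
      ring
    rw [h2, h1, mul_zero]
  have hc : ∀ p, E.coeff p = 0 := fun p => by
    by_contra hp
    have hp' : p ∈ E.coeff.support := Finsupp.mem_support_iff.mpr hp
    have h1 : P.coeff (e p) = E.coeff p := by
      rw [finsetSum_coeff, Finset.sum_eq_single p]
      · rw [coeff_monomial, if_pos rfl]
      · intro q hq hqp
        rw [coeff_monomial, if_neg fun h => hqp (hinj hq hp' h)]
      · exact fun h => absurd hp' h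
    rw [hP, coeff_zero] at h1
    exact hp (by exact_mod_cast h1.symm)
  ext p
  exact hc p

end Laurent

/-! ### The Batyrev-Borisov sum of a cone pair -/

section BBSum

open Polynomial

variable {ι : Type*} [Fintype ι] {w : ι → ℤ} {C : PointedCone ℝ (ι → ℝ)} {A A' : Finset (ι → ℤ)}

namespace IsConePair

theorem dual_hasConeDecomposition (h : IsConePair w C A A') (x : Face C) :
    HasConeDecomposition A' (dim (dualFace x)) {n | toReal n ∈ dualFace x}
      {n | toReal n ∈ intrinsicInterior ℝ (dualFace x)} := by
  have h1 := h.symm.hasConeDecomposition (dualFaceCone x).2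
  rw [coe_dualFaceCone] at h1
  exact h1

theorem strictMono_dualRank (h : IsConePair w C A A') :
    StrictMono (dualRank : (Face C)ᵒᵈ → ℕ) := by
  have := h.finite_face
  have := Fintype.ofFinite (Face C)
  exact StrictMono.dual_sub h.strictMono_rank rank_le_card

theorem isEulerianRank_dual [Fintype (Face C)] (h : IsConePair w C A A') :
    IsEulerianRank (dualRank : (Face C)ᵒᵈ → ℕ) :=
  IsEulerianRank.dual_sub h.isEulerianRank rank_le_card

/-- The series is the product of two absolutely convergent ones, at s = u/v and s = 1/(uv). As v - u
= v (1 - s) and uv - 1 = uv (1 - s) respectively, reciprocity leaves the powers v^k (u/v)^k = u^k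
and (uv)^l (uv)^(-l) = 1. -/
theorem summable_and_tsum_aTerm (h : IsConePair w C A A') {u v : ℂ} (hu : 0 < ‖u‖)
    (huv : ‖u‖ < ‖v‖) (huv1 : 1 < ‖u * v‖) (x y : Face C) :
    Summable (aTerm w u v x y) ∧
      (v - u) ^ rank x * (u * v - 1) ^ (Fintype.card ι - rank y) * ∑' p, aTerm w u v x y p =
        u ^ rank x * aeval (v / u) (sPoly w (x.1 : Set (ι → ℝ))) *
          aeval (u * v) (sPoly w (dualFace y)) := by
  have hu0 : u ≠ 0 := norm_pos_iff.mp hu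
  have hv0 : v ≠ 0 := norm_pos_iff.mp (hu.trans huv)
  have huv0 : u * v ≠ 0 := mul_ne_zero hu0 hv0
  obtain ⟨h1, h2⟩ := summable_and_tsum_intPoints h.deg (h.hasConeDecomposition x.2)
    (s := u / v) (div_ne_zero hu0 hv0) (by rwa [norm_div, div_lt_one (hu.trans huv)])
  obtain ⟨h3, h4⟩ := summable_and_tsum_intPoints h.deg' (h.dual_hasConeDecomposition y)
    (s := 1 / (u * v)) (one_div_ne_zero huv0) (by
      rw [norm_div, norm_one, div_lt_one (zero_lt_one.trans huv1)]
      exact huv1)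
  have key : ∀ (f : IntPoints (x.1 : Set (ι → ℝ)) → ℂ) (g : IntPoints (dualFace y) → ℂ),
      (aTerm w u v x y = fun p => f p.1 * g p.2) → Summable (fun m => ‖f m‖) →
      Summable (fun n => ‖g n‖) → Summable (aTerm w u v x y) ∧
        ∑' p, aTerm w u v x y p = (∑' m, f m) * ∑' n, g n := by
    intro f g hfg hf hg
    rw [hfg]
    exact ⟨summable_mul_of_summable_norm hf hg, (tsum_mul_tsum_of_summable_norm hf hg).symm⟩
  obtain ⟨h10, h11⟩ := key _ _ rfl h1 h3
  refine ⟨h10, ?_⟩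
  rw [h11, ← h.dim_dualFace y, rank]
  generalize (∑' m : IntPoints (x.1 : Set (ι → ℝ)), (u / v) ^ (m.1 ⬝ᵥ w)) = X at h2 ⊢
  generalize (∑' n : IntPoints (dualFace y), (1 / (u * v)) ^ (n.1 ⬝ᵥ w)) = Y at h4 ⊢
  have h6 : v - u = v * (1 - u / v) := by field_simp
  have h7 : u * v - 1 = (u * v) * (1 - 1 / (u * v)) := by field_simp
  rw [h6, h7, mul_pow, mul_pow]
  rw [inv_div] at h2
  rw [one_div, inv_inv, ← one_div] at h4
  have h8 : v ^ dim (x.1 : Set (ι → ℝ)) * (u / v) ^ dim (x.1 : Set (ι → ℝ)) =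
      u ^ dim (x.1 : Set (ι → ℝ)) := by
    rw [← mul_pow, mul_div_cancel₀ _ hv0]
  have h9 : (u * v) ^ dim (dualFace y) * (1 / (u * v)) ^ dim (dualFace y) = 1 := by
    rw [← mul_pow, mul_one_div_cancel huv0, one_pow]
  calc _ = v ^ dim (x.1 : Set (ι → ℝ)) * ((1 - u / v) ^ dim (x.1 : Set (ι → ℝ)) *
        X) *
      ((u * v) ^ dim (dualFace y) * ((1 - 1 / (u * v)) ^ dim (dualFace y) *
        Y)) := by ring
    _ = (v ^ dim (x.1 : Set (ι → ℝ)) * (u / v) ^ dim (x.1 : Set (ι → ℝ))) *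
        aeval (v / u) (sPoly w (x.1 : Set (ι → ℝ))) *
        (((u * v) ^ dim (dualFace y) * (1 / (u * v)) ^ dim (dualFace y)) *
          aeval (u * v) (sPoly w (dualFace y))) := by
      rw [h2, h4]; ring
    _ = _ := by rw [h8, h9, one_mul]

/-- Term by term, with k = ρ(y) - ρ(x): the duality of B contributes (-u)^k and the series
contribute u^ρ(x), so that (-1)^ρ(y) (-u)^k u^ρ(x) = (-1)^ρ(x) u^ρ(y). -/
theorem bbSum_eq (h : IsConePair w C A A') (r : ℕ) {u v : ℂ} (hu : 0 < ‖u‖)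
    (huv : ‖u‖ < ‖v‖) (huv1 : 1 < ‖u * v‖) :
    bbSum w r C u v = ∑ᶠ I : NonemptyInterval (Face C),
      (-1) ^ rank I.fst * u ^ rank I.snd / (u * v) ^ r *
        aeval (v / u) (sPoly w (I.fst.1 : Set (ι → ℝ))) *
        aeval (u * v) (sPoly w (dualFace I.snd)) *
        MvPolynomial.aeval ![u⁻¹, v] (bPoly rank I.fst I.snd) := by
  have hfin := h.finite_face
  have := Fintype.ofFinite (Face C)
  refine finsum_congr fun I => ?_
  have hle := h.strictMono_rank.monotone I.fst_le_snd
  obtain ⟨-, h1⟩ := h.summable_and_tsum_aTerm hu huv huv1 I.fst I.snd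
  have h2 := aeval_bPoly_dual h.strictMono_rank h.strictMono_dualRank h.isEulerianRank
    h.isEulerianRank_dual (fun x y hxy => by
      have h3 := h.strictMono_rank.monotone hxy
      have h4 := rank_le_card y
      simp only [dualRank, OrderDual.ofDual_toDual]
      omega) v (mul_inv_cancel₀ (norm_pos_iff.mp hu)) I.fst_le_snd
  rw [h2]
  obtain ⟨k, hk⟩ := Nat.exists_eq_add_of_le hle
  rw [hk, Nat.add_sub_cancel_left, ← hk, neg_pow u]
  have h5 : (-1 : ℂ) ^ rank I.snd * (-1) ^ k = (-1) ^ rank I.fst := by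
    rw [hk, pow_add, mul_assoc, ← mul_pow]; simp
  have h6 : u ^ rank I.snd = u ^ rank I.fst * u ^ k := by rw [hk, pow_add]
  calc _ = ((-1 : ℂ) ^ rank I.snd * (-1) ^ k) * u ^ k / (u * v) ^ r *
        MvPolynomial.aeval ![u⁻¹, v] (bPoly rank I.fst I.snd) *
        ((v - u) ^ rank I.fst * (u * v - 1) ^ (Fintype.card ι - rank I.snd) *
          ∑' p, aTerm w u v I.fst I.snd p) := by ring
    _ = _ := by rw [h5, h1, h6]; ring

end IsConePair

end BBSum

theorem evalAt_endFormula {d r : ℕ} {D : Fin r → Set (Fin d → ℝ)}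
    [Finite (Face (gorensteinCone D))] {u v : ℂ} (hu : u ≠ 0) (hv : v ≠ 0) :
    evalAt u v (endFormula D) = ∑ᶠ I : NonemptyInterval (Face (gorensteinCone D)),
      (-1) ^ rank I.fst * u ^ rank I.snd / (u * v) ^ r *
        Polynomial.aeval (v / u)
          (sPoly (degreeVector r d) (I.fst.1 : Set (Fin r ⊕ Fin d → ℝ))) *
        Polynomial.aeval (u * v) (sPoly (degreeVector r d) (dualFace I.snd)) *
        MvPolynomial.aeval ![u⁻¹, v] (bPoly rank I.fst I.snd) := by
  have : Finite (NonemptyInterval (Face (gorensteinCone D))) :=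
    Finite.of_injective _ NonemptyInterval.toProd_injective
  rw [← evalHom_apply hu hv, endFormula, map_finsum _ (Set.toFinite _)]
  refine finsum_congr fun I => ?_
  simp only [map_mul, map_pow, map_neg, map_one, evalHom_mon, ← Polynomial.aeval_algHom_apply]
  rw [MvPolynomial.comp_aeval_apply]
  have h1 : (fun i => evalHom hu hv (![mon (-1) 0, mon 0 1] i)) = ![u⁻¹, v] := by
    ext i
    fin_cases i <;> simp [evalHom_mon]
  have h2 : u ^ (-1 : ℤ) * v ^ (1 : ℤ) = v / u := by
    rw [zpow_neg_one, zpow_one, inv_mul_eq_div]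
  rw [h1, h2]
  simp only [zpow_one, zpow_zero, mul_one, zpow_natCast, zpow_neg, ← mul_inv, ← mul_pow,
    div_eq_mul_inv]

end

end StringyE

/-- The first four clauses say that the face poset is finite and that the `S`- and `B`-polynomials
in the two formulas exist; the last one says that there is exactly one `E`-polynomial, and that it
is given by the formula in terms of `S` and `B`. -/
theorem mainTheorem2 {d r : ℕ} (Δ : Set (Fin d → ℝ)) (D : Fin r → Set (Fin d → ℝ))
    (hD : StringyE.IsNefPartition Δ D) :
    Finite (StringyE.Face (StringyE.gorensteinCone D)) ∧
    (∀ x : StringyE.Face (StringyE.gorensteinCone D),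
      (StringyE.sPoly (StringyE.degreeVector r d) (x.1 : Set (Fin r ⊕ Fin d → ℝ)) :
          PowerSeries ℤ) =
        StringyE.sSeries (StringyE.degreeVector r d) (x.1 : Set (Fin r ⊕ Fin d → ℝ)) ∧
      (StringyE.sPoly (StringyE.degreeVector r d) (StringyE.dualFace x) : PowerSeries ℤ) =
        StringyE.sSeries (StringyE.degreeVector r d) (StringyE.dualFace x)) ∧
    StringyE.IsBFamily (P := StringyE.Face (StringyE.gorensteinCone D)) StringyE.rank
      (StringyE.bPoly StringyE.rank) ∧
    StringyE.IsBFamily (P := (StringyE.Face (StringyE.gorensteinCone D))ᵒᵈ) StringyE.dualRank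
      (StringyE.bPoly StringyE.dualRank) ∧
    ∀ E : StringyE.Laurent,
      StringyE.IsStringyEPolynomial D E ↔ E = StringyE.endFormula D := by
  obtain ⟨A, A', h⟩ := hD.exists_isConePair
  have hfin := h.finite_face
  have := Fintype.ofFinite (StringyE.Face (StringyE.gorensteinCone D))
  refine ⟨hfin, fun x => ⟨StringyE.coe_sPoly h.deg (h.hasConeDecomposition x.2),
      StringyE.coe_sPoly h.deg' (h.dual_hasConeDecomposition x)⟩,
    StringyE.isBFamily_bPoly h.strictMono_rank h.isEulerianRank,
    StringyE.isBFamily_bPoly h.strictMono_dualRank h.isEulerianRank_dual, fun E => ?_⟩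
  have hend : ∀ u v : ℂ, 0 < ‖u‖ → ‖u‖ < ‖v‖ → 1 < ‖u * v‖ →
      StringyE.evalAt u v (StringyE.endFormula D) =
        StringyE.bbSum (StringyE.degreeVector r d) r (StringyE.gorensteinCone D) u v :=
    fun u v hu huv huv1 => by
      rw [StringyE.evalAt_endFormula (norm_pos_iff.mp hu) (norm_pos_iff.mp (hu.trans huv)),
        h.bbSum_eq r hu huv huv1]
  constructor
  · intro hE
    refine sub_eq_zero.mp (StringyE.eq_zero_of_evalAt fun u v hu huv huv1 => ?_)
    have h1 := (hE u v hu huv huv1).2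
    rw [← hend u v hu huv huv1] at h1
    simp only [← StringyE.evalHom_apply (norm_pos_iff.mp hu) (norm_pos_iff.mp (hu.trans huv))]
      at h1 ⊢
    rw [map_sub, h1, sub_self]
  · rintro rfl u v hu huv huv1
    exact ⟨fun x y _ => (h.summable_and_tsum_aTerm hu huv huv1 x y).1, hend u v hu huv huv1⟩
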